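/- Let $M$ be a non-empty complex manifold, $p:L\to M$ a holomorphic line bundle with smooth Hermitian metric $h$ and curvature form $\gamma=-\sqrt{-1}\,\partial\bar\partial\log h$, and let $\omega_M$ be a Kähler form on $M$. Let $I\subset\mathbf R$ be an interval with non-empty interior such that $\omega_M-s\gamma$ is positive for every $s\in I$ (so $\{p,I\}$ are horizontal data), and let $\varphi$ be a momentum profile on $I$, that is, a function smooth on the closure of $I$ and positive on the interior of $I$. Let $\widehat L=\mathbf P(\mathcal O\oplus L)\supset L$ be the completion of $L$, let $r:\widehat L\to[0,\infty]$ be the continuous extension of the squared norm function, let $L^\times=\{0<r<\infty\}$, and put $t=\frac12\log r$ on $L^\times$. An invariant subbundle is a domain $L'=r^{-1}(\mathrm J)\subset\widehat L$ with $\mathrm J\subset[0,\infty]$ an open interval. Let $X$ be the generator of the circle action rotating the fibres, normalized by $\exp(2\pi X)=1$. Kähler forms and metrics are related by $g(v,w)=\omega(v,Jw)$. For an interval $I_0\subset\mathbf R$, consider pairs $(L',g)$ consisting of an invariant subbundle $L'\subset\widehat L$ and a Kähler metric $g$ on $L'$, with Kähler form $\omega$, such that: (i) $\omega$ arises from the Calabi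 ansatz: $\omega=p^*\omega_M+2\sqrt{-1}\,\partial\bar\partial f(t)$ on $L'\cap L^\times$, for a smooth function $f$ of one real variable; (ii) there is a smooth function $\tau$ on $L'$ with $\tau=f'(t)$ on $L'\cap L^\times$ that is a moment map, $i_X\omega=-d\tau$, and whose image $\tau(L')$ is $I_0$; (iii) $g(X,X)=\varphi(\tau)$. Then: (a) For $I_0$ equal to the interior of $I$ (hence for $I_0=I$ if $I$ is open) such a pair $(L',g)$ exists. It is unique up to homothety and isometry: for any two such pairs $(L_1,g_1)$, $(L_2,g_2)$ there is $a>0$ such that the fibrewise homothety $v\mapsto av$ of $\widehat L$ maps $L_1$ onto $L_2$ and is an isometry from $g_1$ to $g_2$. (b) Suppose that at each endpoint of $I$ that belongs to $I$ the profile closes up smoothly, i.e. $\varphi(\alpha)=0,\ \varphi'(\alpha)=2$ if $\alpha=\min I\in I$, and $\varphi(\beta)=0,\ \varphi'(\beta)=-2$ if $\beta=\max I\in I$. Then the same existence and uniqueness hold for $I_0=I$. -/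

import Mathlib

open Set Bundle
open scoped Manifold ContDiff Topology ENNReal

set_option linter.unusedSectionVars false

noncomputable section

namespace MomentumConstruction

/-! ### Differential forms on a complex manifold

A `k`-form on a manifold `N` modelled on `F` assigns to `x : N` an alternating form on
`T_x N = F`, where (as everywhere in Mathlib) `T_x N` is identified with `F` through the preferred
chart at `x`. -/

section Forms

variable {F : Type*} [NormedAddCommGroup F] [NormedSpace ℂ F] [NormedSpace ℝ F]
  [IsScalarTower ℝ ℂ F] {N : Type*} [TopologicalSpace N] [ChartedSpace F N]
  {F' : Type*} [NormedAddCommGroup F'] [NormedSpace ℝ F']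
  {N' : Type*} [TopologicalSpace N'] [ChartedSpace F' N'] {k : ℕ}

/-- Real differential `k`-forms on a manifold `N` modelled on `F`. -/
abbrev Form (F : Type*) [NormedAddCommGroup F] [NormedSpace ℝ F] (N : Type*) (k : ℕ) : Type _ :=
  N → F [⋀^Fin k]→L[ℝ] ℝ

/-- The complex structure on a tangent space: multiplication by `i`. -/
def complexJ (F : Type*) [NormedAddCommGroup F] [NormedSpace ℂ F] [NormedSpace ℝ F]
    [IsScalarTower ℝ ℂ F] : F →L[ℝ] F :=
  (Complex.I • ContinuousLinearMap.id ℂ F).restrictScalars ℝ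

/-- The real differential `d_xΦ : T_x N → T_{Φ x} N'`. -/
def differential (F F' : Type*) [NormedAddCommGroup F] [NormedSpace ℝ F]
    [NormedAddCommGroup F'] [NormedSpace ℝ F'] {N N' : Type*}
    [TopologicalSpace N] [ChartedSpace F N] [TopologicalSpace N'] [ChartedSpace F' N']
    (Φ : N → N') (x : N) : F →L[ℝ] F' :=
  mfderiv 𝓘(ℝ, F) 𝓘(ℝ, F') Φ x

/-- The pullback `Φ^* α`. -/
def pullback (Φ : N → N') (α : Form F' N' k) : Form F N k :=
  fun x => (α (Φ x)).compContinuousLinearMap (differential F F' Φ x)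

/-- The expression of a form in a chart, as a form on (an open subset of) the model space. -/
def inChart (c : OpenPartialHomeomorph N F) (α : Form F N k) : Form F F k :=
  pullback c.symm α

/-- The form `α` is smooth on `U` (in the real sense). -/
def IsSmoothOn (α : Form F N k) (U : Set N) : Prop :=
  ∀ x₀ : N, ContDiffOn ℝ ∞ (inChart (chartAt F x₀) α)
    ((chartAt F x₀).target ∩ (chartAt F x₀).symm ⁻¹' U)

/-- The exterior derivative, computed at `x` in the preferred chart at `x`. -/
def extD (α : Form F N k) : Form F N (k + 1) :=
  fun x => extDeriv (inChart (chartAt F x) α) (chartAt F x x)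

/-- `d^c u = i (∂̄ - ∂) u = - du ∘ J`. -/
def dc (u : N → ℝ) : Form F N 1 :=
  fun x => ContinuousAlternatingMap.ofSubsingleton ℝ F ℝ (0 : Fin 1)
    (-(differential F ℝ u x).comp (complexJ F))

/-- `d d^c u = 2 i ∂ ∂̄ u`. -/
def ddc (u : N → ℝ) : Form F N 2 := extD (dc u)

/-- Positivity of a real two-form on `U`: `α(v, Jv) > 0` for tangent vectors `v ≠ 0`. -/
def IsPositiveOn (α : Form F N 2) (U : Set N) : Prop :=
  ∀ x ∈ U, ∀ v : F, v ≠ 0 → 0 < α x ![v, complexJ F v]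

/-- `Ω` is a Kähler form on `U`: a smooth, closed, positive real form of type `(1,1)`. -/
structure IsKahlerForm (Ω : Form F N 2) (U : Set N) : Prop where
  smooth : IsSmoothOn Ω U
  closed : ∀ x ∈ U, extD Ω x = 0
  type_one_one : ∀ x ∈ U, ∀ v w : F, Ω x ![complexJ F v, complexJ F w] = Ω x ![v, w]
  positive : IsPositiveOn Ω U

/-- The Kähler metric `g(v, w) = Ω(v, Jw)` of a Kähler form. -/
def kahlerMetric (Ω : Form F N 2) (x : N) (v w : F) : ℝ := Ω x ![v, complexJ F w]

/-- `τ` is a moment map on `U` for the vector field `X` and the form `Ω`: `i_X Ω = - dτ`. -/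
structure IsMomentMap (Ω : Form F N 2) (X : N → F) (U : Set N) (τ : N → ℝ) : Prop where
  smooth : ContMDiffOn 𝓘(ℝ, F) 𝓘(ℝ, ℝ) ∞ τ U
  contraction : ∀ x ∈ U, ∀ v : F, Ω x ![X x, v] = -(differential F ℝ τ x v)

end Forms

/-! ### The completion of a holomorphic line bundle -/

/-- The completion `L̂ = P(O ⊕ L)` of a line bundle `L` over a manifold `M` modelled on `E`:
a point `∞` is added to each fibre of `L`. (The model space `E` is recorded in the type because the
complex structure of the completion is built from that of `M`.) -/
@[ext]
structure Completion (E : Type*) {M : Type*} (L : M → Type*) where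
  base : M
  fibre : OnePoint (L base)

section Completion

variable {E : Type*} [NormedAddCommGroup E]
  {M : Type*} [TopologicalSpace M] [ChartedSpace E M]
  {L : M → Type*} [∀ x, AddCommGroup (L x)] [∀ x, Module ℂ (L x)]
  [TopologicalSpace (TotalSpace ℂ L)] [∀ x, TopologicalSpace (L x)]
  [FiberBundle ℂ L] [VectorBundle ℂ ℂ L]

/-- The common domain in `M` of the preferred chart and the preferred trivialization at `x₀`. -/
def chartDomain (E : Type*) [NormedAddCommGroup E] {M : Type*} [TopologicalSpace M]
    [ChartedSpace E M] (L : M → Type*) [TopologicalSpace (TotalSpace ℂ L)]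
    [∀ x, TopologicalSpace (L x)] [FiberBundle ℂ L] (x₀ : M) : Set M :=
  (chartAt E x₀).source ∩ (trivializationAt ℂ L x₀).baseSet

/-- The line bundle chart `(z, z⁰)` on the part `L` of the completion. -/
def finiteChart (E : Type*) [NormedAddCommGroup E] {M : Type*} [TopologicalSpace M]
    [ChartedSpace E M] (L : M → Type*) [∀ x, AddCommGroup (L x)]
    [TopologicalSpace (TotalSpace ℂ L)]
    [∀ x, TopologicalSpace (L x)] [FiberBundle ℂ L] (x₀ : M) :
    PartialEquiv (Completion E L) (E × ℂ) where
  toFun p := (chartAt E x₀ p.base,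
    p.fibre.elim 0 fun v => (trivializationAt ℂ L x₀ ⟨p.base, v⟩).2)
  invFun q := ⟨(chartAt E x₀).symm q.1,
    ((trivializationAt ℂ L x₀).symm ((chartAt E x₀).symm q.1) q.2 : L _)⟩
  source := {p | p.base ∈ chartDomain E L x₀ ∧ p.fibre ≠ OnePoint.infty}
  target := {q | q.1 ∈ (chartAt E x₀).target ∧ (chartAt E x₀).symm q.1 ∈ chartDomain E L x₀}
  map_source' := by
    rintro ⟨x, v⟩ ⟨hx, -⟩
    refine ⟨(chartAt E x₀).map_source hx.1, ?_⟩
    simpa [(chartAt E x₀).left_inv hx.1] using hx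
  map_target' := by
    rintro ⟨y, z⟩ ⟨hy, hy'⟩
    exact ⟨hy', OnePoint.coe_ne_infty _⟩
  left_inv' := by
    rintro ⟨x, v⟩ ⟨hx, hv⟩
    induction v using OnePoint.rec with
    | infty => exact absurd rfl hv
    | coe v =>
      have key : ∀ y : M, y = x → (⟨y, (((trivializationAt ℂ L x₀).symm y
          (trivializationAt ℂ L x₀ ⟨x, v⟩).2 : L y) : OnePoint (L y))⟩ : Completion E L) =
            ⟨x, (v : OnePoint (L x))⟩ := by
        rintro y rfl
        rw [(trivializationAt ℂ L x₀).symm_apply_apply_mk hx.2]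
      exact key _ ((chartAt E x₀).left_inv hx.1)
  right_inv' := by
    rintro ⟨y, z⟩ ⟨hy, hy'⟩
    refine Prod.ext ((chartAt E x₀).right_inv hy) ?_
    simp [OnePoint.elim_some, (trivializationAt ℂ L x₀).apply_mk_symm hy'.2]

theorem snd_eq_zero_iff {x₀ x : M} (hx : x ∈ (trivializationAt ℂ L x₀).baseSet) (v : L x) :
    (trivializationAt ℂ L x₀ ⟨x, v⟩).2 = 0 ↔ v = 0 := by
  have := ((trivializationAt ℂ L x₀).continuousLinearEquivAt ℂ x hx).map_eq_zero_iff (x := v)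
  simpa using this

/-- The line bundle chart `(z, 1 / z⁰)` near the section at infinity of the completion. -/
def infChart (E : Type*) [NormedAddCommGroup E] {M : Type*} [TopologicalSpace M]
    [ChartedSpace E M] (L : M → Type*) [∀ x, AddCommGroup (L x)] [∀ x, Module ℂ (L x)]
    [TopologicalSpace (TotalSpace ℂ L)]
    [∀ x, TopologicalSpace (L x)] [FiberBundle ℂ L] [VectorBundle ℂ ℂ L] (x₀ : M) :
    PartialEquiv (Completion E L) (E × ℂ) where
  toFun p := (chartAt E x₀ p.base,
    p.fibre.elim 0 fun v => (trivializationAt ℂ L x₀ ⟨p.base, v⟩).2⁻¹)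
  invFun q := ⟨(chartAt E x₀).symm q.1,
    if q.2 = 0 then OnePoint.infty else
      ((trivializationAt ℂ L x₀).symm ((chartAt E x₀).symm q.1) q.2⁻¹ : L _)⟩
  source := {p | p.base ∈ chartDomain E L x₀ ∧ p.fibre ≠ ((0 : L p.base) : OnePoint (L p.base))}
  target := {q | q.1 ∈ (chartAt E x₀).target ∧ (chartAt E x₀).symm q.1 ∈ chartDomain E L x₀}
  map_source' := by
    rintro ⟨x, v⟩ ⟨hx, -⟩
    refine ⟨(chartAt E x₀).map_source hx.1, ?_⟩
    simpa [(chartAt E x₀).left_inv hx.1] using hx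
  map_target' := by
    rintro ⟨y, z⟩ ⟨hy, hy'⟩
    refine ⟨hy', ?_⟩
    by_cases hz : z = 0
    · simp [hz]
    · simp only [hz, if_false]
      intro h
      have h1 := OnePoint.coe_injective h
      have h2 := (trivializationAt ℂ L x₀).apply_mk_symm hy'.2 z⁻¹
      rw [h1] at h2
      have h3 := (trivializationAt ℂ L x₀).zeroSection ℂ hy'.2
      rw [zeroSection] at h3
      rw [h3] at h2
      exact hz (inv_eq_zero.mp (congrArg Prod.snd h2).symm)
  left_inv' := by
    rintro ⟨x, v⟩ ⟨hx, hv⟩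
    induction v using OnePoint.rec with
    | infty =>
      have key : ∀ y : M, y = x → (⟨y, OnePoint.infty⟩ : Completion E L) = ⟨x, OnePoint.infty⟩ := by
        rintro y rfl
        rfl
      simpa using key _ ((chartAt E x₀).left_inv hx.1)
    | coe v =>
      have hv0 : v ≠ 0 := fun h => hv (by simp [h])
      have h0 := (snd_eq_zero_iff hx.2 v).not.mpr hv0
      have key : ∀ y : M, y = x → (⟨y, (((trivializationAt ℂ L x₀).symm y
          (trivializationAt ℂ L x₀ ⟨x, v⟩).2 : L y) : OnePoint (L y))⟩ : Completion E L) =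
            ⟨x, (v : OnePoint (L x))⟩ := by
        rintro y rfl
        rw [(trivializationAt ℂ L x₀).symm_apply_apply_mk hx.2]
      simpa [OnePoint.elim_some, h0] using key _ ((chartAt E x₀).left_inv hx.1)
  right_inv' := by
    rintro ⟨y, z⟩ ⟨hy, hy'⟩
    refine Prod.ext ((chartAt E x₀).right_inv hy) ?_
    by_cases hz : z = 0
    · simp [hz]
    · simp [hz, OnePoint.elim_some, (trivializationAt ℂ L x₀).apply_mk_symm hy'.2]

theorem symm_eq_zero_iff {x₀ x : M} (hx : x ∈ (trivializationAt ℂ L x₀).baseSet) (z : ℂ) :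
    (trivializationAt ℂ L x₀).symm x z = 0 ↔ z = 0 := by
  rw [← snd_eq_zero_iff hx, (trivializationAt ℂ L x₀).apply_mk_symm hx]

/-- The holomorphic transition function of `L` between two preferred trivializations. -/
def cocycle (L : M → Type*) [∀ x, AddCommGroup (L x)] [∀ x, Module ℂ (L x)]
    [TopologicalSpace (TotalSpace ℂ L)]
    [∀ x, TopologicalSpace (L x)] [FiberBundle ℂ L] [VectorBundle ℂ ℂ L] (x₀ x₁ x : M) : ℂ :=
  (trivializationAt ℂ L x₀).coordChangeL ℂ (trivializationAt ℂ L x₁) x 1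

theorem snd_symm_eq {x₀ x₁ x : M} (h₀ : x ∈ chartDomain E L x₀) (h₁ : x ∈ chartDomain E L x₁)
    (z : ℂ) : (trivializationAt ℂ L x₁ ⟨x, (trivializationAt ℂ L x₀).symm x z⟩).2 =
      z * cocycle L x₀ x₁ x := by
  rw [← (trivializationAt ℂ L x₀).coordChangeL_apply (R := ℂ) (trivializationAt ℂ L x₁)
    ⟨h₀.2, h₁.2⟩ z, cocycle, ← smul_eq_mul, ← map_smul, smul_eq_mul, mul_one]

theorem cocycle_ne_zero (x₀ x₁ x : M) : cocycle L x₀ x₁ x ≠ 0 := by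
  simp [cocycle]

theorem continuousOn_cocycle (x₀ x₁ : M) :
    ContinuousOn (cocycle L x₀ x₁) (chartDomain E L x₀ ∩ chartDomain E L x₁) := by
  have := continuousOn_coordChange ℂ (trivializationAt ℂ L x₀) (trivializationAt ℂ L x₁)
  exact (this.clm_apply continuousOn_const).mono fun x hx => ⟨hx.1.2, hx.2.2⟩

/-- The overlap of two chart domains, seen in the first chart of `M`. -/
def overlap (E : Type*) [NormedAddCommGroup E] {M : Type*} [TopologicalSpace M]
    [ChartedSpace E M] (L : M → Type*) [TopologicalSpace (TotalSpace ℂ L)]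
    [∀ x, TopologicalSpace (L x)] [FiberBundle ℂ L] (x₀ x₁ : M) : Set E :=
  (chartAt E x₀).target ∩
    (chartAt E x₀).symm ⁻¹' (chartDomain E L x₀ ∩ chartDomain E L x₁)

theorem isOpen_overlap (x₀ x₁ : M) : IsOpen (overlap E L x₀ x₁) :=
  (chartAt E x₀).isOpen_inter_preimage_symm
    (((chartAt E x₀).open_source.inter (trivializationAt ℂ L x₀).open_baseSet).inter
      ((chartAt E x₁).open_source.inter (trivializationAt ℂ L x₁).open_baseSet))

/-- The four kinds of coordinate changes, on `q = (z, z⁰)` or `q = (z, 1 / z⁰)`. -/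
theorem finite_finite (x₀ x₁ : M) :
    ((finiteChart E L x₀).symm.trans (finiteChart E L x₁)).source =
        {q | q.1 ∈ overlap E L x₀ x₁} ∧
      EqOn ((finiteChart E L x₀).symm.trans (finiteChart E L x₁))
        (fun q => (chartAt E x₁ ((chartAt E x₀).symm q.1),
          q.2 * cocycle L x₀ x₁ ((chartAt E x₀).symm q.1))) {q | q.1 ∈ overlap E L x₀ x₁} := by
  refine ⟨?_, ?_⟩
  · ext q
    simp [finiteChart, overlap, and_assoc]
  · rintro q hq
    simp [finiteChart, OnePoint.elim_some, snd_symm_eq hq.2.1 hq.2.2]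

theorem inf_inf (x₀ x₁ : M) :
    ((infChart E L x₀).symm.trans (infChart E L x₁)).source =
        {q | q.1 ∈ overlap E L x₀ x₁} ∧
      EqOn ((infChart E L x₀).symm.trans (infChart E L x₁))
        (fun q => (chartAt E x₁ ((chartAt E x₀).symm q.1),
          q.2 * (cocycle L x₀ x₁ ((chartAt E x₀).symm q.1))⁻¹))
        {q | q.1 ∈ overlap E L x₀ x₁} := by
  refine ⟨?_, ?_⟩
  · ext q
    by_cases h0 : q.2 = 0
    · simp [infChart, overlap, and_assoc, h0]
    · simp only [infChart, overlap]
      simp +contextual [and_assoc, h0, symm_eq_zero_iff, chartDomain]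
  · rintro q hq
    by_cases h0 : q.2 = 0
    · simp [infChart, h0]
    · simp [infChart, OnePoint.elim_some, h0, snd_symm_eq hq.2.1 hq.2.2, mul_comm]

theorem finite_inf (x₀ x₁ : M) :
    ((finiteChart E L x₀).symm.trans (infChart E L x₁)).source =
        {q | q.1 ∈ overlap E L x₀ x₁ ∧ q.2 ≠ 0} ∧
      EqOn ((finiteChart E L x₀).symm.trans (infChart E L x₁))
        (fun q => (chartAt E x₁ ((chartAt E x₀).symm q.1),
          q.2⁻¹ * (cocycle L x₀ x₁ ((chartAt E x₀).symm q.1))⁻¹))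
        {q | q.1 ∈ overlap E L x₀ x₁ ∧ q.2 ≠ 0} := by
  refine ⟨?_, ?_⟩
  · ext q
    simp +contextual [finiteChart, infChart, overlap, and_assoc, symm_eq_zero_iff, chartDomain]
  · rintro q ⟨hq, h0⟩
    simp [finiteChart, infChart, OnePoint.elim_some, snd_symm_eq hq.2.1 hq.2.2, mul_comm]

theorem inf_finite (x₀ x₁ : M) :
    ((infChart E L x₀).symm.trans (finiteChart E L x₁)).source =
        {q | q.1 ∈ overlap E L x₀ x₁ ∧ q.2 ≠ 0} ∧
      EqOn ((infChart E L x₀).symm.trans (finiteChart E L x₁))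
        (fun q => (chartAt E x₁ ((chartAt E x₀).symm q.1),
          q.2⁻¹ * cocycle L x₀ x₁ ((chartAt E x₀).symm q.1)))
        {q | q.1 ∈ overlap E L x₀ x₁ ∧ q.2 ≠ 0} := by
  refine ⟨?_, ?_⟩
  · ext q
    by_cases h0 : q.2 = 0 <;> simp [finiteChart, infChart, overlap, and_assoc, h0]
  · rintro q ⟨hq, h0⟩
    simp [finiteChart, infChart, OnePoint.elim_some, h0, snd_symm_eq hq.2.1 hq.2.2]


theorem continuousOn_cocycle_symm (x₀ x₁ : M) :
    ContinuousOn (fun y => cocycle L x₀ x₁ ((chartAt E x₀).symm y)) (overlap E L x₀ x₁) :=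
  (continuousOn_cocycle (E := E) x₀ x₁).comp
    ((chartAt E x₀).continuousOn_symm.mono fun _ hy => hy.1) fun _ hy => hy.2

theorem continuousOn_baseChange (x₀ x₁ : M) :
    ContinuousOn (fun y => chartAt E x₁ ((chartAt E x₀).symm y)) (overlap E L x₀ x₁) :=
  (chartAt E x₁).continuousOn.comp
    ((chartAt E x₀).continuousOn_symm.mono fun _ hy => hy.1) fun _ hy => hy.2.2.1

/-- The standard charts of the completion. -/
def completionCore (E : Type*) [NormedAddCommGroup E] {M : Type*} [TopologicalSpace M]
    [ChartedSpace E M] (L : M → Type*) [∀ x, AddCommGroup (L x)] [∀ x, Module ℂ (L x)]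
    [TopologicalSpace (TotalSpace ℂ L)]
    [∀ x, TopologicalSpace (L x)] [FiberBundle ℂ L] [VectorBundle ℂ ℂ L] :
    ChartedSpaceCore (E × ℂ) (Completion E L) where
  atlas := range (finiteChart E L) ∪ range (infChart E L)
  chartAt p := p.fibre.elim (infChart E L p.base) fun _ => finiteChart E L p.base
  mem_chart_source := by
    rintro ⟨x, v⟩
    have hx : x ∈ chartDomain E L x :=
      ⟨mem_chart_source E x, FiberBundle.mem_baseSet_trivializationAt' x⟩
    induction v using OnePoint.rec with
    | infty => exact ⟨hx, (OnePoint.coe_ne_infty _).symm⟩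
    | coe v => exact ⟨hx, OnePoint.coe_ne_infty _⟩
  chart_mem_atlas := by
    rintro ⟨x, v⟩
    induction v using OnePoint.rec with
    | infty => exact Or.inr ⟨x, rfl⟩
    | coe v => exact Or.inl ⟨x, rfl⟩
  open_source := by
    have h (x₀ x₁ : M) : IsOpen {q : E × ℂ | q.1 ∈ overlap E L x₀ x₁} :=
      (isOpen_overlap x₀ x₁).preimage continuous_fst
    have h' (x₀ x₁ : M) : IsOpen {q : E × ℂ | q.1 ∈ overlap E L x₀ x₁ ∧ q.2 ≠ 0} :=
      (h x₀ x₁).inter (isOpen_ne.preimage continuous_snd)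
    rintro _ _ (⟨x₀, rfl⟩ | ⟨x₀, rfl⟩) (⟨x₁, rfl⟩ | ⟨x₁, rfl⟩)
    · rw [(finite_finite x₀ x₁).1]; exact h x₀ x₁
    · rw [(finite_inf x₀ x₁).1]; exact h' x₀ x₁
    · rw [(inf_finite x₀ x₁).1]; exact h' x₀ x₁
    · rw [(inf_inf x₀ x₁).1]; exact h x₀ x₁
  continuousOn_toFun := by
    have hc (x₀ x₁ : M) (s : Set (E × ℂ)) (hs : s ⊆ {q | q.1 ∈ overlap E L x₀ x₁}) :
        ContinuousOn (fun q : E × ℂ => cocycle L x₀ x₁ ((chartAt E x₀).symm q.1)) s :=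
      (continuousOn_cocycle_symm x₀ x₁).comp continuousOn_fst hs
    have hb (x₀ x₁ : M) (s : Set (E × ℂ)) (hs : s ⊆ {q | q.1 ∈ overlap E L x₀ x₁}) :
        ContinuousOn (fun q : E × ℂ => chartAt E x₁ ((chartAt E x₀).symm q.1)) s :=
      (continuousOn_baseChange (L := L) x₀ x₁).comp continuousOn_fst hs
    rintro _ _ (⟨x₀, rfl⟩ | ⟨x₀, rfl⟩) (⟨x₁, rfl⟩ | ⟨x₁, rfl⟩)
    · rw [(finite_finite x₀ x₁).1]
      refine ContinuousOn.congr ?_ (finite_finite x₀ x₁).2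
      exact (hb _ _ _ fun q hq => hq).prodMk (continuousOn_snd.mul (hc _ _ _ fun q hq => hq))
    · rw [(finite_inf x₀ x₁).1]
      refine ContinuousOn.congr ?_ (finite_inf x₀ x₁).2
      exact (hb _ _ _ fun q hq => hq.1).prodMk ((continuousOn_snd.inv₀ fun q hq => hq.2).mul
        ((hc _ _ _ fun q hq => hq.1).inv₀ fun q _ => cocycle_ne_zero _ _ _))
    · rw [(inf_finite x₀ x₁).1]
      refine ContinuousOn.congr ?_ (inf_finite x₀ x₁).2
      exact (hb _ _ _ fun q hq => hq.1).prodMk ((continuousOn_snd.inv₀ fun q hq => hq.2).mul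
        (hc _ _ _ fun q hq => hq.1))
    · rw [(inf_inf x₀ x₁).1]
      refine ContinuousOn.congr ?_ (inf_inf x₀ x₁).2
      exact (hb _ _ _ fun q hq => hq).prodMk (continuousOn_snd.mul
        ((hc _ _ _ fun q hq => hq).inv₀ fun q _ => cocycle_ne_zero _ _ _))

instance : TopologicalSpace (Completion E L) := (completionCore E L).toTopologicalSpace

instance : ChartedSpace (E × ℂ) (Completion E L) := (completionCore E L).toChartedSpace

end Completion

section Holomorphic

variable {E : Type*} [NormedAddCommGroup E] [NormedSpace ℂ E]
  {M : Type*} [TopologicalSpace M] [ChartedSpace E M] [IsManifold 𝓘(ℂ, E) ω M]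
  {L : M → Type*} [∀ x, AddCommGroup (L x)] [∀ x, Module ℂ (L x)]
  [TopologicalSpace (TotalSpace ℂ L)] [∀ x, TopologicalSpace (L x)]
  [FiberBundle ℂ L] [VectorBundle ℂ ℂ L] [ContMDiffVectorBundle ω ℂ L 𝓘(ℂ, E)]

/-- The completion of a holomorphic line bundle is a complex manifold. -/
instance : IsManifold 𝓘(ℂ, E × ℂ) ω (Completion E L) := by
  have hsymm (x₀ x₁ : M) : ContMDiffOn 𝓘(ℂ, E) 𝓘(ℂ, E) ω (chartAt E x₀).symm
      (overlap E L x₀ x₁) :=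
    (contMDiffOn_chart_symm (I := 𝓘(ℂ, E)) (x := x₀)).mono fun _ hy => hy.1
  have hc₀ (x₀ x₁ : M) : ContDiffOn ℂ ω (fun y => cocycle L x₀ x₁ ((chartAt E x₀).symm y))
      (overlap E L x₀ x₁) := by
    rw [← contMDiffOn_iff_contDiffOn]
    have h := ContMDiffOn.coordChangeL (e := trivializationAt ℂ L x₀)
      (e' := trivializationAt ℂ L x₁) (hsymm x₀ x₁) (fun y hy => hy.2.1.2) (fun y hy => hy.2.2.2)
    exact h.clm_apply contMDiffOn_const
  have hb₀ (x₀ x₁ : M) : ContDiffOn ℂ ω (fun y => chartAt E x₁ ((chartAt E x₀).symm y))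
      (overlap E L x₀ x₁) := by
    rw [← contMDiffOn_iff_contDiffOn]
    exact (contMDiffOn_chart (I := 𝓘(ℂ, E)) (x := x₁)).comp (hsymm x₀ x₁) fun y hy => hy.2.2.1
  have hc (x₀ x₁ : M) (s : Set (E × ℂ)) (hs : s ⊆ {q | q.1 ∈ overlap E L x₀ x₁}) :
      ContDiffOn ℂ ω (fun q : E × ℂ => cocycle L x₀ x₁ ((chartAt E x₀).symm q.1)) s :=
    (hc₀ x₀ x₁).comp contDiffOn_fst hs
  have hb (x₀ x₁ : M) (s : Set (E × ℂ)) (hs : s ⊆ {q | q.1 ∈ overlap E L x₀ x₁}) :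
      ContDiffOn ℂ ω (fun q : E × ℂ => chartAt E x₁ ((chartAt E x₀).symm q.1)) s :=
    (hb₀ x₀ x₁).comp contDiffOn_fst hs
  have key : ∀ e ∈ (completionCore E L).atlas, ∀ e' ∈ (completionCore E L).atlas,
      ContDiffOn ℂ ω (e.symm.trans e') (e.symm.trans e').source := by
    rintro _ (⟨x₀, rfl⟩ | ⟨x₀, rfl⟩) _ (⟨x₁, rfl⟩ | ⟨x₁, rfl⟩)
    · rw [(finite_finite x₀ x₁).1]
      refine ContDiffOn.congr ?_ (finite_finite x₀ x₁).2
      exact (hb _ _ _ fun q hq => hq).prodMk (contDiffOn_snd.mul (hc _ _ _ fun q hq => hq))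
    · rw [(finite_inf x₀ x₁).1]
      refine ContDiffOn.congr ?_ (finite_inf x₀ x₁).2
      exact (hb _ _ _ fun q hq => hq.1).prodMk ((contDiffOn_snd.inv fun q hq => hq.2).mul
        ((hc _ _ _ fun q hq => hq.1).inv fun q _ => cocycle_ne_zero _ _ _))
    · rw [(inf_finite x₀ x₁).1]
      refine ContDiffOn.congr ?_ (inf_finite x₀ x₁).2
      exact (hb _ _ _ fun q hq => hq.1).prodMk ((contDiffOn_snd.inv fun q hq => hq.2).mul
        (hc _ _ _ fun q hq => hq.1))
    · rw [(inf_inf x₀ x₁).1]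
      refine ContDiffOn.congr ?_ (inf_inf x₀ x₁).2
      exact (hb _ _ _ fun q hq => hq).prodMk (contDiffOn_snd.mul
        ((hc _ _ _ fun q hq => hq).inv fun q _ => cocycle_ne_zero _ _ _))
  refine isManifold_of_contDiffOn 𝓘(ℂ, E × ℂ) ω (Completion E L) ?_
  intro e e' he he'
  obtain ⟨e₀, he₀, rfl⟩ : ∃ e₀, ∃ h : e₀ ∈ (completionCore E L).atlas,
      e = (completionCore E L).openPartialHomeomorph e₀ h := by
    simpa [atlas, ChartedSpace.atlas] using he
  obtain ⟨e₁, he₁, rfl⟩ : ∃ e₁, ∃ h : e₁ ∈ (completionCore E L).atlas,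
      e' = (completionCore E L).openPartialHomeomorph e₁ h := by
    simpa [atlas, ChartedSpace.atlas] using he'
  simp only [modelWithCornersSelf_coe, modelWithCornersSelf_coe_symm, Function.id_comp,
    Function.comp_id, preimage_id_eq, id_eq, range_id, inter_univ]
  exact key e₀ he₀ e₁ he₁

end Holomorphic

/-! ### Hermitian line bundles, horizontal data and the Calabi ansatz -/

section Momentum

variable {E : Type*} [NormedAddCommGroup E] [NormedSpace ℂ E]
  {M : Type*} [TopologicalSpace M] [ChartedSpace E M]
  {L : M → Type*} [∀ x, AddCommGroup (L x)] [∀ x, Module ℂ (L x)]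
  [TopologicalSpace (TotalSpace ℂ L)] [∀ x, TopologicalSpace (L x)]
  [FiberBundle ℂ L] [VectorBundle ℂ ℂ L]

/-- A smooth Hermitian metric on a complex line bundle, given by its squared norm function. -/
structure HermitianMetric (E : Type*) [NormedAddCommGroup E] [NormedSpace ℂ E]
    {M : Type*} [TopologicalSpace M] [ChartedSpace E M]
    (L : M → Type*) [∀ x, AddCommGroup (L x)] [∀ x, Module ℂ (L x)]
    [TopologicalSpace (TotalSpace ℂ L)] [∀ x, TopologicalSpace (L x)] [FiberBundle ℂ L] where
  normSq : ∀ x, L x → ℝ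
  normSq_smul : ∀ (x : M) (c : ℂ) (v : L x), normSq x (c • v) = ‖c‖ ^ 2 * normSq x v
  normSq_pos : ∀ (x : M) (v : L x), v ≠ 0 → 0 < normSq x v
  contMDiff : ContMDiff (𝓘(ℝ, E).prod 𝓘(ℝ, ℂ)) 𝓘(ℝ, ℝ) ∞
    fun p : TotalSpace ℂ L => normSq p.proj p.snd

/-- The curvature form `γ = -i ∂ ∂̄ log h`, where `h` is the squared norm of a local nonvanishing
holomorphic section. -/
def HermitianMetric.curvature (h : HermitianMetric E L) : Form E M 2 :=
  fun x => -((1 / 2 : ℝ) •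
    ddc (F := E) (fun y => Real.log (h.normSq y ((trivializationAt ℂ L x).symm y 1))) x)

/-- The continuous extension `r : L̂ → [0, ∞]` of the squared norm function. -/
def HermitianMetric.extNormSq (h : HermitianMetric E L) (p : Completion E L) : ℝ≥0∞ :=
  p.fibre.elim ⊤ fun v => ENNReal.ofReal (h.normSq p.base v)

/-- The logarithm `t` of the norm function on `L^×` (with junk values elsewhere). -/
def HermitianMetric.logNorm (h : HermitianMetric E L) (p : Completion E L) : ℝ :=
  p.fibre.elim 0 fun v => (1 / 2) * Real.log (h.normSq p.base v)

/-- The complement `L^×` in `L̂` of the zero section and the section at infinity. -/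
def puncturedBundle (E : Type*) {M : Type*} (L : M → Type*) [∀ x, AddCommGroup (L x)] :
    Set (Completion E L) :=
  {p | ∃ v : L p.base, v ≠ 0 ∧ p.fibre = (v : OnePoint (L p.base))}

/-- The part `r⁻¹(J)` of `L̂`; it is an invariant subbundle when `J` is an open interval. -/
def HermitianMetric.subbundle (h : HermitianMetric E L) (J : Set ℝ≥0∞) : Set (Completion E L) :=
  h.extNormSq ⁻¹' J

/-- The values of `t = (log r) / 2` for which `r` belongs to `J`. -/
def logInterval (J : Set ℝ≥0∞) : Set ℝ := {t | ENNReal.ofReal (Real.exp (2 * t)) ∈ J}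

/-- Multiplication by `c` in the fibres, fixing the points at infinity. -/
def scale (c : ℂ) (p : Completion E L) : Completion E L :=
  ⟨p.base, p.fibre.map fun v => c • v⟩

/-- The generator `X` of the circle action, normalized so that `exp (2 π X) = 1`. -/
def circleField (p : Completion E L) : E × ℂ :=
  differential ℝ (E × ℂ) (fun θ : ℝ => scale (Complex.exp (θ * Complex.I)) p) 0 1

/-- Horizontal data: a Hermitian holomorphic line bundle over a Kähler manifold, together with a
nondegenerate interval `I` such that `ω_M - s γ` is positive for every `s ∈ I`. -/
structure IsHorizontalData (h : HermitianMetric E L) (ΩM : Form E M 2) (I : Set ℝ) : Prop where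
  kahler : IsKahlerForm ΩM univ
  ordConnected : I.OrdConnected
  nondegenerate : (interior I).Nonempty
  compatible : ∀ s ∈ I, IsPositiveOn (fun x => ΩM x - s • h.curvature x) univ

/-- Momentum profiles on `I`. -/
structure IsMomentumProfile (I : Set ℝ) (φ : ℝ → ℝ) : Prop where
  smooth : ContDiffOn ℝ ∞ φ (closure I)
  pos : ∀ s ∈ interior I, 0 < φ s

/-- The profile closes up at the endpoints of `I` that belong to `I`: there it vanishes, with
derivative `2` at the lower and `-2` at the upper endpoint. -/
structure ClosesUp (I : Set ℝ) (φ : ℝ → ℝ) : Prop where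
  lower : ∀ a, IsLeast I a → φ a = 0 ∧ HasDerivWithinAt φ 2 I a
  upper : ∀ b, IsGreatest I b → φ b = 0 ∧ HasDerivWithinAt φ (-2) I b

/-- The form `Ω` arises on `r⁻¹(J)` from the Calabi ansatz with the function `f`:
`Ω = p^* ω_M + 2 i ∂ ∂̄ f(t)` on `r⁻¹(J) ∩ L^×`. -/
structure IsCalabiAnsatz (h : HermitianMetric E L) (ΩM : Form E M 2) (J : Set ℝ≥0∞)
    (Ω : Form (E × ℂ) (Completion E L) 2) (f : ℝ → ℝ) : Prop where
  smooth : ContDiffOn ℝ ∞ f (logInterval J)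
  eq : ∀ p ∈ h.subbundle J ∩ puncturedBundle E L,
    Ω p = pullback Completion.base ΩM p + ddc (fun q => f (h.logNorm q)) p

/-- `r⁻¹(J)` is an invariant subbundle, and `Ω` is the Kähler form of a bundle-adapted metric on it
whose moment map `τ = f'(t)` has image `I` and satisfies `g(X, X) = φ(τ)`. -/
structure IsMomentumMetric (h : HermitianMetric E L) (ΩM : Form E M 2) (I : Set ℝ) (φ : ℝ → ℝ)
    (J : Set ℝ≥0∞) (Ω : Form (E × ℂ) (Completion E L) 2) : Prop where
  isOpen : IsOpen J
  ordConnected : J.OrdConnected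
  kahler : IsKahlerForm Ω (h.subbundle J)
  momentum : ∃ (f : ℝ → ℝ) (τ : Completion E L → ℝ),
    IsCalabiAnsatz h ΩM J Ω f ∧
    IsMomentMap Ω circleField (h.subbundle J) τ ∧
    (∀ p ∈ h.subbundle J ∩ puncturedBundle E L, τ p = deriv f (h.logNorm p)) ∧
    τ '' h.subbundle J = I ∧
    ∀ p ∈ h.subbundle J, kahlerMetric Ω p (circleField p) (circleField p) = φ (τ p)

/-- Some homothety `v ↦ a v`, `a > 0`, of `L̂` maps `r⁻¹(J₁)` onto `r⁻¹(J₂)` and is an isometry for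
the metrics with Kähler forms `Ω₁` and `Ω₂`. -/
def HomotheticallyIsometric (h : HermitianMetric E L)
    (J₁ : Set ℝ≥0∞) (Ω₁ : Form (E × ℂ) (Completion E L) 2)
    (J₂ : Set ℝ≥0∞) (Ω₂ : Form (E × ℂ) (Completion E L) 2) : Prop :=
  ∃ a : ℝ, 0 < a ∧
    scale (a : ℂ) '' h.subbundle J₁ = h.subbundle J₂ ∧
    ∀ p ∈ h.subbundle J₁, ∀ v w : E × ℂ,
      kahlerMetric Ω₂ (scale (a : ℂ) p)
        (differential (E × ℂ) (E × ℂ) (scale (E := E) (L := L) (a : ℂ)) p v)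
        (differential (E × ℂ) (E × ℂ) (scale (E := E) (L := L) (a : ℂ)) p w) =
      kahlerMetric Ω₁ p v w

end Momentum

end MomentumConstruction

end

/-! Let `t` be the logarithm of the norm. In a frame of squared norm `K` with fibre coordinate `w`
it is `(log K) / 2 + log |w|`, and `log |w|` is pluriharmonic, so `d d^c t` is the pullback of `-γ`.
With `τ = f'(t)` a Calabi form is therefore `p^*(ω_M - τ γ) + f''(t) dt ∧ d^c t`. The horizontal
part is positive because `τ` takes values in `I`. Contraction with `X` shows that `τ` is a moment
map and that `g(X, X) = f''(t)`. So the condition `g(X, X) = φ(τ)` is the autonomous equation `τ' =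
φ(τ)`.

Existence. The equation is solved by inverting `s ↦ ∫ du / φ(u)` on the interior of `I`
(`IsMomentumProfile.exists_momentum`). If a lower end `α` belongs to `I`, the conditions `φ(α) = 0`,
`φ'(α) = 2` say that `r = e^{2t}` is a smooth coordinate in `s` up to `α`, vanishing there to first
order. Hence `τ` is smooth in `r` and `f = α t + G(r)` with `G` smooth and `G'(0) > 0`
(`exists_potential_at_end`). The upper end is the same after reflection and inversion. The local
potentials `a (log K) / 2 + G(r)` change between charts by pluriharmonic terms
(`PotentialData.flatDdc_transition`), so they define one form, also over the sections at zero and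
infinity; `PotentialData.isMomentumMetric` checks its properties.

Uniqueness. Any momentum metric satisfies `f'' = φ(f')` (`IsAdapted.deriv_deriv_eq`). The values of
`f'` fill the part of `I` where `φ > 0`, so two solutions differ by a translation `t ↦ t + c`
(`exists_translation`), which is the homothety by `e^c`. The potentials then agree up to a constant,
so the forms correspond off the two sections, and by density also on them (`pullback_scale_eq`). A
section lies in `L'` exactly when `I` contains the corresponding end
(`IsAdapted.flip_zero_mem_iff`), so the domains correspond as well. -/

noncomputable section

namespace MomentumConstruction

/-! ### The operators `d^c` and `d d^c` on a complex vector space. -/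

section Flat

variable {F : Type*} [NormedAddCommGroup F] [NormedSpace ℂ F] [NormedSpace ℝ F]
  [IsScalarTower ℝ ℂ F]
  {F' : Type*} [NormedAddCommGroup F'] [NormedSpace ℂ F'] [NormedSpace ℝ F']
  [IsScalarTower ℝ ℂ F']

theorem two_le_infty : (2 : WithTop ℕ∞) ≤ (∞ : WithTop ℕ∞) := by
  exact WithTop.coe_le_coe.mpr le_top

@[simp]
theorem complexJ_apply (v : F) : complexJ F v = Complex.I • v := rfl

/-- The operator `d^c` on a complex vector space. -/
def flatDc (u : F → ℝ) : F → F [⋀^Fin 1]→L[ℝ] ℝ := fun y =>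
  ContinuousAlternatingMap.ofSubsingleton ℝ F ℝ (0 : Fin 1) (-(fderiv ℝ u y).comp (complexJ F))

/-- The operator `d d^c` on a complex vector space. -/
def flatDdc (u : F → ℝ) : F → F [⋀^Fin 2]→L[ℝ] ℝ := extDeriv (flatDc u)

theorem flatDc_apply (u : F → ℝ) (y : F) (v : Fin 1 → F) :
    flatDc u y v = -(fderiv ℝ u y (Complex.I • v 0)) := by
  simp [flatDc]

/-- Precomposition with the complex structure, as a continuous linear map to one-forms. -/
def dcCLM (F : Type*) [NormedAddCommGroup F] [NormedSpace ℂ F] [NormedSpace ℝ F]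
    [IsScalarTower ℝ ℂ F] : (F →L[ℝ] ℝ) →L[ℝ] (F [⋀^Fin 1]→L[ℝ] ℝ) :=
  (ContinuousAlternatingMap.ofSubsingletonLIE (𝕜 := ℝ) (E := F) (F := ℝ)
    (0 : Fin 1)).toContinuousLinearEquiv.toContinuousLinearMap.comp
    (-(ContinuousLinearMap.compL ℝ F F ℝ).flip (complexJ F))

theorem flatDc_eq (u : F → ℝ) : flatDc u = fun y => dcCLM F (fderiv ℝ u y) := by
  ext y v
  simp [flatDc, dcCLM]

theorem ContDiffAt.flatDc {u : F → ℝ} {y : F} {m n : WithTop ℕ∞} (hu : ContDiffAt ℝ n u y)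
    (hmn : m + 1 ≤ n) : ContDiffAt ℝ m (flatDc u) y := by
  rw [flatDc_eq]
  exact (dcCLM F).contDiff.contDiffAt.comp y (hu.fderiv_right hmn)

theorem contDiffAt_extDeriv {k : ℕ} {α : F → F [⋀^Fin k]→L[ℝ] ℝ} {y : F}
    {m n : WithTop ℕ∞} (hα : ContDiffAt ℝ n α y) (hmn : m + 1 ≤ n) :
    ContDiffAt ℝ m (extDeriv α) y := by
  have h : extDeriv α = fun z =>
      ContinuousAlternatingMap.alternatizeUncurryFinCLM (n := k) ℝ F ℝ (fderiv ℝ α z) := by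
    ext1 z
    rw [ContinuousAlternatingMap.alternatizeUncurryFinCLM_apply]
    rfl
  rw [h]
  exact (ContinuousAlternatingMap.alternatizeUncurryFinCLM (n := k) ℝ F ℝ).contDiff.contDiffAt.comp y
    (hα.fderiv_right hmn)

theorem ContDiffAt.flatDdc {u : F → ℝ} {y : F} (hu : ContDiffAt ℝ ∞ u y) :
    ContDiffAt ℝ ∞ (flatDdc u) y :=
  contDiffAt_extDeriv (ContDiffAt.flatDc hu (m := ∞) (by simp)) (by simp)

theorem extDeriv_flatDdc {u : F → ℝ} {y : F} (hu : ContDiffAt ℝ ∞ u y) :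
    extDeriv (flatDdc u) y = 0 :=
  extDeriv_extDeriv_apply (ContDiffAt.flatDc hu (m := ∞) (by simp))
    (by simpa using two_le_infty)

theorem flatDc_congr {u v : F → ℝ} {y : F} (h : u =ᶠ[𝓝 y] v) : flatDc u =ᶠ[𝓝 y] flatDc v := by
  filter_upwards [h.fderiv (𝕜 := ℝ)] with z hz
  simp [flatDc, hz]

theorem flatDdc_congr {u v : F → ℝ} {y : F} (h : u =ᶠ[𝓝 y] v) : flatDdc u y = flatDdc v y :=
  (flatDc_congr h).extDeriv_eq

theorem flatDdc_apply {u : F → ℝ} {y : F} (hu : ContDiffAt ℝ 2 u y) (v w : F) :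
    flatDdc u y ![v, w] = fderiv ℝ (fderiv ℝ u) y w (Complex.I • v) -
      fderiv ℝ (fderiv ℝ u) y v (Complex.I • w) := by
  have h1 : DifferentiableAt ℝ (flatDc u) y :=
    (ContDiffAt.flatDc hu (m := 1) (by norm_num)).differentiableAt one_ne_zero
  have h2 : DifferentiableAt ℝ (fderiv ℝ u) y :=
    (hu.fderiv_right (m := 1) (by norm_num)).differentiableAt one_ne_zero
  have key (a b : F) : fderiv ℝ (fun z => -(fderiv ℝ u z b)) y a =
      -(fderiv ℝ (fderiv ℝ u) y a b) := by
    rw [fderiv_fun_neg, fderiv_clm_apply h2 (by fun_prop)]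
    simp
  rw [flatDdc, extDeriv_apply h1, Fin.sum_univ_two]
  simp only [flatDc_apply, key]
  simp [Fin.removeNth, Fin.succAbove]
  ring

theorem flatDdc_add {u v : F → ℝ} {y : F} (hu : ContDiffAt ℝ 2 u y) (hv : ContDiffAt ℝ 2 v y) :
    flatDdc (fun z => u z + v z) y = flatDdc u y + flatDdc v y := by
  have h : flatDc (fun z => u z + v z) =ᶠ[𝓝 y] flatDc u + flatDc v := by
    filter_upwards [hu.eventually (by simp), hv.eventually (by simp)] with z hz hz'
    ext a
    simp only [Pi.add_apply, ContinuousAlternatingMap.add_apply, flatDc_apply]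
    rw [fderiv_fun_add (hz.differentiableAt two_ne_zero) (hz'.differentiableAt two_ne_zero)]
    simp [add_comm]
  rw [flatDdc, h.extDeriv_eq, extDeriv_add]
  · rfl
  · exact (ContDiffAt.flatDc hu (m := 1) (by norm_num)).differentiableAt one_ne_zero
  · exact (ContDiffAt.flatDc hv (m := 1) (by norm_num)).differentiableAt one_ne_zero

theorem flatDdc_const_mul (c : ℝ) {u : F → ℝ} {y : F} (hu : ContDiffAt ℝ 2 u y) :
    flatDdc (fun z => c * u z) y = c • flatDdc u y := by
  have h : flatDc (fun z => c * u z) =ᶠ[𝓝 y] c • flatDc u := by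
    filter_upwards [hu.eventually (by simp)] with z hz
    ext a
    simp only [Pi.smul_apply, ContinuousAlternatingMap.smul_apply, flatDc_apply]
    rw [fderiv_const_mul (hz.differentiableAt two_ne_zero)]
    simp
  rw [flatDdc, h.extDeriv_eq, extDeriv_smul]
  rfl

theorem fderiv_real_eq {ψ : F → F'} {y : F} (hψ : DifferentiableAt ℂ ψ y) :
    fderiv ℝ ψ y = (fderiv ℂ ψ y).restrictScalars ℝ :=
  (hψ.hasFDerivAt.restrictScalars ℝ).fderiv

theorem fderiv_real_I_smul {ψ : F → F'} {y : F} (hψ : DifferentiableAt ℂ ψ y) (v : F) :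
    fderiv ℝ ψ y (Complex.I • v) = Complex.I • fderiv ℝ ψ y v := by
  simp [fderiv_real_eq hψ]

/-- The real differential of a holomorphic map commutes with multiplication by `i`, so pullback
commutes with `d^c`, and it always commutes with `d`. -/
theorem flatDdc_comp {P : F' → ℝ} {ψ : F → F'} {y : F} (hP : ContDiffAt ℝ 2 P (ψ y))
    (hψ : ContDiffAt ℂ 2 ψ y) :
    flatDdc (fun z => P (ψ z)) y =
      (flatDdc P (ψ y)).compContinuousLinearMap (fderiv ℝ ψ y) := by
  have h : flatDc (fun z => P (ψ z)) =ᶠ[𝓝 y]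
      fun z => (flatDc P (ψ z)).compContinuousLinearMap (fderiv ℝ ψ z) := by
    filter_upwards [hψ.eventually (by simp),
      hψ.continuousAt.eventually (hP.eventually (by simp))] with z hz hz'
    ext a
    have hd : DifferentiableAt ℂ ψ z := hz.differentiableAt two_ne_zero
    have := fderiv_comp z (hz'.differentiableAt two_ne_zero) (hd.restrictScalars ℝ)
    simp only [Function.comp_def] at this
    simp [flatDc_apply, this, fderiv_real_I_smul hd]
  rw [flatDdc, h.extDeriv_eq,
    extDeriv_pullback (r := 2) _ (hψ.restrict_scalars ℝ) (by simp)]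
  · rfl
  · exact (ContDiffAt.flatDc hP (m := 1) (by norm_num)).differentiableAt one_ne_zero

theorem flatDdc_of_fderiv_fderiv_eq_zero {u : F → ℝ} {y : F} (hu : ContDiffAt ℝ 2 u y)
    (h : fderiv ℝ (fderiv ℝ u) y = 0) : flatDdc u y = 0 := by
  ext v
  rw [show v = ![v 0, v 1] from by ext i; fin_cases i <;> rfl, flatDdc_apply hu, h]
  simp

theorem flatDdc_re {ψ : F → ℂ} {y : F} (hψ : ContDiffAt ℂ 2 ψ y) :
    flatDdc (fun z => (ψ z).re) y = 0 := by
  have hre : ContDiffAt ℝ 2 (fun w : ℂ => w.re) (ψ y) := Complex.reCLM.contDiff.contDiffAt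
  rw [flatDdc_comp (P := fun w : ℂ => w.re) hre hψ, flatDdc_of_fderiv_fderiv_eq_zero hre]
  · rfl
  · have : fderiv ℝ (fun w : ℂ => w.re) = fun _ => Complex.reCLM := by
      ext1 w; exact Complex.reCLM.fderiv
    rw [this]; simp

theorem contDiffAt_log_norm {g : F → ℂ} {y : F} {n : WithTop ℕ∞} (hg : ContDiffAt ℝ n g y)
    (h0 : g y ≠ 0) : ContDiffAt ℝ n (fun z => Real.log ‖g z‖) y :=
  (hg.norm ℝ h0).log (norm_ne_zero_iff.mpr h0)

/-- The logarithm of the modulus of a nonvanishing holomorphic function is pluriharmonic. -/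
theorem flatDdc_log_norm {g : F → ℂ} {y : F} (hg : ContDiffAt ℂ 2 g y) (h0 : g y ≠ 0) :
    flatDdc (fun z => Real.log ‖g z‖) y = 0 := by
  -- Division by `g y` moves the value at `y` to `1`, where the principal logarithm is holomorphic;
  -- its real part is `log ‖g‖` up to a constant.
  have hq : ContDiffAt ℂ 2 (fun z => Complex.log (g z / g y)) y :=
    (Complex.contDiffAt_log (by simp [h0, Complex.mem_slitPlane_iff])).comp y (hg.div_const _)
  have h : (fun z => Real.log ‖g z‖) =ᶠ[𝓝 y]
      fun z => (Complex.log (g z / g y) + (Real.log ‖g y‖ : ℂ)).re := by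
    filter_upwards [hg.continuousAt.eventually (isOpen_ne.mem_nhds h0)] with z hz
    rw [Complex.add_re, Complex.log_re, norm_div, Complex.ofReal_re,
      Real.log_div (norm_ne_zero_iff.mpr hz) (norm_ne_zero_iff.mpr h0)]
    ring
  rw [flatDdc_congr h]
  exact flatDdc_re (hq.add contDiffAt_const)

/-- The second derivative of a function whose differential is `g dr`. -/
theorem fderiv_fderiv_of_fderiv_eq_smul {u r g : F → ℝ} {y : F} (hr : ContDiffAt ℝ 2 r y)
    (hg : DifferentiableAt ℝ g y)
    (h : fderiv ℝ u =ᶠ[𝓝 y] fun z => g z • fderiv ℝ r z) (v w : F) :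
    fderiv ℝ (fderiv ℝ u) y v w =
      fderiv ℝ g y v * fderiv ℝ r y w + g y * fderiv ℝ (fderiv ℝ r) y v w := by
  have h2 : DifferentiableAt ℝ (fderiv ℝ r) y :=
    (hr.fderiv_right (m := 1) (by norm_num)).differentiableAt one_ne_zero
  rw [h.fderiv_eq, fderiv_fun_smul hg h2]
  simp [add_comm]

/-- This is `d(g d^c r) = g d d^c r + dg ∧ d^c r`. Assuming `du = g dr` rather than `u = G(r)` lets
it apply when `G` is differentiable on one side only, as for functions of the squared norm at the
zero section. -/
theorem flatDdc_of_fderiv_eq_smul {u r g : F → ℝ} {y : F} (hu : ContDiffAt ℝ 2 u y)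
    (hr : ContDiffAt ℝ 2 r y) (hg : DifferentiableAt ℝ g y)
    (h : fderiv ℝ u =ᶠ[𝓝 y] fun z => g z • fderiv ℝ r z) (v w : F) :
    flatDdc u y ![v, w] = g y * flatDdc r y ![v, w] +
      (fderiv ℝ g y w * fderiv ℝ r y (Complex.I • v) -
        fderiv ℝ g y v * fderiv ℝ r y (Complex.I • w)) := by
  rw [flatDdc_apply hu, flatDdc_apply hr]
  simp only [fderiv_fderiv_of_fderiv_eq_smul hr hg h]
  ring

/-- `d d^c f(t) = f'(t) d d^c t + f''(t) dt ∧ d^c t`. -/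
theorem flatDdc_comp_real {f : ℝ → ℝ} {t : F → ℝ} {y : F} (hf : ContDiffAt ℝ 2 f (t y))
    (ht : ContDiffAt ℝ 2 t y) (v w : F) :
    flatDdc (fun z => f (t z)) y ![v, w] = deriv f (t y) * flatDdc t y ![v, w] +
      deriv (deriv f) (t y) * (fderiv ℝ t y w * fderiv ℝ t y (Complex.I • v) -
        fderiv ℝ t y v * fderiv ℝ t y (Complex.I • w)) := by
  have hd : DifferentiableAt ℝ (deriv f) (t y) :=
    ((hf.fderiv_right (m := 1) (by norm_num)).differentiableAt one_ne_zero).clm_apply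
      (differentiableAt_const (1 : ℝ))
  have hg : HasFDerivAt (fun z => deriv f (t z)) (deriv (deriv f) (t y) • fderiv ℝ t y) y :=
    hd.hasDerivAt.comp_hasFDerivAt y (ht.differentiableAt two_ne_zero).hasFDerivAt
  have h : fderiv ℝ (fun z => f (t z)) =ᶠ[𝓝 y] fun z => deriv f (t z) • fderiv ℝ t z := by
    filter_upwards [ht.eventually (by simp),
      ht.continuousAt.eventually (hf.eventually (by simp))] with z hz hz'
    exact ((hz'.differentiableAt two_ne_zero).hasDerivAt.comp_hasFDerivAt z
      (hz.differentiableAt two_ne_zero).hasFDerivAt).fderiv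
  rw [flatDdc_of_fderiv_eq_smul (ContDiffAt.fun_comp y hf ht) ht hg.differentiableAt h, hg.fderiv]
  simp
  ring

end Flat

end MomentumConstruction

end

noncomputable section

namespace MomentumConstruction

/-! ### Differentials, pullbacks and `d d^c` on complex manifolds, computed in charts. -/

section RealManifolds

variable {F F' F'' : Type*} [NormedAddCommGroup F] [NormedSpace ℝ F]
  [NormedAddCommGroup F'] [NormedSpace ℝ F'] [NormedAddCommGroup F''] [NormedSpace ℝ F'']
  {N N' N'' : Type*} [TopologicalSpace N] [ChartedSpace F N] [TopologicalSpace N']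
  [ChartedSpace F' N'] [TopologicalSpace N''] [ChartedSpace F'' N''] {k : ℕ}

theorem differential_comp {Φ : N → N'} {Ψ : N' → N''} {x : N}
    (hΨ : MDifferentiableAt 𝓘(ℝ, F') 𝓘(ℝ, F'') Ψ (Φ x))
    (hΦ : MDifferentiableAt 𝓘(ℝ, F) 𝓘(ℝ, F') Φ x) :
    differential F F'' (fun z => Ψ (Φ z)) x =
      (differential F' F'' Ψ (Φ x)).comp (differential F F' Φ x) :=
  mfderiv_comp x hΨ hΦ

theorem pullback_comp {Φ : N → N'} {Ψ : N' → N''} {x : N} (α : Form F'' N'' k)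
    (hΨ : MDifferentiableAt 𝓘(ℝ, F') 𝓘(ℝ, F'') Ψ (Φ x))
    (hΦ : MDifferentiableAt 𝓘(ℝ, F) 𝓘(ℝ, F') Φ x) :
    pullback (F := F) (fun z => Ψ (Φ z)) α x = pullback Φ (pullback Ψ α : Form F' N' k) x := by
  ext v
  simp [pullback, differential_comp hΨ hΦ, Function.comp_def]

theorem differential_model (u : F → F'') (y : F) : differential F F'' u y = fderiv ℝ u y := by
  rw [differential, mfderiv_eq_fderiv]

theorem pullback_congr {Φ Ψ : N → N''} {x : N} (α : Form F'' N'' k)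
    (h : Φ =ᶠ[𝓝 x] Ψ) : pullback (F := F) Φ α x = pullback Ψ α x := by
  simp only [pullback, differential, h.mfderiv_eq, h.eq_of_nhds]

end RealManifolds

section Manifolds

variable {F : Type*} [NormedAddCommGroup F] [NormedSpace ℂ F] [NormedSpace ℝ F]
  [IsScalarTower ℝ ℂ F] {N : Type*} [TopologicalSpace N] [ChartedSpace F N]
  [IsManifold 𝓘(ℂ, F) ω N]
  {F' : Type*} [NormedAddCommGroup F'] [NormedSpace ℂ F'] [NormedSpace ℝ F']
  [IsScalarTower ℝ ℂ F'] {N' : Type*} [TopologicalSpace N'] [ChartedSpace F' N']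
  [IsManifold 𝓘(ℂ, F') ω N']
  {F'' : Type*} [NormedAddCommGroup F''] [NormedSpace ℝ F'']
  {N'' : Type*} [TopologicalSpace N''] [ChartedSpace F'' N''] {k : ℕ}

theorem contDiffOn_atlas_transition {e e' : OpenPartialHomeomorph N F} (he : e ∈ atlas F N)
    (he' : e' ∈ atlas F N) : ContDiffOn ℂ ω (fun y => e' (e.symm y)) (e.symm.trans e').source := by
  have h := (contDiffGroupoid ω 𝓘(ℂ, F)).compatible he he'
  rw [contDiffGroupoid, mem_groupoid_of_pregroupoid] at h
  simpa [contDiffPregroupoid, Function.comp_def] using h.1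

theorem contDiffOn_transition (x₀ x₁ : N) :
    ContDiffOn ℂ ω (fun y => chartAt F x₁ ((chartAt F x₀).symm y))
      ((chartAt F x₀).symm.trans (chartAt F x₁)).source := by
  exact contDiffOn_atlas_transition (chart_mem_atlas F x₀) (chart_mem_atlas F x₁)

theorem contDiffAt_transition (x₀ x₁ : N) {y : F} (hy : y ∈ (chartAt F x₀).target)
    (hy' : (chartAt F x₀).symm y ∈ (chartAt F x₁).source) :
    ContDiffAt ℂ ω (fun y => chartAt F x₁ ((chartAt F x₀).symm y)) y :=
  (contDiffOn_transition x₀ x₁).contDiffAt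
    (((chartAt F x₀).symm.trans (chartAt F x₁)).open_source.mem_nhds
      (by simpa using ⟨hy, hy'⟩))

/-- The real manifold underlying a complex manifold. -/
theorem isManifold_real (F N : Type*) [NormedAddCommGroup F] [NormedSpace ℂ F] [NormedSpace ℝ F]
    [IsScalarTower ℝ ℂ F] [TopologicalSpace N] [ChartedSpace F N] [IsManifold 𝓘(ℂ, F) ω N]
    (n : WithTop ℕ∞) : IsManifold 𝓘(ℝ, F) n N := by
  refine isManifold_of_contDiffOn 𝓘(ℝ, F) n N ?_
  intro e e' he he'
  simpa [Function.comp_def] using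
    ((contDiffOn_atlas_transition he he').restrict_scalars ℝ).of_le le_top

theorem mdifferentiableAt_chart (x₀ : N) {p : N} (hp : p ∈ (chartAt F x₀).source) :
    MDifferentiableAt 𝓘(ℝ, F) 𝓘(ℝ, F) (chartAt F x₀) p :=
  have := isManifold_real F N 1
  mdifferentiableAt_atlas (chart_mem_atlas F x₀) hp

theorem mdifferentiableAt_chart_symm (x₀ : N) {y : F} (hy : y ∈ (chartAt F x₀).target) :
    MDifferentiableAt 𝓘(ℝ, F) 𝓘(ℝ, F) (chartAt F x₀).symm y :=
  have := isManifold_real F N 1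
  mdifferentiableAt_atlas_symm (chart_mem_atlas F x₀) hy

theorem differential_eq {Φ : N → N''} {x : N}
    (hΦ : MDifferentiableAt 𝓘(ℝ, F) 𝓘(ℝ, F'') Φ x) :
    differential F F'' Φ x =
      fderiv ℝ (fun y => chartAt F'' (Φ x) (Φ ((chartAt F x).symm y))) (chartAt F x x) := by
  rw [differential, hΦ.mfderiv]
  simp [writtenInExtChartAt, Function.comp_def]

theorem differential_chart_symm (x₀ : N) {y : F} (hy : y ∈ (chartAt F x₀).target) :
    differential F F (chartAt F x₀).symm y =
      fderiv ℝ (fun z => chartAt F ((chartAt F x₀).symm y) ((chartAt F x₀).symm z)) y := by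
  rw [differential, (mdifferentiableAt_chart_symm x₀ hy).mfderiv]
  simp [writtenInExtChartAt, Function.comp_def, chartAt_self_eq]

/-- Tangent spaces are identified with the model through the preferred chart, so this chart is
invisible at its own centre. Values of forms can thus be read off in charts. -/
theorem differential_chart_symm_self (p : N) :
    differential F F (chartAt F p).symm (chartAt F p p) = ContinuousLinearMap.id ℝ F := by
  rw [differential_chart_symm p (mem_chart_target F p)]
  have h : (fun z => chartAt F ((chartAt F p).symm (chartAt F p p)) ((chartAt F p).symm z))
      =ᶠ[𝓝 (chartAt F p p)] id := by
    rw [(chartAt F p).left_inv (mem_chart_source F p)]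
    filter_upwards [(chartAt F p).open_target.mem_nhds (mem_chart_target F p)] with z hz
    exact (chartAt F p).right_inv hz
  rw [h.fderiv_eq, fderiv_id]

theorem inChart_self (α : Form F N k) (p : N) :
    inChart (chartAt F p) α (chartAt F p p) = α p := by
  rw [inChart, pullback, differential_chart_symm_self,
    (chartAt F p).left_inv (mem_chart_source F p)]
  rfl

theorem differential_chart_symm_I_smul (x₀ : N) {y : F} (hy : y ∈ (chartAt F x₀).target)
    (v : F) : differential F F (chartAt F x₀).symm y (Complex.I • v) =
      Complex.I • differential F F (chartAt F x₀).symm y v := by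
  rw [differential_chart_symm x₀ hy]
  exact fderiv_real_I_smul
    ((contDiffAt_transition x₀ _ hy (mem_chart_source F _)).differentiableAt (by simp)) v

theorem mdifferentiableAt_of_differentiableAt (x₀ : N) {u : N → F''} {y : F}
    (hy : y ∈ (chartAt F x₀).target)
    (hu : DifferentiableAt ℝ (fun z => u ((chartAt F x₀).symm z)) y) :
    MDifferentiableAt 𝓘(ℝ, F) 𝓘(ℝ, F'') u ((chartAt F x₀).symm y) := by
  have hp := (chartAt F x₀).map_target hy
  rw [← (chartAt F x₀).right_inv hy] at hu
  have h := hu.mdifferentiableAt.comp ((chartAt F x₀).symm y) (mdifferentiableAt_chart x₀ hp)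
  refine h.congr_of_eventuallyEq ?_
  filter_upwards [(chartAt F x₀).open_source.mem_nhds hp] with z hz
  simp [(chartAt F x₀).left_inv hz]

theorem inChart_dc (x₀ : N) {u : N → ℝ} {y : F} (hy : y ∈ (chartAt F x₀).target)
    (hu : DifferentiableAt ℝ (fun z => u ((chartAt F x₀).symm z)) y) :
    inChart (chartAt F x₀) (dc u) y = flatDc (fun z => u ((chartAt F x₀).symm z)) y := by
  have h := differential_comp (mdifferentiableAt_of_differentiableAt x₀ hy hu)
    (mdifferentiableAt_chart_symm x₀ hy)
  rw [differential_model] at h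
  ext v
  rw [flatDc_apply, h]
  simp [inChart, pullback, dc, differential_chart_symm_I_smul x₀ hy]

/-- At points near `p`, `dc u` is expressed in their own preferred charts, not in that of `p`. The
transition maps are holomorphic, so in the chart at `p` it still becomes the flat `d^c`, and only
then is `d` taken. -/
theorem ddc_eq {u : N → ℝ} {p : N}
    (hu : ContDiffAt ℝ 2 (fun z => u ((chartAt F p).symm z)) (chartAt F p p)) :
    ddc u p = flatDdc (fun z => u ((chartAt F p).symm z)) (chartAt F p p) := by
  refine Filter.EventuallyEq.extDeriv_eq ?_
  filter_upwards [hu.eventually (by simp),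
    (chartAt F p).open_target.mem_nhds (mem_chart_target F p)] with z hz hz'
  exact inChart_dc p hz' (hz.differentiableAt two_ne_zero)

end Manifolds

end MomentumConstruction

end

noncomputable section

namespace MomentumConstruction

/-! ### Standard charts of the completion on its two sides, and the norm in them. -/

section Charts

variable {E : Type*} [NormedAddCommGroup E] [NormedSpace ℂ E]
  {M : Type*} [TopologicalSpace M] [ChartedSpace E M]
  {L : M → Type*} [∀ x, AddCommGroup (L x)] [∀ x, Module ℂ (L x)]
  [TopologicalSpace (TotalSpace ℂ L)] [∀ x, TopologicalSpace (L x)]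
  [FiberBundle ℂ L] [VectorBundle ℂ ℂ L]

/-- The point of the zero section (`b = false`) or of the section at infinity (`b = true`). -/
def pole (E : Type*) {M : Type*} (L : M → Type*) [∀ x, AddCommGroup (L x)] (b : Bool) (x : M) :
    Completion E L :=
  ⟨x, bif b then OnePoint.infty else ((0 : L x) : OnePoint (L x))⟩

/-- The side of the completion whose charts are preferred at a point. -/
def side (p : Completion E L) : Bool := p.fibre.elim true fun _ => false

/-- The standard charts of the completion, on the side of the zero section (`b = false`) or of the
section at infinity (`b = true`). -/
def stdChart (E : Type*) [NormedAddCommGroup E] {M : Type*} [TopologicalSpace M]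
    [ChartedSpace E M] (L : M → Type*) [∀ x, AddCommGroup (L x)] [∀ x, Module ℂ (L x)]
    [TopologicalSpace (TotalSpace ℂ L)]
    [∀ x, TopologicalSpace (L x)] [FiberBundle ℂ L] [VectorBundle ℂ ℂ L] (b : Bool) (x₀ : M) :
    OpenPartialHomeomorph (Completion E L) (E × ℂ) :=
  chartAt (E × ℂ) (pole E L b x₀)

theorem chartAt_eq (p : Completion E L) :
    chartAt (E × ℂ) p = stdChart E L (side p) p.base := by
  obtain ⟨x, v⟩ := p
  induction v using OnePoint.rec <;> rfl

theorem chartAt_pole (b : Bool) (x₀ : M) :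
    chartAt (E × ℂ) (pole E L b x₀) = stdChart E L b x₀ := rfl

/-- The sign of the logarithm of the norm on the two sides. -/
def sgn (b : Bool) : ℝ := bif b then -1 else 1

@[simp] theorem sgn_mul_self (b : Bool) : sgn b * sgn b = 1 := by cases b <;> simp [sgn]

theorem sgn_ne_zero (b : Bool) : sgn b ≠ 0 := by cases b <;> simp [sgn]

/-- The identity for `b = false`, the inversion for `b = true`. -/
def flip {α : Type*} [Inv α] (b : Bool) (x : α) : α := bif b then x⁻¹ else x

/-- The domain of the preferred trivialization, in the preferred chart of the base. -/
def region (E : Type*) [NormedAddCommGroup E] {M : Type*} [TopologicalSpace M]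
    [ChartedSpace E M] (L : M → Type*) [TopologicalSpace (TotalSpace ℂ L)]
    [∀ x, TopologicalSpace (L x)] [FiberBundle ℂ L] (x₀ : M) : Set E :=
  (chartAt E x₀).target ∩ (chartAt E x₀).symm ⁻¹' chartDomain E L x₀

theorem isOpen_region (x₀ : M) : IsOpen (region E L x₀) :=
  (chartAt E x₀).isOpen_inter_preimage_symm
    ((chartAt E x₀).open_source.inter (trivializationAt ℂ L x₀).open_baseSet)

theorem mem_stdChart_target {b : Bool} {x₀ : M} {q : E × ℂ} :
    q ∈ (stdChart E L b x₀).target ↔ q.1 ∈ region E L x₀ := by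
  cases b <;> rfl

theorem base_stdChart_symm (b : Bool) (x₀ : M) (q : E × ℂ) :
    ((stdChart E L b x₀).symm q).base = (chartAt E x₀).symm q.1 := by
  cases b <;> rfl

theorem stdChart_fst (b : Bool) (x₀ : M) (p : Completion E L) :
    (stdChart E L b x₀ p).1 = chartAt E x₀ p.base := by
  cases b <;> rfl

theorem stdChart_false_symm (x₀ : M) (q : E × ℂ) :
    (stdChart E L false x₀).symm q = ⟨(chartAt E x₀).symm q.1,
      ((trivializationAt ℂ L x₀).symm ((chartAt E x₀).symm q.1) q.2 : L _)⟩ := rfl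

theorem stdChart_true_symm (x₀ : M) (q : E × ℂ) :
    (stdChart E L true x₀).symm q = ⟨(chartAt E x₀).symm q.1,
      if q.2 = 0 then OnePoint.infty else
      ((trivializationAt ℂ L x₀).symm ((chartAt E x₀).symm q.1) q.2⁻¹ : L _)⟩ := rfl

theorem mem_stdChart_source_false {x₀ : M} {p : Completion E L} :
    p ∈ (stdChart E L false x₀).source ↔
      p.base ∈ chartDomain E L x₀ ∧ p.fibre ≠ OnePoint.infty := Iff.rfl

theorem mem_stdChart_source_true {x₀ : M} {p : Completion E L} :
    p ∈ (stdChart E L true x₀).source ↔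
      p.base ∈ chartDomain E L x₀ ∧ p.fibre ≠ ((0 : L p.base) : OnePoint (L p.base)) := Iff.rfl

theorem puncturedBundle_iff {p : Completion E L} :
    p ∈ puncturedBundle E L ↔
      p.fibre ≠ OnePoint.infty ∧ p.fibre ≠ ((0 : L p.base) : OnePoint (L p.base)) := by
  obtain ⟨x, v⟩ := p
  induction v using OnePoint.rec with
  | infty => simp [puncturedBundle]
  | coe v => simp [puncturedBundle]

theorem stdChart_symm_mem_punctured {b : Bool} {x₀ : M} {q : E × ℂ}
    (hq : q.1 ∈ region E L x₀) :
    (stdChart E L b x₀).symm q ∈ puncturedBundle E L ↔ q.2 ≠ 0 := by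
  cases b
  · simp [stdChart_false_symm, puncturedBundle_iff, symm_eq_zero_iff hq.2.2]
  · by_cases h : q.2 = 0
    · simp [stdChart_true_symm, puncturedBundle_iff, h]
    · simp [stdChart_true_symm, puncturedBundle_iff, h, symm_eq_zero_iff hq.2.2]

theorem symm_eq_smul {x₀ y : M} (hy : y ∈ (trivializationAt ℂ L x₀).baseSet) (c z : ℂ) :
    (trivializationAt ℂ L x₀).symm y (c * z) = c • (trivializationAt ℂ L x₀).symm y z := by
  rw [← Trivialization.symmL_apply (R := ℂ) _ hy, ← Trivialization.symmL_apply (R := ℂ) _ hy,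
    ← smul_eq_mul, map_smul]

/-- Multiplication by `c` in the fibres, in standard charts. -/
theorem scale_stdChart_symm {b : Bool} {x₀ : M} {q : E × ℂ} (hq : q.1 ∈ region E L x₀) {c : ℂ}
    (hc : c ≠ 0) : scale c ((stdChart E L b x₀).symm q) =
      (stdChart E L b x₀).symm (q.1, flip b c * q.2) := by
  cases b
  · simp only [stdChart_false_symm, scale, flip, cond_false, symm_eq_smul hq.2.2]
    rfl
  · by_cases h : q.2 = 0
    · simp [stdChart_true_symm, scale, flip, h]
    · have hinv : (c⁻¹ * q.2)⁻¹ = c * q.2⁻¹ := by rw [mul_inv, inv_inv]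
      have h' : c⁻¹ * q.2 ≠ 0 := mul_ne_zero (inv_ne_zero hc) h
      simp only [stdChart_true_symm, scale, flip, h, h', if_false, cond_true, hinv,
        symm_eq_smul hq.2.2]
      rfl

section Norm

variable (h : HermitianMetric E L)

theorem HermitianMetric.normSq_zero (x : M) : h.normSq x 0 = 0 := by
  simpa using h.normSq_smul x 0 0

/-- The squared norm `K` of the frame of a standard chart (of its dual on the side of infinity). -/
def frameNorm (b : Bool) (x₀ : M) (z : E) : ℝ :=
  flip b (h.normSq ((chartAt E x₀).symm z)
    ((trivializationAt ℂ L x₀).symm ((chartAt E x₀).symm z) 1))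

theorem frameNorm_pos (b : Bool) {x₀ : M} {z : E} (hz : z ∈ region E L x₀) :
    0 < frameNorm h b x₀ z := by
  have : 0 < h.normSq ((chartAt E x₀).symm z)
      ((trivializationAt ℂ L x₀).symm ((chartAt E x₀).symm z) 1) :=
    h.normSq_pos _ _ (by simp [symm_eq_zero_iff hz.2.2])
  cases b
  · exact this
  · exact inv_pos.mpr this

theorem normSq_symm {x₀ y : M} (hy : y ∈ (trivializationAt ℂ L x₀).baseSet) (w : ℂ) :
    h.normSq y ((trivializationAt ℂ L x₀).symm y w) =
      ‖w‖ ^ 2 * h.normSq y ((trivializationAt ℂ L x₀).symm y 1) := by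
  rw [← h.normSq_smul, ← symm_eq_smul hy, mul_one]

/-- The squared norm in standard charts. -/
theorem extNormSq_stdChart_symm {b : Bool} {x₀ : M} {q : E × ℂ} (hq : q.1 ∈ region E L x₀) :
    h.extNormSq ((stdChart E L b x₀).symm q) =
      flip b (ENNReal.ofReal (frameNorm h b x₀ q.1 * ‖q.2‖ ^ 2)) := by
  have hK := frameNorm_pos h false hq
  cases b
  · simp only [stdChart_false_symm, HermitianMetric.extNormSq, flip, frameNorm, cond_false,
      OnePoint.elim_some]
    rw [normSq_symm h hq.2.2 q.2, mul_comm]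
  · by_cases h0 : q.2 = 0
    · simp [stdChart_true_symm, HermitianMetric.extNormSq, flip, h0]
    · have hw : 0 < ‖q.2‖ := norm_pos_iff.mpr h0
      simp only [frameNorm, flip, cond_false] at hK
      simp only [stdChart_true_symm, HermitianMetric.extNormSq, flip, h0, if_false, cond_true,
        OnePoint.elim_some, frameNorm]
      rw [normSq_symm h hq.2.2 q.2⁻¹]
      rw [← ENNReal.ofReal_inv_of_pos (by positivity)]
      congr 1
      simp [mul_comm]

/-- The logarithm of the norm in standard charts. -/
theorem logNorm_stdChart_symm {b : Bool} {x₀ : M} {q : E × ℂ} (hq : q.1 ∈ region E L x₀)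
    (h0 : q.2 ≠ 0) : h.logNorm ((stdChart E L b x₀).symm q) =
      sgn b * ((1 / 2) * Real.log (frameNorm h b x₀ q.1) + Real.log ‖q.2‖) := by
  have hK := frameNorm_pos h false hq
  have hw : 0 < ‖q.2‖ := norm_pos_iff.mpr h0
  simp only [frameNorm, flip, cond_false] at hK
  cases b
  · simp only [stdChart_false_symm, HermitianMetric.logNorm, flip, frameNorm, cond_false,
      OnePoint.elim_some, sgn]
    rw [normSq_symm h hq.2.2 q.2, Real.log_mul (by positivity) hK.ne', Real.log_pow]
    push_cast
    ring
  · simp only [stdChart_true_symm, HermitianMetric.logNorm, flip, frameNorm, cond_true,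
      OnePoint.elim_some, sgn, h0, if_false]
    rw [normSq_symm h hq.2.2 q.2⁻¹, Real.log_mul (by simp [h0]) hK.ne', Real.log_pow, Real.log_inv, norm_inv, Real.log_inv]
    push_cast
    ring

theorem frameNorm_mul_eq_exp {b : Bool} {x₀ : M} {q : E × ℂ} (hq : q.1 ∈ region E L x₀)
    (h0 : q.2 ≠ 0) : frameNorm h b x₀ q.1 * ‖q.2‖ ^ 2 =
      Real.exp (2 * ((1 / 2) * Real.log (frameNorm h b x₀ q.1) + Real.log ‖q.2‖)) := by
  have hK := frameNorm_pos h b hq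
  have hw : 0 < ‖q.2‖ := norm_pos_iff.mpr h0
  rw [mul_add, ← mul_assoc, Real.exp_add]
  norm_num
  rw [Real.exp_log hK, two_mul, Real.exp_add, Real.exp_log hw, sq]

end Norm

end Charts

end MomentumConstruction

end

noncomputable section

namespace MomentumConstruction

/-! ### Smoothness of the frame norm, the circle field and pullback from the base in charts. -/

section Charts

variable {E : Type*} [NormedAddCommGroup E] [NormedSpace ℂ E]
  {M : Type*} [TopologicalSpace M] [ChartedSpace E M] [IsManifold 𝓘(ℂ, E) ω M]
  {L : M → Type*} [∀ x, AddCommGroup (L x)] [∀ x, Module ℂ (L x)]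
  [TopologicalSpace (TotalSpace ℂ L)] [∀ x, TopologicalSpace (L x)]
  [FiberBundle ℂ L] [VectorBundle ℂ ℂ L] [ContMDiffVectorBundle ω ℂ L 𝓘(ℂ, E)]

theorem isManifold_totalSpace_real :
    IsManifold (𝓘(ℝ, E).prod 𝓘(ℝ, ℂ)) ∞ (TotalSpace ℂ L) := by
  refine isManifold_of_contDiffOn (𝓘(ℝ, E).prod 𝓘(ℝ, ℂ)) ∞ (TotalSpace ℂ L) ?_
  intro e e' he he'
  have h := (contDiffGroupoid ω (𝓘(ℂ, E).prod 𝓘(ℂ, ℂ))).compatible he he'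
  rw [contDiffGroupoid, mem_groupoid_of_pregroupoid] at h
  have h1 := h.1
  simp only [contDiffPregroupoid] at h1
  have h2 := (h1.restrict_scalars ℝ).of_le (m := ∞) le_top
  exact h2

theorem contDiffAt_frameNorm (h : HermitianMetric E L) (b : Bool) {x₀ : M} {z : E}
    (hz : z ∈ region E L x₀) : ContDiffAt ℝ ∞ (frameNorm h b x₀) z := by
  have key : ContDiffAt ℝ ∞ (frameNorm h false x₀) z := by
    have := isManifold_totalSpace_real (E := E) (M := M) (L := L)
    -- In the bundle chart over `x₀` the unit frame vector has coordinates `(z, 1)`, so the frame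
    -- norm is the coordinate expression of the squared norm on the slice `w = 1`.
    have h1 := (contMDiff_iff.mp h.contMDiff).2 (⟨x₀, 0⟩ : TotalSpace ℂ L) 0
    have hmaps : region E L x₀ ⊆ (fun z : E => ((z, 1) : E × ℂ)) ⁻¹'
        (extChartAt (𝓘(ℝ, E).prod 𝓘(ℝ, ℂ)) (⟨x₀, 0⟩ : TotalSpace ℂ L)).target := by
      intro z hz
      simp only [FiberBundle.chartedSpace_chartAt, mem_preimage, mfld_simps,
        Trivialization.mem_target]
      exact ⟨⟨hz.1, mem_univ _⟩, hz.2.2⟩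
    have h2 : ContDiffOn ℝ ∞ (fun z : E => ((z, 1) : E × ℂ)) (region E L x₀) :=
      (contDiff_id.prodMk contDiff_const).contDiffOn
    have h3 := h1.comp h2 fun y hy => ⟨hmaps hy, by simp [chartAt_self_eq]⟩
    refine (h3.contDiffAt ((isOpen_region x₀).mem_nhds hz)).congr_of_eventuallyEq ?_
    filter_upwards [(isOpen_region x₀).mem_nhds hz] with y hy
    have h4 := (trivializationAt ℂ L x₀).mk_symm hy.2.2 1
    simp only [FiberBundle.chartedSpace_chartAt, chartAt_self_eq, Function.comp_apply, mfld_simps]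
    change _ = h.normSq ((trivializationAt ℂ L x₀).toOpenPartialHomeomorph.symm
      ((chartAt E x₀).symm y, 1)).proj ((trivializationAt ℂ L x₀).toOpenPartialHomeomorph.symm
      ((chartAt E x₀).symm y, 1)).snd
    rw [← h4]
    rfl
  cases b
  · exact key
  · exact key.inv (frameNorm_pos h false hz).ne'

theorem stdChart_right_inv {b : Bool} {x₀ : M} {q : E × ℂ} (hq : q.1 ∈ region E L x₀) :
    stdChart E L b x₀ ((stdChart E L b x₀).symm q) = q :=
  (stdChart E L b x₀).right_inv (mem_stdChart_target.mpr hq)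

/-- The vector field generating the circle action, in the preferred chart. -/
theorem circleField_eq (p : Completion E L) :
    circleField p = (0, sgn (side p) • (Complex.I * (chartAt (E × ℂ) p p).2)) := by
  set c := chartAt (E × ℂ) p with hc
  set q := c p with hq
  have hcs : c = stdChart E L (side p) p.base := chartAt_eq p
  have hqt : q ∈ c.target := mem_chart_target _ p
  have hqr : q.1 ∈ region E L p.base := mem_stdChart_target.mp (hcs ▸ hqt)
  have hps : c.symm q = p := c.left_inv (mem_chart_source _ p)
  -- Near infinity the fibre coordinate is the inverse one, so a rotation by `θ` acts on it as a
  -- rotation by `-θ`; hence the sign.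
  let γ : ℝ → E × ℂ := fun θ => (q.1, Complex.exp (sgn (side p) * θ * Complex.I) * q.2)
  have hγ0 : γ 0 = q := by simp [γ]
  have hcurve : (fun θ : ℝ => scale (Complex.exp (θ * Complex.I)) p) = fun θ => c.symm (γ θ) := by
    ext1 θ
    conv_lhs => rw [← hps, hcs]
    rw [scale_stdChart_symm hqr (Complex.exp_ne_zero _), hcs]
    congr 3
    cases side p
    · simp [flip, sgn]
    · simp [flip, sgn, ← Complex.exp_neg]
  have hγ : HasDerivAt γ (0, sgn (side p) • (Complex.I * q.2)) 0 := by
    refine (hasDerivAt_const _ _).prodMk ?_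
    have h1 : HasDerivAt (fun θ : ℝ => (sgn (side p) * θ * Complex.I : ℂ))
        (sgn (side p) * Complex.I) 0 := by
      simpa using ((Complex.ofRealCLM.hasDerivAt (x := (0 : ℝ))).const_mul
        (sgn (side p) : ℂ)).mul_const Complex.I
    have h2 := (h1.cexp).mul_const q.2
    simpa [mul_assoc] using h2
  rw [circleField, hcurve, differential_comp (F' := E × ℂ) (Ψ := c.symm) (Φ := γ)
    (by rw [hγ0]; exact mdifferentiableAt_chart_symm p hqt)
    hγ.differentiableAt.mdifferentiableAt, hγ0, differential_chart_symm_self,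
    differential_model, hγ.hasFDerivAt.fderiv]
  simp

theorem mdifferentiableAt_base (p : Completion E L) :
    MDifferentiableAt 𝓘(ℝ, E × ℂ) 𝓘(ℝ, E) (Completion.base : Completion E L → M) p := by
  have hp := mem_chart_source (E × ℂ) p
  have h1 := mdifferentiableAt_chart (F := E × ℂ) p hp
  have h2 : MDifferentiableAt 𝓘(ℝ, E × ℂ) 𝓘(ℝ, E) (Prod.fst : E × ℂ → E) (chartAt (E × ℂ) p p) :=
    differentiableAt_fst.mdifferentiableAt
  have ht : (chartAt (E × ℂ) p p).1 ∈ (chartAt E p.base).target := by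
    rw [chartAt_eq, stdChart_fst]
    exact mem_chart_target _ _
  have h3 := mdifferentiableAt_chart_symm (F := E) p.base ht
  have h4 := h3.comp p (h2.comp p h1)
  refine h4.congr_of_eventuallyEq ?_
  filter_upwards [(chartAt (E × ℂ) p).open_source.mem_nhds hp] with z hz
  conv_lhs => rw [← (chartAt (E × ℂ) p).left_inv hz, chartAt_eq, base_stdChart_symm]
  simp [chartAt_eq]

/-- The pullback of a form on the base, in standard charts. -/
theorem inChart_pullback_base {k : ℕ} (α : Form E M k) (b : Bool) (x₀ : M) {q : E × ℂ}
    (hq : q.1 ∈ region E L x₀) :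
    inChart (stdChart E L b x₀) (pullback Completion.base α) q =
      (inChart (chartAt E x₀) α q.1).compContinuousLinearMap (ContinuousLinearMap.fst ℝ E ℂ) := by
  rw [inChart, ← pullback_comp α (mdifferentiableAt_base _)
    (by rw [← chartAt_pole]; exact mdifferentiableAt_chart_symm _ (mem_stdChart_target.mpr hq))]
  simp only [base_stdChart_symm]
  rw [pullback_comp (Φ := (Prod.fst : E × ℂ → E)) α (mdifferentiableAt_chart_symm _ hq.1)
    differentiableAt_fst.mdifferentiableAt]
  rw [pullback, differential_model, fderiv_fst]
  rfl

theorem pullback_base_eq {k : ℕ} (α : Form E M k) (p : Completion E L) :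
    pullback Completion.base α p =
      (α p.base).compContinuousLinearMap (ContinuousLinearMap.fst ℝ E ℂ) := by
  have hq : (chartAt (E × ℂ) p p).1 ∈ region E L p.base := by
    have := mem_chart_target (E × ℂ) p
    rw [chartAt_eq] at this ⊢
    exact mem_stdChart_target.mp this
  rw [← inChart_self (pullback Completion.base α) p, chartAt_eq p,
    inChart_pullback_base α _ _ (by rwa [chartAt_eq p] at hq), stdChart_fst, inChart_self]

end Charts

end MomentumConstruction

end

noncomputable section

namespace MomentumConstruction

/-! ### The local model: functions of the norm on `E × ℂ`. -/

section TypeOneOne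

variable {F : Type*} [NormedAddCommGroup F] [NormedSpace ℂ F] [NormedSpace ℝ F]
  [IsScalarTower ℝ ℂ F]

theorem I_smul_I_smul (v : F) : Complex.I • Complex.I • v = -v := by
  rw [smul_smul, Complex.I_mul_I, neg_one_smul]

/-- Type `(1,1)` comes from the symmetry of the second derivative. -/
theorem flatDdc_I_smul {u : F → ℝ} {y : F} (hu : ContDiffAt ℝ 2 u y) (v w : F) :
    flatDdc u y ![Complex.I • v, Complex.I • w] = flatDdc u y ![v, w] := by
  have hs := hu.isSymmSndFDerivAt (by simp)
  rw [flatDdc_apply hu, flatDdc_apply hu, I_smul_I_smul, I_smul_I_smul, map_neg, map_neg,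
    hs.eq (Complex.I • w) v, hs.eq (Complex.I • v) w]
  ring

end TypeOneOne

section OneSided

variable {F : Type*} [NormedAddCommGroup F] [NormedSpace ℝ F]

/-- `G` is smooth only relative to `D`, which may end at the value `r y`, as `[0, c)` does for the
squared norm on the zero section. Since `r` stays in `D` near `y`, the composite is smooth in all
directions without extending `G`. -/
theorem contDiffAt_comp_of_eventually_mem {G : ℝ → ℝ} {D : Set ℝ} {n : WithTop ℕ∞}
    (hG : ContDiffOn ℝ n G D) {r : F → ℝ} {y : F} (hr : ContDiffAt ℝ n r y)
    (hD : ∀ᶠ z in 𝓝 y, r z ∈ D) : ContDiffAt ℝ n (fun z => G (r z)) y := by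
  have h := (hG (r y) hD.self_of_nhds).comp y (hr.contDiffWithinAt (s := r ⁻¹' D)) fun _ hz => hz
  exact h.contDiffAt hD

theorem fderiv_comp_of_eventually_mem {G : ℝ → ℝ} {D : Set ℝ}
    (hG : DifferentiableOn ℝ G D) {r : F → ℝ} {y : F} (hr : DifferentiableAt ℝ r y)
    (hD : ∀ᶠ z in 𝓝 y, r z ∈ D) :
    fderiv ℝ (fun z => G (r z)) y = derivWithin G D (r y) • fderiv ℝ r y := by
  have h1 := (hG (r y) hD.self_of_nhds).hasDerivWithinAt
  have h2 := h1.comp_hasFDerivWithinAt y (hr.hasFDerivAt.hasFDerivWithinAt (s := r ⁻¹' D))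
    fun _ hz => hz
  exact (h2.hasFDerivAt hD).fderiv

end OneSided

section Model

variable {E : Type*} [NormedAddCommGroup E] [NormedSpace ℂ E]

/-- Locally `log ‖z‖` is the real part of a branch of the logarithm, so its differential is `Re (dz
/ w)`. -/
theorem hasFDerivAt_log_norm {w : ℂ} (hw : w ≠ 0) :
    HasFDerivAt (fun z : ℂ => Real.log ‖z‖)
      (Complex.reCLM.comp ((ContinuousLinearMap.toSpanSingleton ℂ w⁻¹).restrictScalars ℝ)) w := by
  have h1 : HasDerivAt (fun z : ℂ => Complex.log (z / w)) w⁻¹ w := by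
    have := (hasDerivAt_id w).div_const w |>.clog (by simp [hw])
    simpa [hw] using this
  have h2 := Complex.reCLM.hasFDerivAt.comp w (h1.hasFDerivAt.restrictScalars ℝ)
  have h3 := h2.add_const (Real.log ‖w‖)
  refine h3.congr_of_eventuallyEq ?_
  filter_upwards [isOpen_ne.mem_nhds hw] with z hz
  simp [Complex.log_re,
    Real.log_div (norm_ne_zero_iff.mpr hz) (norm_ne_zero_iff.mpr hw)]

variable {K : E → ℝ}

/-- The logarithm of the norm in a frame of squared norm `K`. -/
def modelLog (K : E → ℝ) (q : E × ℂ) : ℝ := (1 / 2) * Real.log (K q.1) + Real.log ‖q.2‖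

/-- The squared norm in a frame of squared norm `K`. -/
def modelNormSq (K : E → ℝ) (q : E × ℂ) : ℝ := K q.1 * ‖q.2‖ ^ 2

theorem contDiffAt_halfLog {z : E} {n : WithTop ℕ∞} (hK : ContDiffAt ℝ n K z) (h0 : 0 < K z) :
    ContDiffAt ℝ n (fun y => (1 / 2) * Real.log (K y)) z :=
  contDiffAt_const.mul (hK.log h0.ne')

theorem contDiffAt_modelLog {q : E × ℂ} {n : WithTop ℕ∞} (hK : ContDiffAt ℝ n K q.1)
    (h0 : 0 < K q.1) (hq : q.2 ≠ 0) : ContDiffAt ℝ n (modelLog K) q :=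
  ((contDiffAt_halfLog hK h0).comp q contDiffAt_fst).add (contDiffAt_log_norm contDiffAt_snd hq)

theorem contDiffAt_modelNormSq {q : E × ℂ} {n : WithTop ℕ∞} (hK : ContDiffAt ℝ n K q.1) :
    ContDiffAt ℝ n (modelNormSq K) q :=
  (hK.comp q contDiffAt_fst).mul (contDiffAt_snd.norm_sq ℝ)

theorem fderiv_modelLog {q : E × ℂ} (hK : DifferentiableAt ℝ K q.1)
    (h0 : 0 < K q.1) (hq : q.2 ≠ 0) (ζ : E × ℂ) : fderiv ℝ (modelLog K) q ζ =
      fderiv ℝ (fun y => (1 / 2) * Real.log (K y)) q.1 ζ.1 + (ζ.2 * q.2⁻¹).re := by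
  have h1 : HasFDerivAt (fun y => (1 / 2) * Real.log (K y)) _ q.1 :=
    ((hK.log h0.ne').const_mul (1 / 2)).hasFDerivAt
  have h2 := (h1.comp q hasFDerivAt_fst).add ((hasFDerivAt_log_norm hq).comp q hasFDerivAt_snd)
  have h3 : HasFDerivAt (modelLog K) _ q := h2
  rw [h3.fderiv]
  simp

theorem flatDdc_comp_fst {κ : E → ℝ} {q : E × ℂ} (hκ : ContDiffAt ℝ 2 κ q.1) :
    flatDdc (fun p : E × ℂ => κ p.1) q =
      (flatDdc κ q.1).compContinuousLinearMap (ContinuousLinearMap.fst ℝ E ℂ) := by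
  rw [flatDdc_comp (P := κ) (ψ := Prod.fst) hκ contDiffAt_fst, fderiv_fst]

theorem flatDdc_modelLog {q : E × ℂ} (hK : ContDiffAt ℝ 2 K q.1)
    (h0 : 0 < K q.1) (hq : q.2 ≠ 0) : flatDdc (modelLog K) q =
      (flatDdc (fun y => (1 / 2) * Real.log (K y)) q.1).compContinuousLinearMap
        (ContinuousLinearMap.fst ℝ E ℂ) := by
  have h1 := contDiffAt_halfLog hK h0
  have h := flatDdc_add (y := q) (h1.comp q contDiffAt_fst)
    (contDiffAt_log_norm (g := Prod.snd) contDiffAt_snd hq)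
  have h' : flatDdc (modelLog K) q = _ := h
  rw [h', flatDdc_log_norm (g := Prod.snd) contDiffAt_snd hq, add_zero]
  exact flatDdc_comp_fst (κ := fun y => (1 / 2) * Real.log (K y)) h1

/-- The form `d d^c f(t)` outside the zero section. -/
theorem flatDdc_comp_modelLog {f : ℝ → ℝ} {q : E × ℂ} (hK : ContDiffAt ℝ 2 K q.1)
    (h0 : 0 < K q.1) (hq : q.2 ≠ 0) (hf : ContDiffAt ℝ 2 f (modelLog K q)) (v w : E × ℂ) :
    flatDdc (fun p => f (modelLog K p)) q ![v, w] =
      deriv f (modelLog K q) *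
        flatDdc (fun y => (1 / 2) * Real.log (K y)) q.1 ![v.1, w.1] +
      deriv (deriv f) (modelLog K q) *
        (fderiv ℝ (modelLog K) q w * fderiv ℝ (modelLog K) q (Complex.I • v) -
          fderiv ℝ (modelLog K) q v * fderiv ℝ (modelLog K) q (Complex.I • w)) := by
  rw [flatDdc_comp_real hf (contDiffAt_modelLog hK h0 hq), flatDdc_modelLog hK h0 hq]
  have hvw : (ContinuousLinearMap.fst ℝ E ℂ) ∘ ![v, w] = ![v.1, w.1] := by
    ext i
    fin_cases i <;> rfl
  rw [ContinuousAlternatingMap.compContinuousLinearMap_apply, hvw]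

theorem fderiv_norm_sq_snd : fderiv ℝ (fun p : E × ℂ => ‖p.2‖ ^ 2) =
    fun p => ((2 : ℝ) • (innerSL ℝ p.2)).comp (ContinuousLinearMap.snd ℝ E ℂ) := by
  ext1 p
  have h := (hasStrictFDerivAt_norm_sq (p.2 : ℂ)).hasFDerivAt.comp p
    (hasFDerivAt_snd (𝕜 := ℝ) (p := p))
  rw [show (fun p : E × ℂ => ‖p.2‖ ^ 2) = (fun x : ℂ => ‖x‖ ^ 2) ∘ Prod.snd from rfl, h.fderiv]
  ext v
  · simp
  · simp
    ring

/-- The squared norm is quadratic in the fibre coordinate. Along the sections every term containing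
its differential therefore drops out. -/
theorem fderiv_modelNormSq_zero {q : E × ℂ} (hK : DifferentiableAt ℝ K q.1) (hq : q.2 = 0) :
    fderiv ℝ (modelNormSq K) q = 0 := by
  have h1 : DifferentiableAt ℝ (fun p : E × ℂ => K p.1) q := hK.comp q differentiableAt_fst
  have h2 : DifferentiableAt ℝ (fun p : E × ℂ => ‖p.2‖ ^ 2) q :=
    differentiableAt_snd.norm_sq ℝ
  have : fderiv ℝ (modelNormSq K) q = _ := fderiv_fun_mul h1 h2
  rw [this, fderiv_norm_sq_snd]
  ext v <;> simp [hq]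

theorem fderiv_fderiv_modelNormSq {q : E × ℂ} (hK : ContDiffAt ℝ 2 K q.1) (hq : q.2 = 0)
    (v w : E × ℂ) : fderiv ℝ (fderiv ℝ (modelNormSq K)) q v w =
      2 * K q.1 * inner ℝ v.2 w.2 := by
  have hK' : ContDiffAt ℝ 2 (fun p : E × ℂ => K p.1) q := hK.comp q contDiffAt_fst
  have h2 (p : E × ℂ) : DifferentiableAt ℝ (fun p : E × ℂ => ‖p.2‖ ^ 2) p :=
    differentiableAt_snd.norm_sq ℝ
  -- The product rule for `K ‖w‖²`. When this is differentiated again at `q`, the second summand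
  -- contributes nothing, because `‖p.2‖²` and its differential vanish there.
  have h : (fun p => fderiv ℝ (modelNormSq K) p w) =ᶠ[𝓝 q] fun p =>
      K p.1 * (2 * inner ℝ w.2 p.2) + ‖p.2‖ ^ 2 * fderiv ℝ (fun p : E × ℂ => K p.1) p w := by
    filter_upwards [hK'.eventually (by simp)] with p hp
    have h3 : fderiv ℝ (modelNormSq K) p = _ :=
      fderiv_fun_mul (hp.differentiableAt two_ne_zero) (h2 p)
    rw [h3, fderiv_norm_sq_snd, real_inner_comm]
    simp
  have hd2 : DifferentiableAt ℝ (fderiv ℝ (fun p : E × ℂ => K p.1)) q :=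
    (hK'.fderiv_right (m := 1) (by norm_num)).differentiableAt one_ne_zero
  have hd3 : DifferentiableAt ℝ (fderiv ℝ (modelNormSq K)) q :=
    ((contDiffAt_modelNormSq hK).fderiv_right (m := 1) (by norm_num)).differentiableAt one_ne_zero
  have e0 : HasFDerivAt (fun p : E × ℂ => 2 * inner ℝ w.2 p.2)
      ((2 : ℝ) • (innerSL ℝ w.2).comp (ContinuousLinearMap.snd ℝ E ℂ)) q :=
    ((innerSL ℝ w.2).comp (ContinuousLinearMap.snd ℝ E ℂ)).hasFDerivAt.const_mul 2
  have e1 := (hK'.differentiableAt two_ne_zero).hasFDerivAt.mul e0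
  have e2 := (h2 q).hasFDerivAt.mul
    (hd2.hasFDerivAt.clm_apply (hasFDerivAt_const w q))
  have e3 := (e1.add e2).congr_of_eventuallyEq h
  have e4 := hd3.hasFDerivAt.clm_apply (hasFDerivAt_const w q)
  have e5 := congrArg (fun B => B v) (e4.unique e3)
  rw [fderiv_norm_sq_snd] at e5
  simp only [add_apply, ContinuousLinearMap.flip_apply,
    ContinuousLinearMap.comp_zero, smul_apply,
    ContinuousLinearMap.comp_apply, hq] at e5
  simp at e5
  rw [e5, real_inner_comm]
  simp
  ring

theorem flatDdc_modelNormSq_self {q : E × ℂ} (hK : ContDiffAt ℝ 2 K q.1) (hq : q.2 = 0)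
    (v : E × ℂ) : flatDdc (modelNormSq K) q ![v, Complex.I • v] = 4 * K q.1 * ‖v.2‖ ^ 2 := by
  rw [flatDdc_apply (contDiffAt_modelNormSq hK), fderiv_fderiv_modelNormSq hK hq,
    fderiv_fderiv_modelNormSq hK hq, I_smul_I_smul]
  have h1 : inner ℝ (Complex.I * v.2) (Complex.I * v.2) = ‖v.2‖ ^ 2 := by
    rw [real_inner_self_eq_norm_sq]; simp
  have h2 : inner ℝ v.2 v.2 = ‖v.2‖ ^ 2 := real_inner_self_eq_norm_sq _
  simp only [Prod.smul_snd, Prod.snd_neg, smul_eq_mul, inner_neg_right, h1, h2]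
  ring

end Model

end MomentumConstruction

end

noncomputable section

namespace MomentumConstruction

section Model

variable {E : Type*} [NormedAddCommGroup E] [NormedSpace ℂ E] {K : E → ℝ}

/-- The local potential `a log K / 2 + G(r)`. -/
def modelPotential (K : E → ℝ) (a : ℝ) (G : ℝ → ℝ) (q : E × ℂ) : ℝ :=
  a * ((1 / 2) * Real.log (K q.1)) + G (modelNormSq K q)

theorem contDiffAt_modelPotential {a : ℝ} {G : ℝ → ℝ} {D : Set ℝ} {q : E × ℂ} {n : WithTop ℕ∞}
    (hK : ContDiffAt ℝ n K q.1) (h0 : 0 < K q.1) (hG : ContDiffOn ℝ n G D)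
    (hD : ∀ᶠ p in 𝓝 q, modelNormSq K p ∈ D) : ContDiffAt ℝ n (modelPotential K a G) q :=
  (contDiffAt_const.mul ((contDiffAt_halfLog hK h0).comp q contDiffAt_fst)).add
    (contDiffAt_comp_of_eventually_mem hG (contDiffAt_modelNormSq hK) hD)

/-- The form `d d^c` of the potential along the zero section. -/
theorem flatDdc_modelPotential_self {a : ℝ} {G : ℝ → ℝ} {D : Set ℝ} {q : E × ℂ}
    (hK : ContDiffAt ℝ ∞ K q.1) (h0 : 0 < K q.1) (hG : ContDiffOn ℝ ∞ G D)
    (hU : UniqueDiffOn ℝ D)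
    (hD : ∀ᶠ p in 𝓝 q, modelNormSq K p ∈ D) (hq : q.2 = 0) (v : E × ℂ) :
    flatDdc (modelPotential K a G) q ![v, Complex.I • v] =
      a * flatDdc (fun y => (1 / 2) * Real.log (K y)) q.1 ![v.1, Complex.I • v.1] +
        derivWithin G D 0 * (4 * K q.1 * ‖v.2‖ ^ 2) := by
  have hK2 := hK.of_le two_le_infty
  have hG2 : ContDiffOn ℝ 1 (derivWithin G D) D := hG.derivWithin hU (by exact WithTop.coe_le_coe.mpr le_top)
  have hr := contDiffAt_modelNormSq (q := q) hK2
  have hr0 : modelNormSq K q = 0 := by simp [modelNormSq, hq]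
  have hκ := contDiffAt_halfLog hK2 h0
  have hκ' : ContDiffAt ℝ 2 (fun p : E × ℂ => (1 / 2) * Real.log (K p.1)) q :=
    hκ.comp q contDiffAt_fst
  have hGr := contDiffAt_comp_of_eventually_mem (hG.of_le two_le_infty) hr hD
  have hg := contDiffAt_comp_of_eventually_mem hG2 (hr.of_le one_le_two) hD
  -- With the one-sided `G'`, `d d^c G(r) = G'(r) d d^c r + d(G'(r)) ∧ d^c r`; the last term
  -- vanishes at `q` because `dr` does.
  have hd : fderiv ℝ (fun p => G (modelNormSq K p)) =ᶠ[𝓝 q]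
      fun p => derivWithin G D (modelNormSq K p) • fderiv ℝ (modelNormSq K) p := by
    filter_upwards [hD.eventually_nhds, hr.eventually (by simp)] with p hp hp'
    exact fderiv_comp_of_eventually_mem (hG.differentiableOn (by simp))
      (hp'.differentiableAt two_ne_zero) hp
  have h1 : flatDdc (modelPotential K a G) q = _ :=
    flatDdc_add (contDiffAt_const.mul hκ') hGr
  rw [h1, flatDdc_const_mul a hκ', ContinuousAlternatingMap.add_apply,
    flatDdc_of_fderiv_eq_smul hGr hr (hg.differentiableAt one_ne_zero) hd,
    flatDdc_modelNormSq_self hK2 hq,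
    fderiv_modelNormSq_zero (hK2.differentiableAt two_ne_zero) hq, hr0,
    flatDdc_comp_fst (κ := fun y => (1 / 2) * Real.log (K y)) hκ]
  have hvw : (Prod.fst ∘ ![v, Complex.I • v] : Fin 2 → E) =
      ![v.1, Complex.I • v.1] := by
    ext i
    fin_cases i <;> rfl
  simp [hvw]

end Model

/-! ### Invariant subbundles in standard charts. -/

section Charts

variable {E : Type*} [NormedAddCommGroup E] [NormedSpace ℂ E]
  {M : Type*} [TopologicalSpace M] [ChartedSpace E M] [IsManifold 𝓘(ℂ, E) ω M]
  {L : M → Type*} [∀ x, AddCommGroup (L x)] [∀ x, Module ℂ (L x)]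
  [TopologicalSpace (TotalSpace ℂ L)] [∀ x, TopologicalSpace (L x)]
  [FiberBundle ℂ L] [VectorBundle ℂ ℂ L] [ContMDiffVectorBundle ω ℂ L 𝓘(ℂ, E)]

/-- The values of the squared norm `r` (or of `1 / r`) on `r⁻¹(J)`. -/
def sideDomain (b : Bool) (J : Set ℝ≥0∞) : Set ℝ := {s | 0 ≤ s ∧ flip b (ENNReal.ofReal s) ∈ J}

theorem continuous_flip_ofReal (b : Bool) : Continuous fun s => flip b (ENNReal.ofReal s) := by
  cases b
  · exact ENNReal.continuous_ofReal
  · exact continuous_inv.comp ENNReal.continuous_ofReal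

theorem uniqueDiffOn_sideDomain (b : Bool) {J : Set ℝ≥0∞} (hJ : IsOpen J) :
    UniqueDiffOn ℝ (sideDomain b J) :=
  (uniqueDiffOn_Ici 0).inter (hJ.preimage (continuous_flip_ofReal b))

theorem exp_mem_sideDomain {b : Bool} {J : Set ℝ≥0∞} {t : ℝ} :
    Real.exp (2 * t) ∈ sideDomain b J ↔ sgn b * t ∈ logInterval J := by
  cases b
  · simp [sideDomain, logInterval, flip, sgn, Real.exp_nonneg]
  · simp only [sideDomain, logInterval, flip, sgn, Real.exp_nonneg, mem_ofPred_eq, true_and,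
      cond_true]
    rw [← ENNReal.ofReal_inv_of_pos (Real.exp_pos _), ← Real.exp_neg]
    ring_nf

variable (h : HermitianMetric E L)

theorem mem_subbundle_iff {b : Bool} {x₀ : M} {q : E × ℂ} {J : Set ℝ≥0∞}
    (hq : q.1 ∈ region E L x₀) : (stdChart E L b x₀).symm q ∈ h.subbundle J ↔
      modelNormSq (frameNorm h b x₀) q ∈ sideDomain b J := by
  rw [HermitianMetric.subbundle, mem_preimage, extNormSq_stdChart_symm h hq]
  exact ⟨fun hJ => ⟨mul_nonneg (frameNorm_pos h b hq).le (by positivity), hJ⟩, fun hJ => hJ.2⟩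

/-- `sideDomain b J` may contain its end `0` and need not be open in `ℝ`; the squared norm is never
negative, so it cannot leave the set through that end. -/
theorem eventually_mem_sideDomain {b : Bool} {x₀ : M} {q : E × ℂ} {J : Set ℝ≥0∞}
    (hJ : IsOpen J) (hq : q.1 ∈ region E L x₀)
    (hD : modelNormSq (frameNorm h b x₀) q ∈ sideDomain b J) :
    ∀ᶠ p in 𝓝 q, modelNormSq (frameNorm h b x₀) p ∈ sideDomain b J := by
  have h1 := (contDiffAt_modelNormSq (q := q) (contDiffAt_frameNorm h b hq)).continuousAt
  have h2 := (continuous_flip_ofReal b).continuousAt.comp h1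
  filter_upwards [h2 (hJ.mem_nhds hD.2),
    continuous_fst.continuousAt ((isOpen_region x₀).mem_nhds hq)] with p hp hp'
  exact ⟨mul_nonneg (frameNorm_pos h b hp').le (by positivity), hp⟩

theorem side_stdChart_symm {b : Bool} {x₀ : M} {q : E × ℂ} (hq : q.2 = 0) :
    side ((stdChart E L b x₀).symm q) = b := by
  cases b
  · rfl
  · simp [stdChart_true_symm, hq, side]

theorem mem_stdChart_source_of_punctured {b : Bool} {x₀ : M} {p : Completion E L}
    (hp : p ∈ puncturedBundle E L) (hx : p.base ∈ chartDomain E L x₀) :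
    p ∈ (stdChart E L b x₀).source := by
  rw [puncturedBundle_iff] at hp
  cases b
  · exact mem_stdChart_source_false.mpr ⟨hx, hp.1⟩
  · exact mem_stdChart_source_true.mpr ⟨hx, hp.2⟩

theorem stdChart_source_base {b : Bool} {x₀ : M} {p : Completion E L}
    (hp : p ∈ (stdChart E L b x₀).source) : p.base ∈ chartDomain E L x₀ := by
  cases b
  · exact (mem_stdChart_source_false.mp hp).1
  · exact (mem_stdChart_source_true.mp hp).1

theorem stdChart_mem_region {b : Bool} {x₀ : M} {p : Completion E L}
    (hp : p ∈ (stdChart E L b x₀).source) : (stdChart E L b x₀ p).1 ∈ region E L x₀ :=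
  mem_stdChart_target.mp ((stdChart E L b x₀).map_source hp)

theorem contDiffAt_stdChart_transition {b b' : Bool} {x₀ x₁ : M} {q : E × ℂ}
    (hq : q.1 ∈ region E L x₀)
    (hq' : (stdChart E L b x₀).symm q ∈ (stdChart E L b' x₁).source) :
    ContDiffAt ℂ ω (fun z => stdChart E L b' x₁ ((stdChart E L b x₀).symm z)) q :=
  contDiffAt_transition (pole E L b x₀) (pole E L b' x₁) (mem_stdChart_target.mpr hq) hq'

theorem eventually_mem_source {b b' : Bool} {x₀ x₁ : M} {q : E × ℂ}
    (hq : q.1 ∈ region E L x₀)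
    (hq' : (stdChart E L b x₀).symm q ∈ (stdChart E L b' x₁).source) :
    ∀ᶠ z in 𝓝 q, z.1 ∈ region E L x₀ ∧
      (stdChart E L b x₀).symm z ∈ (stdChart E L b' x₁).source := by
  have h1 := ((stdChart E L b x₀).continuousAt_symm (mem_stdChart_target.mpr hq))
    ((stdChart E L b' x₁).open_source.mem_nhds hq')
  filter_upwards [h1, continuous_fst.continuousAt ((isOpen_region x₀).mem_nhds hq)] with z hz hz'
  exact ⟨hz', hz⟩

theorem modelNormSq_eq_toReal {b : Bool} {x₀ : M} {q : E × ℂ} (hq : q.1 ∈ region E L x₀) :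
    modelNormSq (frameNorm h b x₀) q =
      (flip b (h.extNormSq ((stdChart E L b x₀).symm q))).toReal := by
  have h0 : 0 ≤ modelNormSq (frameNorm h b x₀) q :=
    mul_nonneg (frameNorm_pos h b hq).le (by positivity)
  rw [extNormSq_stdChart_symm h hq]
  have : flip b (flip b (ENNReal.ofReal (frameNorm h b x₀ q.1 * ‖q.2‖ ^ 2))) =
      ENNReal.ofReal (frameNorm h b x₀ q.1 * ‖q.2‖ ^ 2) := by
    cases b <;> simp [flip]
  rw [this]
  exact (ENNReal.toReal_ofReal h0).symm

theorem modelNormSq_transition {b : Bool} {x₀ x₁ : M} {q : E × ℂ} (hq : q.1 ∈ region E L x₀)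
    (hq' : (stdChart E L b x₀).symm q ∈ (stdChart E L b x₁).source) :
    modelNormSq (frameNorm h b x₁) (stdChart E L b x₁ ((stdChart E L b x₀).symm q)) =
      modelNormSq (frameNorm h b x₀) q := by
  rw [modelNormSq_eq_toReal h (stdChart_mem_region hq'), modelNormSq_eq_toReal h hq,
    (stdChart E L b x₁).left_inv hq']

theorem modelLog_eq {b : Bool} {x₀ : M} {q : E × ℂ} (hq : q.1 ∈ region E L x₀) (h0 : q.2 ≠ 0) :
    modelLog (frameNorm h b x₀) q = sgn b * h.logNorm ((stdChart E L b x₀).symm q) := by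
  rw [logNorm_stdChart_symm h hq h0, ← mul_assoc, sgn_mul_self, one_mul]
  rfl

theorem modelNormSq_eq_exp {b : Bool} {x₀ : M} {q : E × ℂ} (hq : q.1 ∈ region E L x₀)
    (h0 : q.2 ≠ 0) : modelNormSq (frameNorm h b x₀) q =
      Real.exp (2 * modelLog (frameNorm h b x₀) q) :=
  frameNorm_mul_eq_exp h hq h0

theorem logNorm_mem_logInterval {b : Bool} {x₀ : M} {q : E × ℂ} (hq : q.1 ∈ region E L x₀)
    (h0 : q.2 ≠ 0) {J : Set ℝ≥0∞} : (stdChart E L b x₀).symm q ∈ h.subbundle J ↔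
      h.logNorm ((stdChart E L b x₀).symm q) ∈ logInterval J := by
  rw [mem_subbundle_iff h hq, modelNormSq_eq_exp h hq h0, exp_mem_sideDomain, modelLog_eq h hq h0,
    ← mul_assoc, sgn_mul_self, one_mul]

end Charts

end MomentumConstruction

end

/-! ### Potential data and the form that they define on the completion. -/

noncomputable section

namespace MomentumConstruction

/-- A function `f` on the interval of logarithms of `J`, with local potentials `a t + G(e^{2t})`
and moment functions `S` extending smoothly to the end `0` (`b = false`) and, for the inverse
coordinate, to the end `∞` (`b = true`). -/
structure PotentialData (J : Set ℝ≥0∞) (I : Set ℝ) (φ f : ℝ → ℝ) (a : Bool → ℝ)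
    (G S : Bool → ℝ → ℝ) : Prop where
  isOpen : IsOpen J
  ordConnected : J.OrdConnected
  smooth : ContDiffOn ℝ ∞ f (logInterval J)
  smooth_potential : ∀ b, ContDiffOn ℝ ∞ (G b) (sideDomain b J)
  smooth_moment : ∀ b, ContDiffOn ℝ ∞ (S b) (sideDomain b J)
  potential_eq : ∀ b t, sgn b * t ∈ logInterval J →
    f (sgn b * t) = a b * t + G b (Real.exp (2 * t))
  moment_eq : ∀ b t, sgn b * t ∈ logInterval J → S b (Real.exp (2 * t)) = deriv f (sgn b * t)
  moment_zero : ∀ b, 0 ∈ sideDomain b J → S b 0 = sgn b * a b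
  deriv_pos : ∀ b, 0 ∈ sideDomain b J → 0 < derivWithin (G b) (sideDomain b J) 0
  profile : ∀ t ∈ logInterval J,
    deriv f t ∈ I ∧ 0 < φ (deriv f t) ∧ deriv (deriv f) t = φ (deriv f t)
  profile_zero : ∀ b, 0 ∈ sideDomain b J → S b 0 ∈ I ∧ φ (S b 0) = 0
  surj : ∀ s ∈ I, (∃ t ∈ logInterval J, deriv f t = s) ∨ ∃ b, 0 ∈ sideDomain b J ∧ S b 0 = s

theorem isOpen_logInterval {J : Set ℝ≥0∞} (hJ : IsOpen J) : IsOpen (logInterval J) :=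
  hJ.preimage (ENNReal.continuous_ofReal.comp
    (Real.continuous_exp.comp (continuous_const.mul continuous_id)))

section Existence

variable {E : Type*} [NormedAddCommGroup E] [NormedSpace ℂ E]
  {M : Type*} [TopologicalSpace M] [ChartedSpace E M] [IsManifold 𝓘(ℂ, E) ω M]
  {L : M → Type*} [∀ x, AddCommGroup (L x)] [∀ x, Module ℂ (L x)]
  [TopologicalSpace (TotalSpace ℂ L)] [∀ x, TopologicalSpace (L x)]
  [FiberBundle ℂ L] [VectorBundle ℂ ℂ L] [ContMDiffVectorBundle ω ℂ L 𝓘(ℂ, E)]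
  (h : HermitianMetric E L) (ΩM : Form E M 2)
  {J : Set ℝ≥0∞} {I : Set ℝ} {φ f : ℝ → ℝ} {a : Bool → ℝ} {G S : Bool → ℝ → ℝ}

/-- The form with local potentials `a log K / 2 + G(r)` in standard charts. -/
def momentumForm (a : Bool → ℝ) (G : Bool → ℝ → ℝ) : Form (E × ℂ) (Completion E L) 2 := fun p =>
  pullback Completion.base ΩM p +
    flatDdc (modelPotential (frameNorm h (side p) p.base) (a (side p)) (G (side p)))
      (chartAt (E × ℂ) p p)

/-- The moment map. -/
def momentMap (S : Bool → ℝ → ℝ) (p : Completion E L) : ℝ :=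
  S (side p) (flip (side p) (h.extNormSq p)).toReal

/-- The logarithm of the norm on side `b` is `(log K) / 2 + log |w|`. Replacing the multiple `a b`
of it by `a b (log K) / 2` removes only `a b log |w|`, which is singular on the section but
pluriharmonic off it. -/
theorem PotentialData.potential_eventuallyEq (hP : PotentialData J I φ f a G S) {b : Bool}
    {x₀ : M} {q : E × ℂ} (hq : q.1 ∈ region E L x₀)
    (hJ : (stdChart E L b x₀).symm q ∈ h.subbundle J) (h0 : q.2 ≠ 0) :
    modelPotential (frameNorm h b x₀) (a b) (G b) =ᶠ[𝓝 q]
      fun z => f (h.logNorm ((stdChart E L b x₀).symm z)) + -a b * Real.log ‖z.2‖ := by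
  filter_upwards [continuous_fst.continuousAt ((isOpen_region x₀).mem_nhds hq),
    continuous_snd.continuousAt (isOpen_ne.mem_nhds h0),
    eventually_mem_sideDomain h hP.isOpen hq ((mem_subbundle_iff h hq).mp hJ)] with z hz hz0 hzJ
  rw [← mem_subbundle_iff h hz, logNorm_mem_logInterval h hz hz0] at hzJ
  have h1 : h.logNorm ((stdChart E L b x₀).symm z) = sgn b * modelLog (frameNorm h b x₀) z := by
    rw [modelLog_eq h hz hz0, ← mul_assoc, sgn_mul_self, one_mul]
  rw [h1] at hzJ ⊢
  rw [hP.potential_eq b _ hzJ, modelPotential, modelNormSq_eq_exp h hz hz0, modelLog]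
  ring

theorem PotentialData.contDiffAt_potential (hP : PotentialData J I φ f a G S) {b : Bool}
    {x₀ : M} {q : E × ℂ} (hq : q.1 ∈ region E L x₀)
    (hJ : (stdChart E L b x₀).symm q ∈ h.subbundle J) :
    ContDiffAt ℝ ∞ (modelPotential (frameNorm h b x₀) (a b) (G b)) q :=
  contDiffAt_modelPotential (contDiffAt_frameNorm h b hq) (frameNorm_pos h b hq)
    (hP.smooth_potential b)
    (eventually_mem_sideDomain h hP.isOpen hq ((mem_subbundle_iff h hq).mp hJ))

theorem PotentialData.contDiffAt_comp_logNorm (hP : PotentialData J I φ f a G S) {b : Bool}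
    {x₀ : M} {q : E × ℂ} (hq : q.1 ∈ region E L x₀)
    (hJ : (stdChart E L b x₀).symm q ∈ h.subbundle J) (h0 : q.2 ≠ 0) :
    ContDiffAt ℝ ∞ (fun z => f (h.logNorm ((stdChart E L b x₀).symm z))) q := by
  have h1 := (hP.contDiffAt_potential h hq hJ).congr_of_eventuallyEq
    (hP.potential_eventuallyEq h hq hJ h0).symm
  have h2 : ContDiffAt ℝ ∞ (fun z : E × ℂ => -a b * Real.log ‖z.2‖) q :=
    contDiffAt_const.mul (contDiffAt_log_norm (g := Prod.snd) contDiffAt_snd h0)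
  simpa using h1.sub h2

theorem PotentialData.flatDdc_potential (hP : PotentialData J I φ f a G S) {b : Bool}
    {x₀ : M} {q : E × ℂ} (hq : q.1 ∈ region E L x₀)
    (hJ : (stdChart E L b x₀).symm q ∈ h.subbundle J) (h0 : q.2 ≠ 0) :
    flatDdc (modelPotential (frameNorm h b x₀) (a b) (G b)) q =
      flatDdc (fun z => f (h.logNorm ((stdChart E L b x₀).symm z))) q := by
  have hl : ContDiffAt ℝ 2 (fun z : E × ℂ => Real.log ‖z.2‖) q :=
    contDiffAt_log_norm (g := Prod.snd) contDiffAt_snd h0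
  rw [flatDdc_congr (hP.potential_eventuallyEq h hq hJ h0),
    flatDdc_add ((hP.contDiffAt_comp_logNorm h hq hJ h0).of_le two_le_infty)
      (contDiffAt_const.mul hl), flatDdc_const_mul _ hl,
    flatDdc_log_norm (g := Prod.snd) contDiffAt_snd h0, smul_zero, add_zero]

/-- This is what makes the form well defined. Off the sections both potentials give `d d^c f(t)`,
and `t` does not depend on the chart. On a section both charts lie on the same side, and the
potential changes by `-a log |g|` with `g` the transition function, holomorphic without zeros. -/
theorem PotentialData.flatDdc_transition (hP : PotentialData J I φ f a G S) {b b' : Bool}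
    {x₀ x₁ : M} {q : E × ℂ} (hq : q.1 ∈ region E L x₀)
    (hJ : (stdChart E L b x₀).symm q ∈ h.subbundle J)
    (hq' : (stdChart E L b x₀).symm q ∈ (stdChart E L b' x₁).source)
    (hb : q.2 = 0 → b' = b) :
    flatDdc (fun z => modelPotential (frameNorm h b' x₁) (a b') (G b')
        (stdChart E L b' x₁ ((stdChart E L b x₀).symm z))) q =
      flatDdc (modelPotential (frameNorm h b x₀) (a b) (G b)) q := by
  have hψ := contDiffAt_stdChart_transition hq hq'
  have hev := eventually_mem_source hq hq'
  have hq1 := stdChart_mem_region hq'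
  have hJ' : (stdChart E L b' x₁).symm (stdChart E L b' x₁ ((stdChart E L b x₀).symm q)) ∈
      h.subbundle J := by rwa [(stdChart E L b' x₁).left_inv hq']
  by_cases h0 : q.2 = 0
  · obtain rfl := hb h0
    have hone : (stdChart E L b' x₀).symm (q.1, 1) ∈ (stdChart E L b' x₁).source := by
      refine mem_stdChart_source_of_punctured
        ((stdChart_symm_mem_punctured (q := (q.1, 1)) hq).mpr one_ne_zero) ?_
      have := stdChart_source_base hq'
      rwa [base_stdChart_symm] at this ⊢
    -- The transition function is read off as the new fibre coordinate of the point with old fibre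
    -- coordinate `1`; comparing the squared norms of that point gives `K₁ |g|² = K₀`.
    let g : E × ℂ → ℂ := fun z =>
      (stdChart E L b' x₁ ((stdChart E L b' x₀).symm (z.1, 1))).2
    have hg : ContDiffAt ℂ 2 g q := by
      have h1 := (contDiffAt_stdChart_transition (q := (q.1, 1)) hq hone).of_le
        (m := 2) le_top
      have h2 : ContDiffAt ℂ 2 (fun z : E × ℂ => (z.1, (1 : ℂ))) q :=
        contDiffAt_fst.prodMk contDiffAt_const
      exact (ContDiffAt.fun_comp q h1 h2).snd
    have hg0 : g q ≠ 0 := by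
      rw [← stdChart_symm_mem_punctured (b := b') (stdChart_mem_region hone),
        (stdChart E L b' x₁).left_inv hone, stdChart_symm_mem_punctured (q := (q.1, 1)) hq]
      exact one_ne_zero
    have hl := contDiffAt_log_norm (hg.restrict_scalars ℝ) hg0
    have key : (fun z => modelPotential (frameNorm h b' x₁) (a b') (G b')
        (stdChart E L b' x₁ ((stdChart E L b' x₀).symm z))) =ᶠ[𝓝 q] fun z =>
        modelPotential (frameNorm h b' x₀) (a b') (G b') z + -a b' * Real.log ‖g z‖ := by
      filter_upwards [hev, hg.continuousAt.eventually (isOpen_ne.mem_nhds hg0)]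
        with z ⟨hz, hz'⟩ hgz
      have hzone : (stdChart E L b' x₀).symm (z.1, 1) ∈ (stdChart E L b' x₁).source := by
        refine mem_stdChart_source_of_punctured
          ((stdChart_symm_mem_punctured (q := (z.1, 1)) hz).mpr one_ne_zero) ?_
        have := stdChart_source_base hz'
        rwa [base_stdChart_symm] at this ⊢
      have e1 := modelNormSq_transition h (q := (z.1, 1)) hz hzone
      have e2 : (stdChart E L b' x₁ ((stdChart E L b' x₀).symm (z.1, 1))).1 =
          (stdChart E L b' x₁ ((stdChart E L b' x₀).symm z)).1 := by
        simp only [stdChart_fst, base_stdChart_symm]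
      have e3 : frameNorm h b' x₁ (stdChart E L b' x₁ ((stdChart E L b' x₀).symm z)).1 *
          ‖g z‖ ^ 2 = frameNorm h b' x₀ z.1 := by
        rw [← e2]
        simpa [modelNormSq] using e1
      have hK1 := frameNorm_pos h b' (stdChart_mem_region hz')
      have hgz' : 0 < ‖g z‖ := norm_pos_iff.mpr hgz
      rw [modelPotential, modelPotential, modelNormSq_transition h hz hz', ← e3,
        Real.log_mul hK1.ne' (by positivity), Real.log_pow]
      push_cast
      ring
    rw [flatDdc_congr key, flatDdc_add
      ((hP.contDiffAt_potential h hq hJ).of_le two_le_infty) (contDiffAt_const.mul hl),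
      flatDdc_const_mul _ hl, flatDdc_log_norm hg hg0, smul_zero, add_zero]
  · have hpunct := (stdChart_symm_mem_punctured (b := b) hq).mpr h0
    have h0' : (stdChart E L b' x₁ ((stdChart E L b x₀).symm q)).2 ≠ 0 := by
      rwa [← stdChart_symm_mem_punctured (b := b') hq1, (stdChart E L b' x₁).left_inv hq']
    have hψ2 := hψ.of_le (m := 2) le_top
    -- Both sides are replaced by `d d^c` of `f(t)` before the charts are compared, since the `log
    -- |w|` terms of the two charts need not match.
    rw [hP.flatDdc_potential h hq hJ h0,
      flatDdc_comp (ψ := fun z => stdChart E L b' x₁ ((stdChart E L b x₀).symm z))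
        ((hP.contDiffAt_potential h hq1 hJ').of_le two_le_infty) hψ2,
      hP.flatDdc_potential h hq1 hJ' h0', ← flatDdc_comp
        (P := fun z => f (h.logNorm ((stdChart E L b' x₁).symm z)))
        (ψ := fun z => stdChart E L b' x₁ ((stdChart E L b x₀).symm z)) ((hP.contDiffAt_comp_logNorm h hq1 hJ' h0').of_le two_le_infty) hψ2]
    refine flatDdc_congr ?_
    filter_upwards [hev] with z hz
    rw [(stdChart E L b' x₁).left_inv hz.2]

theorem chart_mem_region (p : Completion E L) :
    (chartAt (E × ℂ) p p).1 ∈ region E L p.base := by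
  have h := mem_chart_source (E × ℂ) p
  rw [chartAt_eq] at h ⊢
  exact stdChart_mem_region h

/-- The form in an arbitrary standard chart. -/
theorem PotentialData.inChart_momentumForm (hP : PotentialData J I φ f a G S) {b : Bool}
    {x₀ : M} {q : E × ℂ} (hq : q.1 ∈ region E L x₀)
    (hJ : (stdChart E L b x₀).symm q ∈ h.subbundle J) :
    inChart (stdChart E L b x₀) (momentumForm h ΩM a G) q =
      (inChart (chartAt E x₀) ΩM q.1).compContinuousLinearMap (ContinuousLinearMap.fst ℝ E ℂ) +
        flatDdc (modelPotential (frameNorm h b x₀) (a b) (G b)) q := by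
  rw [← inChart_pullback_base ΩM b x₀ hq]
  set p := (stdChart E L b x₀).symm q with hp
  have hps : p ∈ (stdChart E L (side p) p.base).source := by
    rw [← chartAt_eq]; exact mem_chart_source _ p
  have hψ := (contDiffAt_stdChart_transition hq hps).of_le (m := 2) le_top
  have hJ' : (stdChart E L (side p) p.base).symm (stdChart E L (side p) p.base p) ∈
      h.subbundle J := by rwa [(stdChart E L (side p) p.base).left_inv hps]
  have hD : differential (E × ℂ) (E × ℂ) (stdChart E L b x₀).symm q =
      fderiv ℝ (fun z => stdChart E L (side p) p.base ((stdChart E L b x₀).symm z)) q := by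
    rw [← chartAt_eq, hp]
    exact differential_chart_symm (pole E L b x₀) (mem_stdChart_target.mpr hq)
  -- At each point the form is defined through the preferred chart of that point. A point with fibre
  -- coordinate `0` lies on the section of side `b`, so its preferred chart is on side `b` too.
  have h1 := hP.flatDdc_transition h hq hJ hps fun h0 => side_stdChart_symm h0
  rw [flatDdc_comp (ψ := fun z => stdChart E L (side p) p.base ((stdChart E L b x₀).symm z))
    ((hP.contDiffAt_potential h (stdChart_mem_region hps) hJ').of_le two_le_infty)
    hψ] at h1
  rw [← h1, ← hD, inChart, pullback, ← hp, momentumForm, chartAt_eq]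
  rfl

end Existence

end MomentumConstruction

end

noncomputable section

namespace MomentumConstruction

/-! ### The values of the form off and on the two sections. -/

section Existence

variable {E : Type*} [NormedAddCommGroup E] [NormedSpace ℂ E]
  {M : Type*} [TopologicalSpace M] [ChartedSpace E M] [IsManifold 𝓘(ℂ, E) ω M]
  {L : M → Type*} [∀ x, AddCommGroup (L x)] [∀ x, Module ℂ (L x)]
  [TopologicalSpace (TotalSpace ℂ L)] [∀ x, TopologicalSpace (L x)]
  [FiberBundle ℂ L] [VectorBundle ℂ ℂ L] [ContMDiffVectorBundle ω ℂ L 𝓘(ℂ, E)]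
  (h : HermitianMetric E L) (ΩM : Form E M 2)
  {J : Set ℝ≥0∞} {I : Set ℝ} {φ f : ℝ → ℝ} {a : Bool → ℝ} {G S : Bool → ℝ → ℝ}

theorem chart_symm_chart (p : Completion E L) :
    (stdChart E L (side p) p.base).symm (chartAt (E × ℂ) p p) = p := by
  rw [← chartAt_eq]
  exact (chartAt (E × ℂ) p).left_inv (mem_chart_source _ p)

theorem chart_fst (p : Completion E L) :
    (chartAt (E × ℂ) p p).1 = chartAt E p.base p.base := by
  rw [chartAt_eq, stdChart_fst]

theorem base_mem_region (x : M) : chartAt E x x ∈ region E L x := by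
  have := chart_mem_region (pole E L false x)
  rwa [chart_fst] at this

theorem mem_punctured_iff_chart (p : Completion E L) :
    p ∈ puncturedBundle E L ↔ (chartAt (E × ℂ) p p).2 ≠ 0 := by
  rw [← stdChart_symm_mem_punctured (b := side p) (chart_mem_region p), chart_symm_chart]

/-- The curvature form in terms of the frames of standard charts. -/
theorem flatDdc_frameNorm (b : Bool) (x : M) :
    flatDdc (fun y => (1 / 2) * Real.log (frameNorm h b x y)) (chartAt E x x) =
      sgn b • -(h.curvature x) := by
  have hx : chartAt E x x ∈ region E L x := base_mem_region x
  have hlog : ContDiffAt ℝ 2 (fun y => Real.log (frameNorm h false x y)) (chartAt E x x) :=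
    ((contDiffAt_frameNorm h false hx).of_le two_le_infty).log (frameNorm_pos h false hx).ne'
  have h1 : h.curvature x = -((1 / 2 : ℝ) •
      flatDdc (fun y => Real.log (frameNorm h false x y)) (chartAt E x x)) := by
    rw [HermitianMetric.curvature]
    congr 2
    exact ddc_eq hlog
  rw [h1, neg_neg, ← flatDdc_const_mul _ hlog]
  cases b
  · simp [sgn]
  · simp only [sgn, cond_true]
    have h2 : ContDiffAt ℝ 2 (fun y => (1 / 2) * Real.log (frameNorm h false x y))
        (chartAt E x x) := contDiffAt_const.mul hlog
    rw [← flatDdc_const_mul _ h2]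
    congr 1
    ext y
    simp [frameNorm, flip]

theorem momentumForm_apply (p : Completion E L) (v w : E × ℂ) :
    momentumForm h ΩM a G p ![v, w] = ΩM p.base ![v.1, w.1] +
      flatDdc (modelPotential (frameNorm h (side p) p.base) (a (side p)) (G (side p)))
        (chartAt (E × ℂ) p p) ![v, w] := by
  have hvw : (ContinuousLinearMap.fst ℝ E ℂ) ∘ ![v, w] = ![v.1, w.1] := by
    ext i
    fin_cases i <;> rfl
  rw [momentumForm, pullback_base_eq, ContinuousAlternatingMap.add_apply,
    ContinuousAlternatingMap.compContinuousLinearMap_apply, hvw]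

theorem hasDerivAt_comp_sgn {f : ℝ → ℝ} (b : Bool) {t : ℝ}
    (hf : DifferentiableAt ℝ f (sgn b * t)) :
    HasDerivAt (fun s => f (sgn b * s)) (sgn b * deriv f (sgn b * t)) t := by
  have := hf.hasDerivAt.comp t ((hasDerivAt_id t).const_mul (sgn b))
  simpa [mul_comm, Function.comp_def] using this

theorem differentiableAt_deriv {f : ℝ → ℝ} {t : ℝ} (hf : ContDiffAt ℝ 2 f t) :
    DifferentiableAt ℝ (deriv f) t :=
  ((hf.fderiv_right (m := 1) (by norm_num)).differentiableAt one_ne_zero).clm_apply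
    (differentiableAt_const (1 : ℝ))

theorem deriv_deriv_comp_sgn {f : ℝ → ℝ} (b : Bool) {t : ℝ}
    (hf : ContDiffAt ℝ 2 f (sgn b * t)) :
    deriv (deriv fun s => f (sgn b * s)) t = deriv (deriv f) (sgn b * t) := by
  have hc : ContinuousAt (fun s : ℝ => sgn b * s) t := by fun_prop
  have h1 : (deriv fun s => f (sgn b * s)) =ᶠ[𝓝 t] fun s => sgn b * deriv f (sgn b * s) := by
    filter_upwards [hc.eventually (hf.eventually (by simp))] with s hs
    exact (hasDerivAt_comp_sgn b (hs.differentiableAt two_ne_zero)).deriv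
  rw [h1.deriv_eq, ((hasDerivAt_comp_sgn b (differentiableAt_deriv hf)).const_mul (sgn b)).deriv,
    ← mul_assoc, sgn_mul_self, one_mul]

/-- The Kähler form at points outside the two sections, where `p = (z, w)` in a standard chart. -/
theorem PotentialData.momentumForm_apply_punctured (hP : PotentialData J I φ f a G S)
    {p : Completion E L} (hp : p ∈ h.subbundle J) (h0 : p ∈ puncturedBundle E L)
    (v w : E × ℂ) : momentumForm h ΩM a G p ![v, w] =
      (ΩM p.base - deriv f (h.logNorm p) • h.curvature p.base) ![v.1, w.1] +
      φ (deriv f (h.logNorm p)) *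
        (fderiv ℝ (modelLog (frameNorm h (side p) p.base)) (chartAt (E × ℂ) p p) w *
            fderiv ℝ (modelLog (frameNorm h (side p) p.base)) (chartAt (E × ℂ) p p)
              (Complex.I • v) -
          fderiv ℝ (modelLog (frameNorm h (side p) p.base)) (chartAt (E × ℂ) p p) v *
            fderiv ℝ (modelLog (frameNorm h (side p) p.base)) (chartAt (E × ℂ) p p)
              (Complex.I • w)) := by
  set q := chartAt (E × ℂ) p p with hqdef
  set b := side p with hb
  have hq : q.1 ∈ region E L p.base := chart_mem_region p
  have hq1 : q.1 = chartAt E p.base p.base := chart_fst p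
  have hs : (stdChart E L b p.base).symm q = p := chart_symm_chart p
  have hq2 : q.2 ≠ 0 := (mem_punctured_iff_chart p).mp h0
  have hK := (contDiffAt_frameNorm h b hq).of_le two_le_infty
  have hK0 := frameNorm_pos h b hq
  have hlog : sgn b * modelLog (frameNorm h b p.base) q = h.logNorm p := by
    rw [modelLog_eq h hq hq2, ← mul_assoc, sgn_mul_self, one_mul, hs]
  have hT : sgn b * modelLog (frameNorm h b p.base) q ∈ logInterval J := by
    rw [hlog, ← hs, ← logNorm_mem_logInterval h hq hq2, hs]
    exact hp
  have hf2 : ContDiffAt ℝ 2 f (sgn b * modelLog (frameNorm h b p.base) q) :=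
    (hP.smooth.contDiffAt ((isOpen_logInterval hP.isOpen).mem_nhds hT)).of_le two_le_infty
  have hF : ContDiffAt ℝ 2 (fun s => f (sgn b * s)) (modelLog (frameNorm h b p.base) q) :=
    ContDiffAt.fun_comp _ hf2 (contDiffAt_const.mul contDiffAt_id)
  have key : (fun z => f (h.logNorm ((stdChart E L b p.base).symm z))) =ᶠ[𝓝 q]
      fun z => f (sgn b * modelLog (frameNorm h b p.base) z) := by
    filter_upwards [continuous_fst.continuousAt ((isOpen_region p.base).mem_nhds hq),
      continuous_snd.continuousAt (isOpen_ne.mem_nhds hq2)] with z hz hz0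
    rw [modelLog_eq h hz hz0, ← mul_assoc, sgn_mul_self, one_mul]
  rw [momentumForm_apply, ← hb, ← hqdef, hP.flatDdc_potential h hq (hs.symm ▸ hp) hq2,
    flatDdc_congr key, flatDdc_comp_modelLog (f := fun s => f (sgn b * s)) hK hK0 hq2 hF,
    (hasDerivAt_comp_sgn b (hf2.differentiableAt two_ne_zero)).deriv, deriv_deriv_comp_sgn b hf2,
    (hP.profile _ hT).2.2, hlog, hq1, flatDdc_frameNorm]
  simp only [ContinuousAlternatingMap.sub_apply, ContinuousAlternatingMap.smul_apply,
    ContinuousAlternatingMap.neg_apply, smul_eq_mul]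
  -- On side `b` the variable is `sgn b * t`: `f'` acquires the factor `sgn b`, which cancels the
  -- sign in the curvature of the (possibly dual) frame, while `f''` acquires none.
  linear_combination (-(deriv f (h.logNorm p) * h.curvature p.base ![v.1, w.1])) * sgn_mul_self b

/-- On a section `dr = 0`, so two terms survive: the coefficient `a` times the curvature of the
frame, which is `-S(0) γ` by `moment_zero`, and `G'(0) d d^c r` along the fibre. -/
theorem PotentialData.momentumForm_apply_zero (hP : PotentialData J I φ f a G S)
    {p : Completion E L} (hp : p ∈ h.subbundle J) (h0 : p ∉ puncturedBundle E L)
    (v : E × ℂ) : momentumForm h ΩM a G p ![v, Complex.I • v] =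
      (ΩM p.base - S (side p) 0 • h.curvature p.base) ![v.1, Complex.I • v.1] +
      derivWithin (G (side p)) (sideDomain (side p) J) 0 *
        (4 * frameNorm h (side p) p.base (chartAt (E × ℂ) p p).1 * ‖v.2‖ ^ 2) := by
  set q := chartAt (E × ℂ) p p with hqdef
  set b := side p with hb
  have hq : q.1 ∈ region E L p.base := chart_mem_region p
  have hq1 : q.1 = chartAt E p.base p.base := chart_fst p
  have hs : (stdChart E L b p.base).symm q = p := chart_symm_chart p
  have hq2 : q.2 = 0 := by simpa using (mem_punctured_iff_chart p).not.mp h0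
  have hD : modelNormSq (frameNorm h b p.base) q ∈ sideDomain b J := by
    rw [← mem_subbundle_iff h hq, hs]; exact hp
  have hD0 : 0 ∈ sideDomain b J := by simpa [modelNormSq, hq2] using hD
  rw [momentumForm_apply, ← hb, ← hqdef, flatDdc_modelPotential_self
    (contDiffAt_frameNorm h b hq) (frameNorm_pos h b hq) (hP.smooth_potential b)
    (uniqueDiffOn_sideDomain b hP.isOpen) (eventually_mem_sideDomain h hP.isOpen hq hD) hq2,
    hP.moment_zero b hD0, hq1, flatDdc_frameNorm]
  simp only [ContinuousAlternatingMap.sub_apply, ContinuousAlternatingMap.smul_apply,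
    ContinuousAlternatingMap.neg_apply, smul_eq_mul, Prod.smul_fst]
  ring

end Existence

end MomentumConstruction

end

noncomputable section

namespace MomentumConstruction

/-! ### Potential data give a momentum metric. -/

section Existence

theorem contDiffAt_compContinuousLinearMap_fst {E : Type*} [NormedAddCommGroup E]
    [NormedSpace ℝ E] {u : E → E [⋀^Fin 2]→L[ℝ] ℝ} {q : E × ℂ} (hu : ContDiffAt ℝ ∞ u q.1) :
    ContDiffAt ℝ ∞ (fun z : E × ℂ =>
      (u z.1).compContinuousLinearMap (ContinuousLinearMap.fst ℝ E ℂ)) q := by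
  let A : (E [⋀^Fin 2]→L[ℝ] ℝ) →L[ℝ] ((E × ℂ) [⋀^Fin 2]→L[ℝ] ℝ) :=
    ContinuousAlternatingMap.compContinuousLinearMapCLM (ContinuousLinearMap.fst ℝ E ℂ)
  exact A.contDiff.contDiffAt.comp q (hu.comp q contDiffAt_fst)

variable {E : Type*} [NormedAddCommGroup E] [NormedSpace ℂ E]
  {M : Type*} [TopologicalSpace M] [ChartedSpace E M] [IsManifold 𝓘(ℂ, E) ω M]
  {L : M → Type*} [∀ x, AddCommGroup (L x)] [∀ x, Module ℂ (L x)]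
  [TopologicalSpace (TotalSpace ℂ L)] [∀ x, TopologicalSpace (L x)]
  [FiberBundle ℂ L] [VectorBundle ℂ ℂ L] [ContMDiffVectorBundle ω ℂ L 𝓘(ℂ, E)]
  (h : HermitianMetric E L) {ΩM : Form E M 2}
  {J : Set ℝ≥0∞} {I : Set ℝ} {φ f : ℝ → ℝ} {a : Bool → ℝ} {G S : Bool → ℝ → ℝ}

theorem PotentialData.moment_eq_logNorm (hP : PotentialData J I φ f a G S) {b : Bool}
    {x₀ : M} {q : E × ℂ} (hq : q.1 ∈ region E L x₀)
    (hJ : (stdChart E L b x₀).symm q ∈ h.subbundle J) (h0 : q.2 ≠ 0) :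
    S b (modelNormSq (frameNorm h b x₀) q) =
      deriv f (h.logNorm ((stdChart E L b x₀).symm q)) := by
  have h1 : h.logNorm ((stdChart E L b x₀).symm q) = sgn b * modelLog (frameNorm h b x₀) q := by
    rw [modelLog_eq h hq h0, ← mul_assoc, sgn_mul_self, one_mul]
  rw [logNorm_mem_logInterval h hq h0, h1] at hJ
  rw [modelNormSq_eq_exp h hq h0, hP.moment_eq b _ hJ, h1]

theorem momentMap_eq_of_side {b : Bool} {x₀ : M} {q : E × ℂ} (hq : q.1 ∈ region E L x₀)
    (hb : side ((stdChart E L b x₀).symm q) = b) :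
    momentMap h S ((stdChart E L b x₀).symm q) = S b (modelNormSq (frameNorm h b x₀) q) := by
  rw [momentMap, hb, modelNormSq_eq_toReal h hq]

theorem PotentialData.momentMap_punctured (hP : PotentialData J I φ f a G S)
    {p : Completion E L} (hp : p ∈ h.subbundle J) (h0 : p ∈ puncturedBundle E L) :
    momentMap h S p = deriv f (h.logNorm p) := by
  have hs := chart_symm_chart p
  have h1 := momentMap_eq_of_side (S := S) h (chart_mem_region p) (by rw [hs])
  have h2 := hP.moment_eq_logNorm h (b := side p) (chart_mem_region p) (by rwa [hs])
    ((mem_punctured_iff_chart p).mp h0)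
  rw [← h1, hs] at h2
  exact h2

/-- The moment map in standard charts. -/
theorem PotentialData.momentMap_eq (hP : PotentialData J I φ f a G S) {b : Bool}
    {x₀ : M} {q : E × ℂ} (hq : q.1 ∈ region E L x₀)
    (hJ : (stdChart E L b x₀).symm q ∈ h.subbundle J) :
    momentMap h S ((stdChart E L b x₀).symm q) = S b (modelNormSq (frameNorm h b x₀) q) := by
  by_cases h0 : q.2 = 0
  · exact momentMap_eq_of_side h hq (side_stdChart_symm h0)
  · rw [hP.moment_eq_logNorm h hq hJ h0]
    exact hP.momentMap_punctured h hJ ((stdChart_symm_mem_punctured hq).mpr h0)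

theorem PotentialData.momentMap_zero (hP : PotentialData J I φ f a G S)
    {p : Completion E L} (hp : p ∈ h.subbundle J) (h0 : p ∉ puncturedBundle E L) :
    0 ∈ sideDomain (side p) J ∧ momentMap h S p = S (side p) 0 := by
  have hq2 : (chartAt (E × ℂ) p p).2 = 0 := by simpa using (mem_punctured_iff_chart p).not.mp h0
  have hs := chart_symm_chart p
  have hJ : (stdChart E L (side p) p.base).symm (chartAt (E × ℂ) p p) ∈ h.subbundle J := by
    rwa [hs]
  have h1 := hP.momentMap_eq h (chart_mem_region p) hJ
  rw [mem_subbundle_iff h (chart_mem_region p)] at hJ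
  rw [hs] at h1
  rw [h1]
  simpa [modelNormSq, hq2] using hJ

theorem eventually_mem_subbundle (hJo : IsOpen J) {b : Bool} {x₀ : M} {q : E × ℂ}
    (hq : q.1 ∈ region E L x₀) (hJ : (stdChart E L b x₀).symm q ∈ h.subbundle J) :
    ∀ᶠ z in 𝓝 q, z.1 ∈ region E L x₀ ∧ (stdChart E L b x₀).symm z ∈ h.subbundle J := by
  filter_upwards [continuous_fst.continuousAt ((isOpen_region x₀).mem_nhds hq),
    eventually_mem_sideDomain h hJo hq ((mem_subbundle_iff h hq).mp hJ)] with z hz hz'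
  exact ⟨hz, (mem_subbundle_iff h hz).mpr hz'⟩

theorem PotentialData.isSmoothOn_momentumForm (hP : PotentialData J I φ f a G S)
    (hM : IsSmoothOn ΩM univ) :
    IsSmoothOn (momentumForm h ΩM a G) (h.subbundle J) := by
  intro p₀ q hqq
  rw [chartAt_eq] at hqq ⊢
  have hq := mem_stdChart_target.mp hqq.1
  have hJ : (stdChart E L (side p₀) p₀.base).symm q ∈ h.subbundle J := hqq.2
  refine ContDiffAt.contDiffWithinAt ?_
  have h1 : ContDiffAt ℝ ∞ (inChart (chartAt E p₀.base) ΩM) q.1 := by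
    have := hM p₀.base
    rw [preimage_univ, inter_univ] at this
    exact this.contDiffAt ((chartAt E p₀.base).open_target.mem_nhds hq.1)
  have h2 : ContDiffAt ℝ ∞ (fun z : E × ℂ => (inChart (chartAt E p₀.base) ΩM
      z.1).compContinuousLinearMap (ContinuousLinearMap.fst ℝ E ℂ)) q :=
    contDiffAt_compContinuousLinearMap_fst h1
  refine (h2.add (ContDiffAt.flatDdc (hP.contDiffAt_potential h hq hJ))).congr_of_eventuallyEq ?_
  filter_upwards [eventually_mem_subbundle h hP.isOpen hq hJ] with z hz
  exact hP.inChart_momentumForm h ΩM hz.1 hz.2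

/-- Locally the form is the pullback of a closed form plus an exact form. -/
theorem PotentialData.extD_momentumForm (hP : PotentialData J I φ f a G S)
    (hM : IsKahlerForm ΩM univ) {p : Completion E L} (hp : p ∈ h.subbundle J) :
    extD (momentumForm h ΩM a G) p = 0 := by
  have hq := chart_mem_region p
  have hs := chart_symm_chart p
  have hJ : (stdChart E L (side p) p.base).symm (chartAt (E × ℂ) p p) ∈ h.subbundle J := by
    rwa [hs]
  set q := chartAt (E × ℂ) p p with hqdef
  have h1 : ContDiffAt ℝ ∞ (inChart (chartAt E p.base) ΩM) q.1 := by
    have := hM.smooth p.base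
    rw [preimage_univ, inter_univ] at this
    exact this.contDiffAt ((chartAt E p.base).open_target.mem_nhds hq.1)
  have h2 : ContDiffAt ℝ ∞ (fun z : E × ℂ => (inChart (chartAt E p.base) ΩM
      z.1).compContinuousLinearMap (ContinuousLinearMap.fst ℝ E ℂ)) q :=
    contDiffAt_compContinuousLinearMap_fst h1
  have h3 := ContDiffAt.flatDdc (hP.contDiffAt_potential h hq hJ)
  have key : inChart (chartAt (E × ℂ) p) (momentumForm h ΩM a G) =ᶠ[𝓝 q] fun z =>
      (inChart (chartAt E p.base) ΩM z.1).compContinuousLinearMap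
        (ContinuousLinearMap.fst ℝ E ℂ) +
      flatDdc (modelPotential (frameNorm h (side p) p.base) (a (side p)) (G (side p))) z := by
    filter_upwards [eventually_mem_subbundle h hP.isOpen hq hJ] with z hz
    rw [chartAt_eq]
    exact hP.inChart_momentumForm h ΩM hz.1 hz.2
  rw [extD, ← hqdef, key.extDeriv_eq, extDeriv_fun_add (h2.differentiableAt (by simp))
    (h3.differentiableAt (by simp)), extDeriv_flatDdc (hP.contDiffAt_potential h hq hJ), add_zero]
  have h4 := extDeriv_pullback (f := (Prod.fst : E × ℂ → E)) (x := q) (r := 2)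
    (h1.differentiableAt (by simp)) contDiffAt_fst (by simp)
  simp only [fderiv_fst] at h4
  rw [h4]
  have h5 := hM.closed p.base (mem_univ _)
  rw [extD, ← chart_fst (L := L) p, ← hqdef] at h5
  rw [h5]
  rfl

theorem PotentialData.momentumForm_type (hP : PotentialData J I φ f a G S)
    (hM : IsKahlerForm ΩM univ) {p : Completion E L} (hp : p ∈ h.subbundle J) (v w : E × ℂ) :
    momentumForm h ΩM a G p ![Complex.I • v, Complex.I • w] =
      momentumForm h ΩM a G p ![v, w] := by
  have hJ : (stdChart E L (side p) p.base).symm (chartAt (E × ℂ) p p) ∈ h.subbundle J := by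
    rwa [chart_symm_chart]
  rw [momentumForm_apply, momentumForm_apply, flatDdc_I_smul
    ((hP.contDiffAt_potential h (chart_mem_region p) hJ).of_le two_le_infty)]
  congr 1
  exact hM.type_one_one p.base (mem_univ _) v.1 w.1

/-- A vector with nonzero horizontal part is handled by `ω_M - s γ`, since the momentum `s` lies in
`I`, and the fibre term is nonnegative. For a vertical vector the fibre term is strict: its
coefficient is `φ(τ) > 0` off the sections and contains `G'(0) > 0` on them. -/
theorem PotentialData.momentumForm_pos (hP : PotentialData J I φ f a G S)
    (hdata : IsHorizontalData h ΩM I) {p : Completion E L} (hp : p ∈ h.subbundle J)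
    {v : E × ℂ} (hv : v ≠ 0) : 0 < momentumForm h ΩM a G p ![v, Complex.I • v] := by
  have hq := chart_mem_region p
  have hcompat {s : ℝ} (hs : s ∈ I) (u : E) (hu : u ≠ 0) :
      0 < (ΩM p.base - s • h.curvature p.base) ![u, Complex.I • u] :=
    hdata.compatible s hs p.base (mem_univ _) u hu
  have hzero (s : ℝ) : (ΩM p.base - s • h.curvature p.base) ![0, Complex.I • (0 : E)] = 0 :=
    ContinuousAlternatingMap.map_coord_zero _ 0 rfl
  by_cases h0 : p ∈ puncturedBundle E L
  · have hq2 := (mem_punctured_iff_chart p).mp h0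
    have hT : h.logNorm p ∈ logInterval J := by
      have := (logNorm_mem_logInterval h (b := side p) hq hq2 (J := J)).mp
      rw [chart_symm_chart] at this
      exact this hp
    obtain ⟨hI, hφ, -⟩ := hP.profile _ hT
    rw [hP.momentumForm_apply_punctured h ΩM hp h0, I_smul_I_smul, map_neg]
    set dt := fderiv ℝ (modelLog (frameNorm h (side p) p.base)) (chartAt (E × ℂ) p p) with hdt
    have hsq : dt (Complex.I • v) * dt (Complex.I • v) - dt v * -dt v =
        dt (Complex.I • v) ^ 2 + dt v ^ 2 := by ring
    rw [hsq]
    by_cases hv1 : v.1 = 0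
    · have hK := ((contDiffAt_frameNorm h (side p) hq).differentiableAt (by simp))
      have e1 := fderiv_modelLog hK (frameNorm_pos h (side p) hq) hq2 v
      have e2 := fderiv_modelLog hK (frameNorm_pos h (side p) hq) hq2 (Complex.I • v)
      rw [← hdt] at e1 e2
      rw [Prod.smul_fst, hv1, hzero, zero_add]
      refine mul_pos hφ ?_
      -- For vertical `v` the numbers `dt(v)` and `dt(Jv)` are `Re c` and `-Im c` with `c = v.2 /
      -- w`, so the sum of their squares is `|c|²`.
      have hc : v.2 * (chartAt (E × ℂ) p p).2⁻¹ ≠ 0 := by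
        refine mul_ne_zero (fun h2 => hv (Prod.ext hv1 h2)) (inv_ne_zero hq2)
      simp only [hv1, map_zero, zero_add, Prod.smul_fst, smul_zero, Prod.smul_snd, smul_eq_mul,
        mul_assoc, Complex.I_mul_re] at e1 e2
      rw [e1, e2]
      have := Complex.normSq_pos.mpr hc
      rw [Complex.normSq_apply] at this
      nlinarith
    · exact add_pos_of_pos_of_nonneg (hcompat hI _ hv1) (by positivity)
  · obtain ⟨hD, -⟩ := hP.momentMap_zero h hp h0
    obtain ⟨hI, -⟩ := hP.profile_zero _ hD
    have hG := hP.deriv_pos _ hD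
    have hK := frameNorm_pos h (side p) hq
    rw [hP.momentumForm_apply_zero h ΩM hp h0]
    by_cases hv1 : v.1 = 0
    · have hv2 : 0 < ‖v.2‖ := norm_pos_iff.mpr fun h2 => hv (Prod.ext hv1 h2)
      rw [hv1, hzero, zero_add]
      positivity
    · exact add_pos_of_pos_of_nonneg (hcompat hI _ hv1) (by positivity)

/-- Rotations preserve the norm, while `J X` is `-sgn` times the radial field, along which `log |w|`
grows at unit speed. -/
theorem fderiv_modelLog_circleField {p : Completion E L} (h0 : p ∈ puncturedBundle E L) :
    fderiv ℝ (modelLog (frameNorm h (side p) p.base)) (chartAt (E × ℂ) p p) (circleField p) = 0 ∧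
    fderiv ℝ (modelLog (frameNorm h (side p) p.base)) (chartAt (E × ℂ) p p)
      (Complex.I • circleField p) = -sgn (side p) := by
  have hq := chart_mem_region p
  have hq2 := (mem_punctured_iff_chart p).mp h0
  have hK := ((contDiffAt_frameNorm h (side p) hq).differentiableAt (by simp))
  rw [fderiv_modelLog hK (frameNorm_pos h (side p) hq) hq2,
    fderiv_modelLog hK (frameNorm_pos h (side p) hq) hq2, circleField_eq]
  simp only [Prod.smul_mk, smul_zero, map_zero, zero_add]
  constructor
  · rw [smul_mul_assoc, mul_assoc, mul_inv_cancel₀ hq2]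
    simp
  · rw [smul_eq_mul, mul_smul_comm, smul_mul_assoc, ← mul_assoc, Complex.I_mul_I, mul_assoc,
      mul_inv_cancel₀ hq2]
    simp

theorem circleField_eq_zero {p : Completion E L} (h0 : p ∉ puncturedBundle E L) :
    circleField p = 0 := by
  have hq2 : (chartAt (E × ℂ) p p).2 = 0 := by simpa using (mem_punctured_iff_chart p).not.mp h0
  rw [circleField_eq, hq2]
  simp

theorem circleField_fst (p : Completion E L) : (circleField p).1 = 0 := by
  rw [circleField_eq]

theorem PotentialData.contDiffAt_momentMap (hP : PotentialData J I φ f a G S) {b : Bool}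
    {x₀ : M} {q : E × ℂ} (hq : q.1 ∈ region E L x₀)
    (hJ : (stdChart E L b x₀).symm q ∈ h.subbundle J) :
    ContDiffAt ℝ ∞ (fun z => momentMap h S ((stdChart E L b x₀).symm z)) q := by
  refine (contDiffAt_comp_of_eventually_mem (hP.smooth_moment b)
    (contDiffAt_modelNormSq (contDiffAt_frameNorm h b hq))
    (eventually_mem_sideDomain h hP.isOpen hq
      ((mem_subbundle_iff h hq).mp hJ))).congr_of_eventuallyEq ?_
  filter_upwards [eventually_mem_subbundle h hP.isOpen hq hJ] with z hz
  exact hP.momentMap_eq h hz.1 hz.2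

theorem PotentialData.contMDiffAt_momentMap (hP : PotentialData J I φ f a G S)
    {p : Completion E L} (hp : p ∈ h.subbundle J) :
    ContMDiffAt 𝓘(ℝ, E × ℂ) 𝓘(ℝ, ℝ) ∞ (momentMap h S) p := by
  have hs := chart_symm_chart p
  have hJ : (stdChart E L (side p) p.base).symm (chartAt (E × ℂ) p p) ∈ h.subbundle J := by
    rwa [hs]
  have h1 := hP.contDiffAt_momentMap h (chart_mem_region p) hJ
  rw [← chartAt_eq] at h1
  have := isManifold_real (E × ℂ) (Completion E L) ∞
  have h2 : ContMDiffAt 𝓘(ℝ, E × ℂ) 𝓘(ℝ, E × ℂ) ∞ (chartAt (E × ℂ) p) p :=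
    contMDiffOn_chart.contMDiffAt
      ((chartAt (E × ℂ) p).open_source.mem_nhds (mem_chart_source _ p))
  refine (h1.contMDiffAt.comp p h2).congr_of_eventuallyEq ?_
  filter_upwards [(chartAt (E × ℂ) p).open_source.mem_nhds (mem_chart_source _ p)] with z hz
  simp [(chartAt (E × ℂ) p).left_inv hz]

/-- Off the sections `X` is vertical and tangent to the level sets of `t`, so both sides reduce to
`-φ(τ) dt`. On the sections both vanish, because `X = 0` and `dr = 0`. -/
theorem PotentialData.contraction (hP : PotentialData J I φ f a G S)
    {p : Completion E L} (hp : p ∈ h.subbundle J) (v : E × ℂ) :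
    momentumForm h ΩM a G p ![circleField p, v] =
      -(differential (E × ℂ) ℝ (momentMap h S) p v) := by
  have hq := chart_mem_region p
  have hs := chart_symm_chart p
  have hJ : (stdChart E L (side p) p.base).symm (chartAt (E × ℂ) p p) ∈ h.subbundle J := by
    rwa [hs]
  have hD := eventually_mem_sideDomain h hP.isOpen hq ((mem_subbundle_iff h hq).mp hJ)
  have hK := (contDiffAt_frameNorm h (side p) hq).differentiableAt (by simp)
  have hr := (contDiffAt_modelNormSq (q := chartAt (E × ℂ) p p)
    (contDiffAt_frameNorm h (side p) hq)).differentiableAt (by simp)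
  have hS := (hP.smooth_moment (side p)).differentiableOn (by simp)
  have hev := eventually_mem_subbundle h hP.isOpen hq hJ
  rw [differential_eq ((hP.contMDiffAt_momentMap h hp).mdifferentiableAt (by simp))]
  have h1 : (fun y => chartAt ℝ (momentMap h S p)
      (momentMap h S ((chartAt (E × ℂ) p).symm y))) =ᶠ[𝓝 (chartAt (E × ℂ) p p)]
      fun y => S (side p) (modelNormSq (frameNorm h (side p) p.base) y) := by
    filter_upwards [hev] with z hz
    rw [chartAt_eq, ← hP.momentMap_eq h hz.1 hz.2]
    rfl
  by_cases h0 : p ∈ puncturedBundle E L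
  · have hq2 := (mem_punctured_iff_chart p).mp h0
    have hT : h.logNorm p ∈ logInterval J := by
      have := (logNorm_mem_logInterval h (b := side p) hq hq2 (J := J)).mp
      rw [hs] at this
      exact this hp
    have h2 : (fun y => chartAt ℝ (momentMap h S p)
        (momentMap h S ((chartAt (E × ℂ) p).symm y))) =ᶠ[𝓝 (chartAt (E × ℂ) p p)]
        fun y => deriv f (sgn (side p) * modelLog (frameNorm h (side p) p.base) y) := by
      filter_upwards [h1, hev, continuous_snd.continuousAt (isOpen_ne.mem_nhds hq2)]
        with z hz hz' hz0
      rw [hz, hP.moment_eq_logNorm h hz'.1 hz'.2 hz0, modelLog_eq h hz'.1 hz0, ← mul_assoc,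
        sgn_mul_self, one_mul]
    have hlog : sgn (side p) * modelLog (frameNorm h (side p) p.base) (chartAt (E × ℂ) p p) =
        h.logNorm p := by
      rw [modelLog_eq h hq hq2, ← mul_assoc, sgn_mul_self, one_mul, hs]
    have hf2 : ContDiffAt ℝ 2 f (h.logNorm p) :=
      (hP.smooth.contDiffAt ((isOpen_logInterval hP.isOpen).mem_nhds hT)).of_le two_le_infty
    have hl := (contDiffAt_modelLog (contDiffAt_frameNorm h (side p) hq)
      (frameNorm_pos h (side p) hq) hq2).differentiableAt (by simp)
    have h3 : HasFDerivAt
        (fun y => deriv f (sgn (side p) * modelLog (frameNorm h (side p) p.base) y))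
        (deriv (deriv f) (h.logNorm p) • (sgn (side p) •
          fderiv ℝ (modelLog (frameNorm h (side p) p.base)) (chartAt (E × ℂ) p p)))
        (chartAt (E × ℂ) p p) := by
      have := differentiableAt_deriv hf2
      rw [← hlog] at this ⊢
      exact this.hasDerivAt.comp_hasFDerivAt
        (f := fun y => sgn (side p) * modelLog (frameNorm h (side p) p.base) y) _
        (hl.hasFDerivAt.const_mul (sgn (side p)))
    obtain ⟨e1, e2⟩ := fderiv_modelLog_circleField h h0
    rw [h2.fderiv_eq, h3.fderiv, hP.momentumForm_apply_punctured h ΩM hp h0, e1, e2,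
      circleField_fst, (hP.profile _ hT).2.2]
    rw [show (ΩM p.base - deriv f (h.logNorm p) • h.curvature p.base) ![0, v.1] = 0 from
      ContinuousAlternatingMap.map_coord_zero _ 0 rfl]
    simp only [_root_.smul_apply, smul_eq_mul]
    ring
  · have hq2 : (chartAt (E × ℂ) p p).2 = 0 := by
      simpa using (mem_punctured_iff_chart p).not.mp h0
    rw [h1.fderiv_eq, fderiv_comp_of_eventually_mem hS hr hD, fderiv_modelNormSq_zero hK hq2,
      circleField_eq_zero h0]
    rw [ContinuousAlternatingMap.map_coord_zero _ 0 rfl]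
    simp

theorem PotentialData.metric_circleField (hP : PotentialData J I φ f a G S)
    {p : Completion E L} (hp : p ∈ h.subbundle J) :
    momentumForm h ΩM a G p ![circleField p, Complex.I • circleField p] =
      φ (momentMap h S p) := by
  by_cases h0 : p ∈ puncturedBundle E L
  · obtain ⟨e1, e2⟩ := fderiv_modelLog_circleField h h0
    rw [hP.momentumForm_apply_punctured h ΩM hp h0, I_smul_I_smul, map_neg, e1, e2,
      hP.momentMap_punctured h hp h0, Prod.smul_fst, circleField_fst]
    rw [ContinuousAlternatingMap.map_coord_zero _ 0 rfl]
    linear_combination φ (deriv f (h.logNorm p)) * sgn_mul_self (side p)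
  · obtain ⟨hD, h1⟩ := hP.momentMap_zero h hp h0
    rw [h1, (hP.profile_zero _ hD).2, circleField_eq_zero h0]
    exact ContinuousAlternatingMap.map_coord_zero _ 0 rfl

theorem exists_logNorm_eq [Nonempty M] (h : HermitianMetric E L) (t : ℝ) (J : Set ℝ≥0∞)
    (ht : t ∈ logInterval J) :
    ∃ p : Completion E L, p ∈ h.subbundle J ∩ puncturedBundle E L ∧ h.logNorm p = t := by
  obtain ⟨x⟩ := ‹Nonempty M›
  have hx : chartAt E x x ∈ region E L x := base_mem_region x
  -- The modulus of the fibre coordinate is solved from `(log K) / 2 + log |w| = t`.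
  let q : E × ℂ := (chartAt E x x,
    (Real.exp (t - (1 / 2) * Real.log (frameNorm h false x (chartAt E x x))) : ℝ))
  have hq : q.1 ∈ region E L x := hx
  have h0 : q.2 ≠ 0 := by simp [q]
  have hl : h.logNorm ((stdChart E L false x).symm q) = t := by
    have := modelLog_eq h (b := false) hq h0
    simp only [sgn, cond_false, one_mul] at this
    rw [← this, modelLog]
    simp [q, Complex.norm_exp]
  refine ⟨(stdChart E L false x).symm q, ⟨?_, (stdChart_symm_mem_punctured hq).mpr h0⟩, hl⟩
  rw [logNorm_mem_logInterval h hq h0, hl]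
  exact ht

theorem PotentialData.isMomentumMetric [Nonempty M] (hP : PotentialData J I φ f a G S)
    (hdata : IsHorizontalData h ΩM I) :
    IsMomentumMetric h ΩM I φ J (momentumForm h ΩM a G) where
  isOpen := hP.isOpen
  ordConnected := hP.ordConnected
  kahler :=
    { smooth := hP.isSmoothOn_momentumForm h hdata.kahler.smooth
      closed := fun p hp => hP.extD_momentumForm h hdata.kahler hp
      type_one_one := fun p hp v w => hP.momentumForm_type h hdata.kahler hp v w
      positive := fun p hp v hv => hP.momentumForm_pos h hdata hp hv }
  momentum := by
    refine ⟨f, momentMap h S, ⟨hP.smooth, ?_⟩, ⟨?_, fun p hp v => hP.contraction h hp v⟩,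
      fun p hp => hP.momentMap_punctured h hp.1 hp.2, ?_, fun p hp => hP.metric_circleField h hp⟩
    · rintro p ⟨hp, h0⟩
      have hJ : (stdChart E L (side p) p.base).symm (chartAt (E × ℂ) p p) ∈ h.subbundle J := by
        rwa [chart_symm_chart]
      have hq2 := (mem_punctured_iff_chart p).mp h0
      have h1 := hP.contDiffAt_comp_logNorm h (chart_mem_region p) hJ hq2
      have h2 := hP.flatDdc_potential h (chart_mem_region p) hJ hq2
      rw [← chartAt_eq] at h1 h2
      rw [momentumForm, h2, ddc_eq (h1.of_le two_le_infty)]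
    · exact fun p hp => (hP.contMDiffAt_momentMap h hp).contMDiffWithinAt
    · refine Subset.antisymm ?_ fun s hs => ?_
      · rintro _ ⟨p, hp, rfl⟩
        by_cases h0 : p ∈ puncturedBundle E L
        · rw [hP.momentMap_punctured h hp h0]
          refine (hP.profile _ ?_).1
          have := (logNorm_mem_logInterval h (b := side p) (chart_mem_region p)
            ((mem_punctured_iff_chart p).mp h0) (J := J)).mp
          rw [chart_symm_chart] at this
          exact this hp
        · obtain ⟨hD, h1⟩ := hP.momentMap_zero h hp h0
          rw [h1]
          exact (hP.profile_zero _ hD).1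
      · rcases hP.surj s hs with ⟨t, ht, rfl⟩ | ⟨b, hb, rfl⟩
        · obtain ⟨p, ⟨hp, h0⟩, rfl⟩ := exists_logNorm_eq h t J ht
          exact ⟨p, hp, hP.momentMap_punctured h hp h0⟩
        · obtain ⟨x⟩ := ‹Nonempty M›
          have hq : ((chartAt E x x, 0) : E × ℂ).1 ∈ region E L x := base_mem_region x
          have hJ : (stdChart E L b x).symm (chartAt E x x, 0) ∈ h.subbundle J := by
            rw [mem_subbundle_iff h hq]
            simpa [modelNormSq] using hb
          refine ⟨_, hJ, ?_⟩
          rw [hP.momentMap_eq h hq hJ]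
          simp [modelNormSq]

end Existence

end MomentumConstruction

end

noncomputable section

namespace MomentumConstruction

/-! ### One-variable calculus on intervals, up to the endpoints. -/

section Calculus

variable {S : Set ℝ} {g : ℝ → ℝ} {a x : ℝ}

theorem intervalIntegrable_of_ordConnected (hS : S.OrdConnected) (hg : ContinuousOn g S)
    {y : ℝ} (hx : x ∈ S) (hy : y ∈ S) : IntervalIntegrable g MeasureTheory.volume x y :=
  (hg.mono (hS.uIcc_subset hx hy)).intervalIntegrable

/-- The fundamental theorem of calculus relative to `S`, valid also at an end of `S`, where `g` is
controlled from one side only. -/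
theorem hasDerivWithinAt_primitive (hS : S.OrdConnected) (hg : ContinuousOn g S) (ha : a ∈ S)
    (hx : x ∈ S) : HasDerivWithinAt (fun y => ∫ u in a..y, g u) (g x) S x := by
  rw [hasDerivWithinAt_iff_isLittleO, Asymptotics.isLittleO_iff]
  intro ε hε
  obtain ⟨δ, hδ, hball⟩ := Metric.continuousWithinAt_iff.mp (hg x hx) ε hε
  filter_upwards [self_mem_nhdsWithin, mem_nhdsWithin_of_mem_nhds (Metric.ball_mem_nhds x hδ)]
    with y hy hyx
  have e : (∫ u in a..y, g u) - (∫ u in a..x, g u) - (y - x) • g x =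
      ∫ u in x..y, (g u - g x) := by
    rw [intervalIntegral.integral_interval_sub_left
      (intervalIntegrable_of_ordConnected hS hg ha hy)
      (intervalIntegrable_of_ordConnected hS hg ha hx),
      intervalIntegral.integral_sub (intervalIntegrable_of_ordConnected hS hg hx hy)
      intervalIntegrable_const, intervalIntegral.integral_const]
  rw [e]
  refine intervalIntegral.norm_integral_le_of_norm_le_const fun u hu => ?_
  have hu' := uIoc_subset_uIcc hu
  refine (hball (hS.uIcc_subset hx hy hu') ?_).le
  rw [Real.dist_eq]
  rw [Metric.mem_ball, Real.dist_eq] at hyx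
  exact (abs_sub_left_of_mem_uIcc hu').trans_lt hyx

theorem hasDerivAt_sub_pow (a x : ℝ) (k : ℕ) :
    HasDerivAt (fun y => (y - a) ^ (k + 1)) ((k + 1) * (x - a) ^ k) x := by
  have := ((hasDerivAt_id x).sub_const a).fun_pow (k + 1)
  simpa using this

theorem eq_of_hasDerivWithinAt_zero (hS : S.OrdConnected)
    (h : ∀ y ∈ S, HasDerivWithinAt g 0 S y) {y : ℝ} (hx : x ∈ S) (hy : y ∈ S) : g x = g y := by
  have := hS.convex.norm_image_sub_le_of_norm_hasDerivWithin_le (C := 0) h (by simp) hy hx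
  simpa [sub_eq_zero] using this

/-- The derivative of each member of the family is again a member, so `C^n` for all members at once
gives `C^(n+1)` for each. -/
theorem contDiffOn_of_derivWithin_closed {ι : Type*} {A : ι → ℝ → ℝ} {succ : ι → ι}
    (hS : UniqueDiffOn ℝ S)
    (hA : ∀ i, ∀ x ∈ S, HasDerivWithinAt (A i) (A (succ i) x) S x) (i : ι) :
    ContDiffOn ℝ ∞ (A i) S := by
  rw [contDiffOn_infty]
  intro n
  induction n generalizing i with
  | zero => exact contDiffOn_zero.mpr fun x hx => (hA i x hx).continuousWithinAt
  | succ n ih =>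
    push_cast
    refine (contDiffOn_succ_iff_derivWithin hS).mpr
      ⟨fun x hx => (hA i x hx).differentiableWithinAt, by simp, ?_⟩
    exact (ih (succ i)).congr fun x hx => (hA i x hx).derivWithin (hS x hx)

theorem strictMonoOn_of_hasDerivWithinAt {R R' : ℝ → ℝ} (hS : S.OrdConnected)
    (hR : ∀ x ∈ S, HasDerivWithinAt R (R' x) S x) (hpos : ∀ x ∈ S, 0 < R' x) :
    StrictMonoOn R S :=
  strictMonoOn_of_hasDerivWithinAt_pos hS.convex (fun x hx => (hR x hx).continuousWithinAt)
    (fun x hx => (hR x (interior_subset hx)).mono interior_subset)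
    fun x hx => hpos x (interior_subset hx)

/-- The inverse function theorem for intervals of the real line. -/
theorem exists_inverse {R B : ℝ → ℝ} (hS : S.OrdConnected)
    (hR : ∀ x ∈ S, HasDerivWithinAt R (B x)⁻¹ S x) (hpos : ∀ x ∈ S, 0 < B x)
    (hB : ContDiffOn ℝ ∞ B S) (hu : UniqueDiffOn ℝ (R '' S)) :
    ∃ g : ℝ → ℝ, (∀ x ∈ S, g (R x) = x) ∧ ContDiffOn ℝ ∞ g (R '' S) ∧
      ∀ y ∈ R '' S, HasDerivWithinAt g (B (g y)) (R '' S) y := by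
  have hm := strictMonoOn_of_hasDerivWithinAt hS hR fun x hx => inv_pos.mpr (hpos x hx)
  have hcR : ContinuousOn R S := fun x hx => (hR x hx).continuousWithinAt
  have hi : (R '' S).OrdConnected := (hS.isPreconnected.image R hcR).ordConnected
  let g : ℝ → ℝ := Function.invFunOn R S
  have hl : ∀ x ∈ S, g (R x) = x := fun x hx => hm.injOn.leftInvOn_invFunOn hx
  have hmem : ∀ y ∈ R '' S, g y ∈ S := by rintro _ ⟨x, hx, rfl⟩; rwa [hl x hx]
  have hr : ∀ y ∈ R '' S, R (g y) = y := by rintro _ ⟨x, hx, rfl⟩; rw [hl x hx]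
  -- `R` is an order isomorphism onto its image, hence a homeomorphism for the order topologies; on
  -- order-connected sets these are the subspace topologies.
  have hc : ContinuousOn g (R '' S) := by
    rw [continuousOn_iff_continuous_domRestrict]
    have h1 : (R '' S).domRestrict g = fun y => (((hm.orderIso R S).symm y : S) : ℝ) := by
      funext y
      obtain ⟨z, rfl⟩ := (hm.orderIso R S).surjective y
      rw [OrderIso.symm_apply_apply]
      exact hl z z.2
    rw [h1]
    exact continuous_subtype_val.comp (hm.orderIso R S).symm.continuous
  have hd : ∀ y ∈ R '' S, HasDerivWithinAt g (B (g y)) (R '' S) y := by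
    intro y hy
    have h1 : HasDerivWithinAt R (B (g y))⁻¹ S (g y) := hR _ (hmem y hy)
    have h2 : Filter.Tendsto g (𝓝[R '' S] y) (𝓝[S] (g y)) :=
      (hc y hy).tendsto_nhdsWithin hmem
    have h3 := HasFDerivWithinAt.of_local_left_inverse (f := R) (g := g) (s := R '' S) (t := S)
      (a := y) (f' := ContinuousLinearEquiv.unitsEquivAut ℝ
        (Units.mk0 (B (g y))⁻¹ (inv_ne_zero (hpos _ (hmem y hy)).ne'))) h2
      (h1.hasFDerivWithinAt.congr_fderiv (by ext; simp)) hy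
      (Filter.eventually_of_mem self_mem_nhdsWithin hr)
    refine h3.hasDerivWithinAt.congr_deriv ?_
    simp
  -- Bootstrapping: `g' = B ∘ g`, so if `g` is `C^n` then `g'` is `C^n` and `g` is `C^(n+1)`.
  refine ⟨g, hl, ?_, hd⟩
  rw [contDiffOn_infty]
  intro n
  induction n with
  | zero => exact contDiffOn_zero.mpr hc
  | succ n ih =>
    push_cast
    refine (contDiffOn_succ_iff_derivWithin hu).mpr
      ⟨fun y hy => (hd y hy).differentiableWithinAt, by simp, ?_⟩
    exact ((hB.of_le (by exact_mod_cast le_top)).comp ih hmem).congr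
      fun y hy => (hd y hy).derivWithin (hu y hy)

/-- The average of `(x - a) ^ k g(x)` from `a` to `x`. -/
def powAverage (a : ℝ) (k : ℕ) (g : ℝ → ℝ) (x : ℝ) : ℝ :=
  ∫ u in (0 : ℝ)..1, u ^ k * g (a + u * (x - a))

theorem segment_mem (hS : S.OrdConnected) (ha : a ∈ S) (hx : x ∈ S) {u : ℝ} (h0 : 0 ≤ u)
    (h1 : u ≤ 1) : a + u * (x - a) ∈ S := by
  have := hS.convex.add_smul_sub_mem ha hx ⟨h0, h1⟩
  simpa using this

/-- The substitution `y = a + u (x - a)` turns the average into a primitive, which the fundamental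
theorem can differentiate. -/
theorem pow_mul_powAverage (k : ℕ) :
    (x - a) ^ (k + 1) * powAverage a k g x = ∫ y in a..x, (y - a) ^ k * g y := by
  rcases eq_or_ne x a with rfl | hx
  · simp
  · have hx' : x - a ≠ 0 := sub_ne_zero.mpr hx
    have := intervalIntegral.integral_comp_mul_add (a := 0) (b := 1)
      (fun y => (y - a) ^ k * g y) hx' a
    simp only [mul_zero, zero_add, mul_one, sub_add_cancel, smul_eq_mul] at this
    rw [inv_mul_eq_div, eq_div_iff hx'] at this
    rw [← this, pow_succ, mul_assoc, mul_comm (x - a), ← mul_assoc, powAverage,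
      ← intervalIntegral.integral_const_mul]
    congr 1
    refine intervalIntegral.integral_congr fun u _ => ?_
    simp only [add_sub_cancel_right, mul_pow]
    rw [add_comm a, mul_comm u (x - a)]
    ring

theorem continuousWithinAt_powAverage (hS : S.OrdConnected) (hg : ContinuousOn g S) (ha : a ∈ S)
    (k : ℕ) : ContinuousWithinAt (powAverage a k g) S a := by
  rw [Metric.continuousWithinAt_iff]
  intro ε hε
  obtain ⟨δ, hδ, hball⟩ := Metric.continuousWithinAt_iff.mp (hg a ha) (ε / 2) (half_pos hε)
  refine ⟨δ, hδ, fun {x} hx hxa => ?_⟩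
  have hcont (z : ℝ) (hz : z ∈ S) :
      ContinuousOn (fun u : ℝ => u ^ k * g (a + u * (z - a))) (uIcc 0 1) := by
    refine (continuousOn_id.pow k).mul (hg.comp (by fun_prop) fun u hu => ?_)
    rw [uIcc_of_le zero_le_one] at hu
    exact segment_mem hS ha hz hu.1 hu.2
  rw [Real.dist_eq, powAverage, powAverage, ← intervalIntegral.integral_sub
    (hcont x hx).intervalIntegrable (hcont a ha).intervalIntegrable, ← Real.norm_eq_abs]
  refine (intervalIntegral.norm_integral_le_of_norm_le_const (C := ε / 2)
    fun u hu => ?_).trans_lt (by simpa using half_lt_self hε)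
  rw [uIoc_of_le zero_le_one] at hu
  rw [← mul_sub, norm_mul, Real.norm_eq_abs, Real.norm_eq_abs, abs_pow, abs_of_pos hu.1]
  have h1 : |g (a + u * (x - a)) - g (a + u * (a - a))| ≤ ε / 2 := by
    have := hball (segment_mem hS ha hx hu.1.le hu.2) (by
      rw [Real.dist_eq, add_sub_cancel_left, abs_mul, abs_of_pos hu.1]
      rw [Real.dist_eq] at hxa
      exact (mul_le_of_le_one_left (abs_nonneg _) hu.2).trans_lt hxa)
    rw [Real.dist_eq] at this
    simpa using this.le
  calc u ^ k * _ ≤ 1 * (ε / 2) :=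
        mul_le_mul (pow_le_one₀ hu.1.le hu.2) h1 (abs_nonneg _) zero_le_one
    _ = ε / 2 := one_mul _

theorem hasDerivWithinAt_powAverage_of_ne (hS : S.OrdConnected)
    {g' : ℝ → ℝ} (hg : ∀ x ∈ S, HasDerivWithinAt g (g' x) S x) (hg' : ContinuousOn g' S)
    (ha : a ∈ S) (k : ℕ) (hx : x ∈ S) (hxa : x ≠ a) :
    HasDerivWithinAt (powAverage a k g) (powAverage a (k + 1) g' x) S x := by
  have hc : ContinuousOn g S := fun x hx => (hg x hx).continuousWithinAt
  have hprim {u : ℝ → ℝ} (hcu : ContinuousOn u S) (j : ℕ) {y : ℝ} (hy : y ∈ S) :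
      HasDerivWithinAt (fun y => (y - a) ^ (j + 1) * powAverage a j u y) ((y - a) ^ j * u y)
        S y := by
    simp_rw [pow_mul_powAverage]
    exact hasDerivWithinAt_primitive hS (g := fun y => (y - a) ^ j * u y)
      (ContinuousOn.mul (by fun_prop) hcu) ha hy
  -- Integration by parts for `(y - a)^(k+1) g'`, verified by differentiating the difference of the
  -- two sides, which vanishes at `a`.
  have hparts : (x - a) ^ (k + 2) * powAverage a (k + 1) g' x =
      (x - a) ^ (k + 1) * g x - (k + 1) * ((x - a) ^ (k + 1) * powAverage a k g x) := by
    have hd (y : ℝ) (hy : y ∈ S) : HasDerivWithinAt (fun y =>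
        (y - a) ^ (k + 1) * g y - (k + 1) * ((y - a) ^ (k + 1) * powAverage a k g y) -
          (y - a) ^ (k + 1 + 1) * powAverage a (k + 1) g' y) 0 S y := by
      have h1 := (hasDerivAt_sub_pow a y k).hasDerivWithinAt (s := S)
      refine (((h1.mul (hg y hy)).sub ((hprim hc k hy).const_mul _)).sub
        (hprim hg' (k + 1) hy)).congr_deriv ?_
      ring
    have := eq_of_hasDerivWithinAt_zero hS hd hx ha
    simp only [sub_self, ne_eq, Nat.add_eq_zero_iff, one_ne_zero, and_false, not_false_eq_true,
      zero_pow, zero_mul, mul_zero] at this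
    linarith
  have hx' : x - a ≠ 0 := sub_ne_zero.mpr hxa
  have h1 := (hasDerivAt_sub_pow a x k).hasDerivWithinAt (s := S)
  have h2 := (hprim hc k hx).div h1 (pow_ne_zero _ hx')
  refine (h2.congr_deriv ?_).congr_of_eventuallyEq_of_mem ?_ hx
  · rw [div_eq_iff (pow_ne_zero _ (pow_ne_zero _ hx'))]
    have e : powAverage a (k + 1) g' x * ((x - a) ^ (k + 1)) ^ 2 =
        (x - a) ^ k * ((x - a) ^ (k + 2) * powAverage a (k + 1) g' x) := by ring
    rw [e, hparts]
    ring
  · filter_upwards [mem_nhdsWithin_of_mem_nhds (isOpen_ne.mem_nhds hxa)] with y hy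
    have : y - a ≠ 0 := sub_ne_zero.mpr hy
    simp only [Pi.div_apply]
    field_simp

/-- At `x = a` the quotient by `(x - a)^(k+1)` degenerates. There the average is continuous and its
derivatives at nearby points converge, so the limit is the one-sided derivative. -/
theorem hasDerivWithinAt_powAverage (hS : S.OrdConnected)
    (hmin : IsLeast S a) {g' : ℝ → ℝ} (hg : ∀ x ∈ S, HasDerivWithinAt g (g' x) S x)
    (hg' : ContinuousOn g' S) (hnhds : ∀ x ∈ S, x ≠ a → S ∈ 𝓝 x) (hright : S ∈ 𝓝[>] a) (k : ℕ)
    (hx : x ∈ S) :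
    HasDerivWithinAt (powAverage a k g) (powAverage a (k + 1) g' x) S x := by
  have hc : ContinuousOn g S := fun x hx => (hg x hx).continuousWithinAt
  by_cases hxa : x = a
  · subst hxa
    have hright' : S \ {x} ∈ 𝓝[>] x := by
      filter_upwards [hright, self_mem_nhdsWithin] with y hy hy'
      exact ⟨hy, ne_of_gt hy'⟩
    refine (hasDerivWithinAt_Ici_of_tendsto_deriv (s := S \ {x}) ?_ ?_ hright' ?_).mono
      fun y hy => hmin.2 hy
    · exact fun y hy => ((hasDerivWithinAt_powAverage_of_ne hS hg hg' hx k hy.1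
        hy.2).differentiableWithinAt).mono sdiff_subset
    · exact (continuousWithinAt_powAverage hS hc hx k).mono sdiff_subset
    · have h1 : Filter.Tendsto (powAverage x (k + 1) g') (𝓝[>] x)
          (𝓝 (powAverage x (k + 1) g' x)) :=
        (continuousWithinAt_powAverage hS hg' hx (k + 1)).tendsto.mono_left
          (nhdsWithin_le_of_mem hright)
      refine h1.congr' ?_
      filter_upwards [hright'] with y hy
      exact (((hasDerivWithinAt_powAverage_of_ne hS hg hg' hx k hy.1
        hy.2).hasDerivAt (hnhds y hy.1 hy.2)).deriv).symm
  · exact hasDerivWithinAt_powAverage_of_ne hS hg hg' hmin.1 k hx hxa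

/-- A smooth function on an interval is divisible by `x - a` up to its value at the end `a`. -/
theorem exists_eq_add_sub_mul (hS : S.OrdConnected) (hu : UniqueDiffOn ℝ S)
    (hmin : IsLeast S a) (hg : ContDiffOn ℝ ∞ g S) (hnhds : ∀ x ∈ S, x ≠ a → S ∈ 𝓝 x)
    (hright : S ∈ 𝓝[>] a) :
    ∃ q : ℝ → ℝ, ContDiffOn ℝ ∞ q S ∧ ∀ x ∈ S, g x = g a + (x - a) * q x := by
  -- Hadamard's lemma: the quotient `(g x - g a) / (x - a)` is the average of `g'`. Differentiating
  -- an average replaces `(u, k)` by `(u', k + 1)`, so the averages indexed by such pairs are closed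
  -- under differentiation.
  let ι := {u : ℝ → ℝ // ContDiffOn ℝ ∞ u S} × ℕ
  have hd (u : ℝ → ℝ) (h : ContDiffOn ℝ ∞ u S) : ContDiffOn ℝ ∞ (derivWithin u S) S :=
    ((contDiffOn_infty_iff_derivWithin hu).mp h).2
  have h1 := contDiffOn_of_derivWithin_closed (ι := ι) (A := fun i => powAverage a i.2 i.1.1)
    (succ := fun i => (⟨derivWithin i.1.1 S, hd _ i.1.2⟩, i.2 + 1)) hu
    (fun i x hx => hasDerivWithinAt_powAverage hS hmin
      (fun x hx => ((i.1.2.differentiableOn (by simp)) x hx).hasDerivWithinAt)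
      (hd _ i.1.2).continuousOn hnhds hright i.2 hx)
    (⟨derivWithin g S, hd g hg⟩, 0)
  refine ⟨_, h1, fun x hx => ?_⟩
  have h2 := pow_mul_powAverage (a := a) (x := x) (g := derivWithin g S) 0
  simp only [zero_add, pow_one, pow_zero, one_mul] at h2
  have h3 (y : ℝ) (hy : y ∈ S) :
      HasDerivWithinAt (fun y => g y - ∫ z in a..y, derivWithin g S z) 0 S y := by
    refine (((hg.differentiableOn (by simp)) y hy).hasDerivWithinAt.sub
      (hasDerivWithinAt_primitive hS (hd g hg).continuousOn hmin.1 hy)).congr_deriv (sub_self _)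
  have := eq_of_hasDerivWithinAt_zero hS h3 hx hmin.1
  simp only [intervalIntegral.integral_same, sub_zero] at this
  rw [h2]
  linarith

end Calculus

end MomentumConstruction

end

noncomputable section

namespace MomentumConstruction

/-! ### Smooth extension of the momentum across an end where the profile closes up. -/

section Profile

theorem contDiffOn_infty_of_hasDerivWithinAt {S : Set ℝ} {F F' : ℝ → ℝ} (hu : UniqueDiffOn ℝ S)
    (hF : ∀ x ∈ S, HasDerivWithinAt F (F' x) S x) (hF' : ContDiffOn ℝ ∞ F' S) :
    ContDiffOn ℝ ∞ F S :=
  (contDiffOn_infty_iff_derivWithin hu).mpr ⟨fun x hx => (hF x hx).differentiableWithinAt,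
    hF'.congr fun x hx => (hF x hx).derivWithin (hu x hx)⟩

theorem uniqueDiffOn_of_Ioo_subset {S : Set ℝ} (hS : S.OrdConnected) {a b : ℝ} (hab : a < b)
    (h : Ioo a b ⊆ S) : UniqueDiffOn ℝ S :=
  uniqueDiffOn_convex hS.convex
    ((nonempty_Ioo.mpr hab).mono (interior_maximal h isOpen_Ioo))

/-- At an end where the profile closes up, the momentum is a smooth function of the squared norm,
and the potential is smooth up to a multiple of the logarithm of the norm. -/
theorem exists_potential_at_end {U T : Set ℝ} {α : ℝ} {φ σ f : ℝ → ℝ} (hU : IsOpen U)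
    (hS : (insert α U).OrdConnected) (hα : ∀ s ∈ U, α < s)
    (hφ : ContDiffOn ℝ ∞ φ (insert α U)) (hpos : ∀ s ∈ U, 0 < φ s) (hφ0 : φ α = 0)
    (hφ2 : HasDerivWithinAt φ 2 (insert α U) α) (hT0 : 0 ∈ T) (hT : T.OrdConnected)
    (hσ : ∀ t ∈ T, HasDerivAt σ (φ (σ t)) t) (hσT : σ '' T = U)
    (hf : ∀ t ∈ T, HasDerivAt f (σ t) t) (hf0 : f 0 = 0) :
    ∃ D : Set ℝ, D = insert 0 ((fun t => Real.exp (2 * t)) '' T) ∧ D.OrdConnected ∧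
      ∃ G τ : ℝ → ℝ, ContDiffOn ℝ ∞ G D ∧ ContDiffOn ℝ ∞ τ D ∧
        (∀ t ∈ T, τ (Real.exp (2 * t)) = σ t) ∧ τ 0 = α ∧
        (∀ t ∈ T, f t = α * t + G (Real.exp (2 * t))) ∧ 0 < derivWithin G D 0 := by
  set S := insert α U with hSdef
  have hαS : α ∈ S := mem_insert _ _
  have hUS : U ⊆ S := subset_insert _ _
  have hσU : ∀ t ∈ T, σ t ∈ U := fun t ht => hσT ▸ mem_image_of_mem σ ht
  have hs1 : σ 0 ∈ U := hσU 0 hT0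
  have hIoo : Ioo α (σ 0) ⊆ S := Ioo_subset_Icc_self.trans (hS.out hαS (hUS hs1))
  have hu : UniqueDiffOn ℝ S := uniqueDiffOn_of_Ioo_subset hS (hα _ hs1) hIoo
  have hmin : IsLeast S α := ⟨hαS, by rintro s (rfl | hs); exacts [le_rfl, (hα s hs).le]⟩
  have hnhds : ∀ x ∈ S, x ≠ α → S ∈ 𝓝 x := fun x hx hxα =>
    Filter.mem_of_superset (hU.mem_nhds (hx.resolve_left hxα)) hUS
  have hright : S ∈ 𝓝[>] α := Filter.mem_of_superset (Ioo_mem_nhdsGT (hα _ hs1)) hIoo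
  -- Two divisions by `s - α`: `φ = (s - α) ψ` and `ψ = 2 + (s - α) χ`, the constant `2` being
  -- `φ'(α)`.
  obtain ⟨ψ, hψ, hφψ⟩ := exists_eq_add_sub_mul hS hu hmin hφ hnhds hright
  obtain ⟨χ, hχ, hψχ⟩ := exists_eq_add_sub_mul hS hu hmin hψ hnhds hright
  simp only [hφ0, zero_add] at hφψ
  have hψ2 : ψ α = 2 := by
    have h1 : HasDerivWithinAt (fun s => (s - α) * ψ s) (1 * ψ α + (α - α) * derivWithin ψ S α)
        S α := ((hasDerivAt_id α).sub_const α).hasDerivWithinAt.mul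
      (hψ.differentiableOn (by simp) α hαS).hasDerivWithinAt
    have h2 := (h1.congr (fun s hs => hφψ s hs) (hφψ α hαS)).derivWithin (hu α hαS)
    rw [hφ2.derivWithin (hu α hαS)] at h2
    linarith
  rw [hψ2] at hψχ
  have hψpos : ∀ s ∈ S, 0 < ψ s := by
    rintro s (rfl | hs)
    · rw [hψ2]; norm_num
    · have := hpos s hs
      rw [hφψ s (hUS hs)] at this
      exact (mul_pos_iff_of_pos_left (sub_pos.mpr (hα s hs))).mp this
  -- Along a solution, `d(log r)/ds = 2/φ = 1/(s - α) - χ/ψ`, so `log r = log (s - α) + k(s)` with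
  -- `k' = -χ/ψ` smooth up to `α`. The constant is chosen to give `r = 1` at `t = 0`. The slope `2`
  -- is what gives `s - α` the exponent `1`.
  let k : ℝ → ℝ := fun s => -(∫ u in σ 0..s, χ u / ψ u) - Real.log (σ 0 - α)
  have hq : ContDiffOn ℝ ∞ (fun s => χ s / ψ s) S := hχ.div hψ fun s hs => (hψpos s hs).ne'
  have hk : ∀ s ∈ S, HasDerivWithinAt k (-(χ s / ψ s)) S s := fun s hs =>
    ((hasDerivWithinAt_primitive hS hq.continuousOn (hUS hs1) hs).neg).sub_const _
  have hks : ContDiffOn ℝ ∞ k S := contDiffOn_infty_of_hasDerivWithinAt hu hk hq.neg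
  let R : ℝ → ℝ := fun s => (s - α) * Real.exp (k s)
  -- The reciprocal of `R'`. It is smooth and positive also at `α`, so `R` is a change of coordinate
  -- including the end.
  let B : ℝ → ℝ := fun s => ψ s * Real.exp (-k s) / 2
  have hBpos : ∀ s ∈ S, 0 < B s := fun s hs => by have := hψpos s hs; positivity
  have hR : ∀ s ∈ S, HasDerivWithinAt R (B s)⁻¹ S s := by
    intro s hs
    have h1 := ((hasDerivAt_id s).sub_const α).hasDerivWithinAt (s := S)
    refine (h1.mul (hk s hs).exp).congr_deriv ?_
    have := (hψpos s hs).ne'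
    simp only [B, Real.exp_neg, id]
    field_simp
    linear_combination hψχ s hs
  have hRα : R α = 0 := by simp [R]
  have hRσ : ∀ t ∈ T, R (σ t) = Real.exp (2 * t) := by
    intro t ht
    have hd : ∀ t ∈ T, HasDerivWithinAt (fun t => R (σ t) * Real.exp (-(2 * t))) 0 T t := by
      intro t ht
      have h1 : HasDerivWithinAt (fun t => R (σ t)) ((B (σ t))⁻¹ * φ (σ t)) T t :=
        (hR (σ t) (hUS (hσU t ht))).comp t (hσ t ht).hasDerivWithinAt
          fun u hu => hUS (hσU u hu)
      have h2 := (((hasDerivAt_id t).const_mul 2).neg.exp).hasDerivWithinAt (s := T)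
      refine (h1.mul h2).congr_deriv ?_
      have := (hψpos _ (hUS (hσU t ht))).ne'
      simp only [B, R, hφψ _ (hUS (hσU t ht)), Real.exp_neg, id]
      field_simp
      ring
    have h3 := eq_of_hasDerivWithinAt_zero hT hd ht hT0
    have h4 : R (σ 0) = 1 := by
      have := sub_pos.mpr (hα _ hs1)
      simp only [R, k, intervalIntegral.integral_same, neg_zero, zero_sub, Real.exp_neg,
        Real.exp_log this]
      exact mul_inv_cancel₀ this.ne'
    simp only [h4, mul_zero, neg_zero, Real.exp_zero, mul_one, Real.exp_neg] at h3
    exact (mul_inv_eq_one₀ (Real.exp_ne_zero _)).mp h3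
  -- An image of an interval under a continuous map is an interval, so here `T` must be unbounded
  -- below: the end is reached only as `t → -∞`.
  have hRS : R '' S = insert 0 ((fun t => Real.exp (2 * t)) '' T) := by
    rw [hSdef, image_insert_eq, hRα, ← hσT, image_image]
    congr 1
    exact image_congr hRσ
  have hDc : (R '' S).OrdConnected :=
    (hS.isPreconnected.image R fun x hx => (hR x hx).continuousWithinAt).ordConnected
  have h0D : (0 : ℝ) ∈ R '' S := ⟨α, hαS, hRα⟩
  have h1D : (1 : ℝ) ∈ R '' S := ⟨σ 0, hUS hs1, by simpa using hRσ 0 hT0⟩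
  have hDu : UniqueDiffOn ℝ (R '' S) := uniqueDiffOn_of_Ioo_subset hDc zero_lt_one
    (Ioo_subset_Icc_self.trans (hDc.out h0D h1D))
  obtain ⟨τ, hτR, hτ, -⟩ := exists_inverse hS hR hBpos
    ((hψ.mul (Real.contDiff_exp.comp_contDiffOn hks.neg)).div_const 2) hDu
  have hτS : MapsTo τ (R '' S) S := by rintro _ ⟨s, hs, rfl⟩; rwa [hτR s hs]
  have hτσ : ∀ t ∈ T, τ (Real.exp (2 * t)) = σ t := fun t ht => by
    rw [← hRσ t ht, hτR _ (hUS (hσU t ht))]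
  -- Differentiating `f = α t + G(e^{2t})` forces `G'(r) = (τ - α) / (2 r)`, which is `exp (-k) /
  -- 2`: smooth and positive even at `r = 0`. The base point `1` matches `f 0 = 0`.
  have hG' : ContDiffOn ℝ ∞ (fun r => Real.exp (-k (τ r)) / 2) (R '' S) :=
    (Real.contDiff_exp.comp_contDiffOn (hks.comp hτ hτS).neg).div_const 2
  let G : ℝ → ℝ := fun r => ∫ u in (1 : ℝ)..r, Real.exp (-k (τ u)) / 2
  have hG : ∀ r ∈ R '' S, HasDerivWithinAt G (Real.exp (-k (τ r)) / 2) (R '' S) r := fun r hr =>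
    hasDerivWithinAt_primitive hDc hG'.continuousOn h1D hr
  refine ⟨R '' S, hRS, hDc, G, τ, contDiffOn_infty_of_hasDerivWithinAt hDu hG hG', hτ, hτσ, ?_,
    fun t ht => ?_, ?_⟩
  · rw [← hRα, hτR α hαS]
  · have hd : ∀ t ∈ T,
        HasDerivWithinAt (fun t => f t - (α * t + G (Real.exp (2 * t)))) 0 T t := by
      intro t ht
      have hmem : ∀ t ∈ T, Real.exp (2 * t) ∈ R '' S := fun t ht =>
        ⟨σ t, hUS (hσU t ht), hRσ t ht⟩
      have h1 : HasDerivWithinAt (fun t => Real.exp (2 * t)) (Real.exp (2 * t) * (2 * 1)) T t :=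
        (((hasDerivAt_id t).const_mul 2).exp).hasDerivWithinAt
      have h2 := (hG _ (hmem t ht)).comp t h1 hmem
      refine ((hf t ht).hasDerivWithinAt.sub
        (((hasDerivAt_id t).const_mul α).hasDerivWithinAt.add h2)).congr_deriv ?_
      have h3 : Real.exp (2 * t) = (σ t - α) * Real.exp (k (σ t)) := (hRσ t ht).symm
      simp only [hτσ t ht, Real.exp_neg]
      rw [h3]
      field_simp
      ring
    have := eq_of_hasDerivWithinAt_zero hT hd ht hT0
    simp only [hf0, mul_zero, zero_add, Real.exp_zero] at this
    have hG1 : G 1 = 0 := intervalIntegral.integral_same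
    linarith
  · rw [(hG 0 h0D).derivWithin (hDu 0 h0D)]
    positivity

end Profile

end MomentumConstruction

end

noncomputable section

namespace MomentumConstruction

/-! ### Intervals of squared norms and the ends of momentum intervals. -/

section Intervals

/-- The set of squared norms with logarithms in `T`, together with the ends `b` such that `P b`. -/
def normInterval (T : Set ℝ) (P : Bool → Prop) : Set ℝ≥0∞ :=
  {x | (∃ t ∈ T, x = ENNReal.ofReal (Real.exp (2 * t))) ∨ ∃ b, P b ∧ x = flip b 0}

variable {T : Set ℝ} {P : Bool → Prop}

theorem exists_eq_ofReal_exp {x : ℝ≥0∞} (h0 : x ≠ 0) (h1 : x ≠ ⊤) :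
    ∃ t : ℝ, x = ENNReal.ofReal (Real.exp (2 * t)) := by
  refine ⟨Real.log x.toReal / 2, ?_⟩
  rw [mul_div_cancel₀ _ two_ne_zero, Real.exp_log (ENNReal.toReal_pos h0 h1),
    ENNReal.ofReal_toReal h1]

theorem ofReal_exp_le_iff {s t : ℝ} :
    ENNReal.ofReal (Real.exp (2 * s)) ≤ ENNReal.ofReal (Real.exp (2 * t)) ↔ s ≤ t := by
  rw [ENNReal.ofReal_le_ofReal_iff (Real.exp_nonneg _), Real.exp_le_exp]
  constructor <;> intro h <;> linarith

theorem ofReal_exp_lt_iff {s t : ℝ} :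
    ENNReal.ofReal (Real.exp (2 * s)) < ENNReal.ofReal (Real.exp (2 * t)) ↔ s < t := by
  rw [← not_le, ofReal_exp_le_iff, not_le]

theorem flip_zero_false : flip false (0 : ℝ≥0∞) = 0 := rfl

theorem flip_zero_true : flip true (0 : ℝ≥0∞) = ⊤ := ENNReal.inv_zero

theorem ofReal_exp_ne_flip (b : Bool) (t : ℝ) :
    ENNReal.ofReal (Real.exp (2 * t)) ≠ flip b 0 := by
  cases b
  · simpa [flip_zero_false] using Real.exp_pos _
  · simp [flip_zero_true]

theorem logInterval_normInterval : logInterval (normInterval T P) = T := by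
  ext t
  constructor
  · rintro (⟨s, hs, h⟩ | ⟨b, -, h⟩)
    · rwa [le_antisymm (ofReal_exp_le_iff.mp h.le) (ofReal_exp_le_iff.mp h.ge)]
    · exact absurd h (ofReal_exp_ne_flip b t)
  · exact fun ht => Or.inl ⟨t, ht, rfl⟩

theorem flip_zero_injective : Function.Injective fun b => flip b (0 : ℝ≥0∞) := by
  intro b c h
  cases b <;> cases c <;> simp_all [flip_zero_false, flip_zero_true]

theorem zero_mem_sideDomain_iff {J : Set ℝ≥0∞} {b : Bool} :
    0 ∈ sideDomain b J ↔ flip b 0 ∈ J := by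
  simp [sideDomain]

theorem flip_zero_mem_normInterval {b : Bool} : flip b 0 ∈ normInterval T P ↔ P b := by
  constructor
  · rintro (⟨s, hs, h⟩ | ⟨c, hc, h⟩)
    · exact absurd h.symm (ofReal_exp_ne_flip b s)
    · rwa [flip_zero_injective h]
  · exact fun h => Or.inr ⟨b, h, rfl⟩

theorem mem_sideDomain_iff {J : Set ℝ≥0∞} {b : Bool} {s : ℝ} :
    s ∈ sideDomain b J ↔
      (∃ t, sgn b * t ∈ logInterval J ∧ Real.exp (2 * t) = s) ∨ s = 0 ∧ flip b 0 ∈ J := by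
  constructor
  · intro hs
    rcases hs.1.eq_or_lt with rfl | h0
    · exact Or.inr ⟨rfl, zero_mem_sideDomain_iff.mp hs⟩
    · have e : Real.exp (2 * (Real.log s / 2)) = s := by
        rw [mul_div_cancel₀ _ two_ne_zero, Real.exp_log h0]
      exact Or.inl ⟨_, exp_mem_sideDomain.mp (by rwa [e]), e⟩
  · rintro (⟨t, ht, rfl⟩ | ⟨rfl, h⟩)
    · exact exp_mem_sideDomain.mpr ht
    · exact zero_mem_sideDomain_iff.mpr h

/-- The hypothesis on `P` says that `T` runs off to infinity towards each added end; otherwise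
adding it would leave a gap. -/
theorem ordConnected_normInterval (hT : T.OrdConnected) (hne : T.Nonempty)
    (hP : ∀ b, P b → ∀ s ∈ T, ∀ t, sgn b * t ≤ sgn b * s → t ∈ T) :
    (normInterval T P).OrdConnected := by
  have hPf : P false → ∀ s ∈ T, ∀ t, t ≤ s → t ∈ T := by simpa [sgn] using hP false
  have hPt : P true → ∀ s ∈ T, ∀ t, s ≤ t → t ∈ T := by simpa [sgn] using hP true
  refine ⟨fun x hx y hy z hz => ?_⟩
  rcases eq_or_ne z 0 with rfl | h0
  · rwa [le_zero_iff.mp hz.1] at hx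
  rcases eq_or_ne z ⊤ with rfl | h1
  · rwa [top_le_iff.mp hz.2] at hy
  obtain ⟨t, rfl⟩ := exists_eq_ofReal_exp h0 h1
  have hlow : P false ∨ ∃ s ∈ T, s ≤ t := by
    rcases hx with ⟨s, hs, rfl⟩ | ⟨b, hb, rfl⟩
    · exact Or.inr ⟨s, hs, ofReal_exp_le_iff.mp hz.1⟩
    · cases b
      · exact Or.inl hb
      · exact absurd (top_le_iff.mp (flip_zero_true ▸ hz.1)) h1
  have hup : P true ∨ ∃ s ∈ T, t ≤ s := by
    rcases hy with ⟨s, hs, rfl⟩ | ⟨b, hb, rfl⟩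
    · exact Or.inr ⟨s, hs, ofReal_exp_le_iff.mp hz.2⟩
    · cases b
      · exact absurd (le_zero_iff.mp (flip_zero_false ▸ hz.2)) h0
      · exact Or.inl hb
  refine Or.inl ⟨t, ?_, rfl⟩
  rcases hlow with hf | ⟨s, hs, hst⟩
  · rcases hup with ht | ⟨u, hu, htu⟩
    · obtain ⟨s, hs⟩ := hne
      rcases le_total t s with h | h
      exacts [hPf hf s hs t h, hPt ht s hs t h]
    · exact hPf hf u hu t htu
  · rcases hup with ht | ⟨u, hu, htu⟩
    · exact hPt ht s hs t hst
    · exact hT.out hs hu ⟨hst, htu⟩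

theorem isOpen_normInterval (hT : T.OrdConnected) (hTo : IsOpen T) (hne : T.Nonempty)
    (hP : ∀ b, P b → ∀ s ∈ T, ∀ t, sgn b * t ≤ sgn b * s → t ∈ T) :
    IsOpen (normInterval T P) := by
  have hoc := ordConnected_normInterval hT hne hP
  have hmem {t : ℝ} (ht : t ∈ T) : ENNReal.ofReal (Real.exp (2 * t)) ∈ normInterval T P :=
    Or.inl ⟨t, ht, rfl⟩
  refine isOpen_iff_mem_nhds.mpr fun x hx => ?_
  rcases id hx with ⟨t, ht, rfl⟩ | ⟨b, hb, rfl⟩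
  · obtain ⟨l, u, htlu, hlu⟩ := mem_nhds_iff_exists_Ioo_subset.mp (hTo.mem_nhds ht)
    have h1 : (l + t) / 2 ∈ T := hlu ⟨by linarith [htlu.1], by linarith [htlu.1, htlu.2]⟩
    have h2 : (t + u) / 2 ∈ T := hlu ⟨by linarith [htlu.1, htlu.2], by linarith [htlu.2]⟩
    refine Filter.mem_of_superset (Ioo_mem_nhds (ofReal_exp_lt_iff.mpr ?_)
      (ofReal_exp_lt_iff.mpr ?_)) (Ioo_subset_Icc_self.trans (hoc.out (hmem h1) (hmem h2)))
    · linarith [htlu.1]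
    · linarith [htlu.2]
  -- A neighbourhood of an added end is the ray between it and any point coming from `T`; the ray
  -- lies in the set by order-connectedness.
  · obtain ⟨s, hs⟩ := hne
    cases b
    · refine Filter.mem_of_superset ((isOpen_Iio (a := ENNReal.ofReal (Real.exp (2 * s)))).mem_nhds ?_)
        fun y hy => hoc.out hx (hmem hs) ⟨?_, le_of_lt hy⟩
      · simpa [flip_zero_false] using Real.exp_pos _
      · rw [flip_zero_false]; exact zero_le
    · refine Filter.mem_of_superset ((isOpen_Ioi (a := ENNReal.ofReal (Real.exp (2 * s)))).mem_nhds ?_)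
        fun y hy => hoc.out (hmem hs) hx ⟨le_of_lt hy, ?_⟩
      · simp [flip_zero_true]
      · rw [flip_zero_true]; exact le_top

/-- `α` is the least (`b = false`) or the greatest (`b = true`) element of `I`. -/
def IsEnd (b : Bool) (I : Set ℝ) (α : ℝ) : Prop := α ∈ I ∧ ∀ s ∈ I, sgn b * α ≤ sgn b * s

variable {I : Set ℝ} {φ : ℝ → ℝ} {α : ℝ} {b : Bool}

theorem isEnd_false : IsEnd false I α ↔ IsLeast I α := by
  simp [IsEnd, IsLeast, lowerBounds, sgn]

theorem isEnd_true : IsEnd true I α ↔ IsGreatest I α := by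
  simp [IsEnd, IsGreatest, upperBounds, sgn]

theorem ClosesUp.of_isEnd (hφ : ClosesUp I φ) (h : IsEnd b I α) :
    φ α = 0 ∧ HasDerivWithinAt φ (sgn b * 2) I α := by
  cases b
  · simpa [sgn] using hφ.lower α (isEnd_false.mp h)
  · simpa [sgn] using hφ.upper α (isEnd_true.mp h)

theorem IsEnd.notMem_interior (h : IsEnd b I α) : α ∉ interior I := by
  intro hα
  obtain ⟨l, u, hlu, hI⟩ := mem_nhds_iff_exists_Ioo_subset.mp
    (mem_interior_iff_mem_nhds.mp hα)
  cases b
  · have := (isEnd_false.mp h).2 (@hI ((l + α) / 2)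
      ⟨by linarith [hlu.1], by linarith [hlu.1, hlu.2]⟩)
    linarith [hlu.1]
  · have := (isEnd_true.mp h).2 (@hI ((α + u) / 2)
      ⟨by linarith [hlu.1, hlu.2], by linarith [hlu.2]⟩)
    linarith [hlu.2]

theorem Ioo_subset_interior (hI : I.OrdConnected) {x y : ℝ} (hx : x ∈ I) (hy : y ∈ I) :
    Ioo x y ⊆ interior I :=
  interior_maximal (Ioo_subset_Icc_self.trans (hI.out hx hy)) isOpen_Ioo

theorem IsEnd.mem_interior (hI : I.OrdConnected) (h : IsEnd b I α) {y z : ℝ}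
    (hy : y ∈ interior I) (h1 : sgn b * α < sgn b * z) (h2 : sgn b * z ≤ sgn b * y) :
    z ∈ interior I := by
  rcases eq_or_ne z y with rfl | hzy
  · exact hy
  cases b
  · simp only [sgn, cond_false, one_mul] at h1 h2
    exact Ioo_subset_interior hI h.1 (interior_subset hy) ⟨h1, lt_of_le_of_ne h2 hzy⟩
  · simp only [sgn, cond_true, neg_mul, one_mul, neg_lt_neg_iff, neg_le_neg_iff] at h1 h2
    exact Ioo_subset_interior hI (interior_subset hy) h.1 ⟨lt_of_le_of_ne h2 hzy.symm, h1⟩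

theorem mem_interior_or_isEnd (hI : I.OrdConnected) {s : ℝ} (hs : s ∈ I) :
    s ∈ interior I ∨ ∃ b, IsEnd b I s := by
  by_cases h0 : IsLeast I s
  · exact Or.inr ⟨false, isEnd_false.mpr h0⟩
  by_cases h1 : IsGreatest I s
  · exact Or.inr ⟨true, isEnd_true.mpr h1⟩
  simp only [IsLeast, IsGreatest, hs, true_and, lowerBounds, upperBounds, mem_ofPred_eq,
    not_forall, not_le] at h0 h1
  obtain ⟨x, hx, hxs⟩ := h0
  obtain ⟨y, hy, hys⟩ := h1
  exact Or.inl (Ioo_subset_interior hI hx hy ⟨hxs, hys⟩)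

end Intervals

/-! ### Reduction of upper ends to lower ends by reflection. -/

section Profile

variable {I T : Set ℝ} {φ σ f : ℝ → ℝ} {b : Bool} {α : ℝ}

theorem sgn_mul_sgn_mul (b : Bool) (t : ℝ) : sgn b * (sgn b * t) = t := by
  rw [← mul_assoc, sgn_mul_self, one_mul]

/-- The potential and the moment function at an end that belongs to `I`. -/
theorem IsEnd.exists_potential (hα : IsEnd b I α) (hI : I.OrdConnected)
    (hφ : IsMomentumProfile I φ) (hc : ClosesUp I φ) (hT0 : 0 ∈ T) (hT : T.OrdConnected)
    (hσ : ∀ t ∈ T, HasDerivAt σ (φ (σ t)) t) (hσT : σ '' T = interior I)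
    (hf : ∀ t ∈ T, HasDerivAt f (σ t) t) (hf0 : f 0 = 0) :
    ∃ D : Set ℝ, D = insert 0 ((fun t => Real.exp (2 * t)) '' {t | sgn b * t ∈ T}) ∧
      D.OrdConnected ∧ ∃ G S : ℝ → ℝ, ContDiffOn ℝ ∞ G D ∧ ContDiffOn ℝ ∞ S D ∧
        (∀ t, sgn b * t ∈ T → S (Real.exp (2 * t)) = σ (sgn b * t)) ∧ S 0 = α ∧
        (∀ t, sgn b * t ∈ T → f (sgn b * t) = sgn b * α * t + G (Real.exp (2 * t))) ∧
        0 < derivWithin G D 0 := by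
  have hsm (t : ℝ) : HasDerivAt (fun t => sgn b * t) (sgn b) t := by
    simpa using (hasDerivAt_id t).const_mul (sgn b)
  have hoc {A : Set ℝ} (hA : A.OrdConnected) : {t | sgn b * t ∈ A}.OrdConnected := by
    refine ⟨fun x hx y hy z hz => ?_⟩
    cases b
    · simp only [sgn, cond_false, one_mul, mem_ofPred_eq] at *
      exact hA.out hx hy hz
    · simp only [sgn, cond_true, neg_mul, one_mul, mem_ofPred_eq] at *
      exact hA.out hy hx ⟨neg_le_neg hz.2, neg_le_neg hz.1⟩
  have hlt : ∀ s, sgn b * s ∈ interior I → sgn b * α < s := by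
    intro s hs
    have h1 := hα.2 _ (interior_subset hs)
    rw [sgn_mul_sgn_mul] at h1
    refine lt_of_le_of_ne h1 fun h2 => hα.notMem_interior ?_
    rwa [← h2, sgn_mul_sgn_mul] at hs
  have hmem : ∀ s ∈ insert (sgn b * α) {s | sgn b * s ∈ interior I}, sgn b * s ∈ I := by
    rintro s (rfl | hs)
    · rw [sgn_mul_sgn_mul]; exact hα.1
    · exact interior_subset hs
  -- For `b = true` this reflects both variables: `-σ(-t)` solves the equation with profile `φ(-s)`,
  -- the greatest element becomes least, the slope `-2` becomes `2`, and `r` becomes `1 / r`.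
  obtain ⟨D, hD, hDc, G, τ, hG, hτ, hτσ, hτ0, hfG, hpos⟩ :=
    exists_potential_at_end (U := {s | sgn b * s ∈ interior I}) (T := {t | sgn b * t ∈ T})
      (α := sgn b * α) (φ := fun s => φ (sgn b * s)) (σ := fun t => sgn b * σ (sgn b * t))
      (f := fun t => f (sgn b * t)) (isOpen_interior.preimage (continuous_const_mul _))
      (by
        refine ⟨fun x hx y hy z hz => ?_⟩
        have hx' : sgn b * α ≤ x := by
          rcases hx with rfl | hx
          exacts [le_rfl, (hlt x hx).le]
        rcases (hx'.trans hz.1).eq_or_lt with h | h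
        · exact Or.inl h.symm
        · rcases hy with rfl | hy
          · exact absurd hz.2 (not_le.mpr h)
          · refine Or.inr (hα.mem_interior hI hy ?_ ?_)
            · rwa [sgn_mul_sgn_mul]
            · simpa only [sgn_mul_sgn_mul] using hz.2)
      hlt (hφ.smooth.comp (contDiff_const.mul contDiff_id).contDiffOn
        fun s hs => subset_closure (hmem s hs))
      (fun s hs => hφ.pos _ hs) (by simpa only [sgn_mul_sgn_mul] using (hc.of_isEnd hα).1)
      (by
        have h1 := (hc.of_isEnd hα).2
        rw [← sgn_mul_sgn_mul b α] at h1
        refine (h1.comp (sgn b * α) (hsm _).hasDerivWithinAt hmem).congr_deriv ?_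
        linear_combination 2 * sgn_mul_self b)
      (by simpa using hT0) (hoc hT)
      (fun t ht => by
        have h1 : HasDerivAt (fun t => σ (sgn b * t)) _ t := (hσ _ ht).comp t (hsm t)
        refine (h1.const_mul (sgn b)).congr_deriv ?_
        rw [sgn_mul_sgn_mul]
        linear_combination φ (σ (sgn b * t)) * sgn_mul_self b)
      (by
        ext s
        constructor
        · rintro ⟨t, ht, rfl⟩
          simp only [mem_ofPred_eq, sgn_mul_sgn_mul]
          exact hσT ▸ mem_image_of_mem σ ht
        · intro hs
          rw [mem_ofPred_eq, ← hσT] at hs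
          obtain ⟨t, ht, hts⟩ := hs
          refine ⟨sgn b * t, ?_, ?_⟩
          · rwa [mem_ofPred_eq, sgn_mul_sgn_mul]
          · simp only [sgn_mul_sgn_mul, hts])
      (fun t ht => ((hf _ ht).comp t (hsm t)).congr_deriv (mul_comm _ _)) (by simpa using hf0)
  refine ⟨D, hD, hDc, G, fun r => sgn b * τ r, hG, contDiffOn_const.mul hτ, fun t ht => ?_, ?_,
    hfG, hpos⟩
  · simp only [hτσ t ht, sgn_mul_sgn_mul]
  · simp only [hτ0, sgn_mul_sgn_mul]

end Profile

end MomentumConstruction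

end

/-! ### From a momentum profile to potential data. -/

noncomputable section

namespace MomentumConstruction

variable {I T : Set ℝ} {φ σ f : ℝ → ℝ} {b : Bool} {α : ℝ}

/-- The momentum as a function of the logarithm of the norm. -/
theorem IsMomentumProfile.exists_momentum (hφ : IsMomentumProfile I φ) (hI : I.OrdConnected)
    (hne : (interior I).Nonempty) :
    ∃ (T : Set ℝ) (σ f : ℝ → ℝ), 0 ∈ T ∧ IsOpen T ∧ T.OrdConnected ∧ ContDiffOn ℝ ∞ σ T ∧
      (∀ t ∈ T, HasDerivAt σ (φ (σ t)) t) ∧ σ '' T = interior I ∧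
      (∀ t ∈ T, HasDerivAt f (σ t) t) ∧ f 0 = 0 := by
  obtain ⟨s₀, hs₀⟩ := hne
  have hU : (interior I).OrdConnected := hI.interior
  have hφU : ContDiffOn ℝ ∞ φ (interior I) :=
    hφ.smooth.mono (interior_subset.trans subset_closure)
  -- Separation of variables: `Θ s` is the time in which `τ' = φ(τ)` leads from `s₀` to `s`, and its
  -- inverse is the solution.
  let Θ : ℝ → ℝ := fun s => ∫ u in s₀..s, (φ u)⁻¹
  have hΘ : ∀ s ∈ interior I, HasDerivWithinAt Θ (φ s)⁻¹ (interior I) s := fun s hs =>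
    hasDerivWithinAt_primitive hU (hφU.continuousOn.inv₀ fun s hs => (hφ.pos s hs).ne') hs₀ hs
  have hm := strictMonoOn_of_hasDerivWithinAt hU hΘ fun s hs => inv_pos.mpr (hφ.pos s hs)
  have hT : (Θ '' interior I).OrdConnected :=
    (hU.isPreconnected.image Θ fun s hs => (hΘ s hs).continuousWithinAt).ordConnected
  have hTo : IsOpen (Θ '' interior I) := by
    refine isOpen_iff_mem_nhds.mpr ?_
    rintro _ ⟨s, hs, rfl⟩
    obtain ⟨l, u, hlu, hlu'⟩ := mem_nhds_iff_exists_Ioo_subset.mp (isOpen_interior.mem_nhds hs)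
    have h1 : (l + s) / 2 ∈ interior I := hlu' ⟨by linarith [hlu.1], by linarith [hlu.1, hlu.2]⟩
    have h2 : (s + u) / 2 ∈ interior I := hlu' ⟨by linarith [hlu.1, hlu.2], by linarith [hlu.2]⟩
    exact Filter.mem_of_superset (Ioo_mem_nhds (hm h1 hs (by linarith [hlu.1]))
      (hm hs h2 (by linarith [hlu.2]))) (Ioo_subset_Icc_self.trans
        (hT.out (mem_image_of_mem _ h1) (mem_image_of_mem _ h2)))
  obtain ⟨σ, hσΘ, hσ, hσ'⟩ := exists_inverse hU hΘ hφ.pos hφU hTo.uniqueDiffOn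
  have hT0 : (0 : ℝ) ∈ Θ '' interior I := ⟨s₀, hs₀, intervalIntegral.integral_same⟩
  refine ⟨Θ '' interior I, σ, fun t => ∫ u in (0 : ℝ)..t, σ u, hT0, hTo, hT, hσ,
    fun t ht => (hσ' t ht).hasDerivAt (hTo.mem_nhds ht), ?_,
    fun t ht => (hasDerivWithinAt_primitive hT hσ.continuousOn hT0 ht).hasDerivAt
      (hTo.mem_nhds ht), intervalIntegral.integral_same⟩
  rw [image_image, image_congr hσΘ, image_id']

/-- Both cases are put in one form so that the data for the two ends can be chosen together. If `I`
has no end of kind `b`, then `0 ∉ D`, the logarithm is smooth on `D`, and `f` itself, as a function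
of `r` or `1 / r`, serves with `a = 0`. -/
theorem exists_end_data (hI : I.OrdConnected) (hφ : IsMomentumProfile I φ) (hc : ClosesUp I φ)
    (hT0 : 0 ∈ T) (hT : T.OrdConnected) (hσs : ContDiffOn ℝ ∞ σ T) (hfs : ContDiffOn ℝ ∞ f T)
    (hσ : ∀ t ∈ T, HasDerivAt σ (φ (σ t)) t) (hσT : σ '' T = interior I)
    (hf : ∀ t ∈ T, HasDerivAt f (σ t) t) (hf0 : f 0 = 0) (b : Bool) {D : Set ℝ}
    (hD : ∀ s, s ∈ D ↔ (∃ t, sgn b * t ∈ T ∧ Real.exp (2 * t) = s) ∨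
      s = 0 ∧ ∃ α, IsEnd b I α) :
    ∃ (a : ℝ) (G S : ℝ → ℝ), ContDiffOn ℝ ∞ G D ∧ ContDiffOn ℝ ∞ S D ∧
      (∀ t, sgn b * t ∈ T → f (sgn b * t) = a * t + G (Real.exp (2 * t))) ∧
      (∀ t, sgn b * t ∈ T → S (Real.exp (2 * t)) = σ (sgn b * t)) ∧
      ∀ α, IsEnd b I α → D.OrdConnected ∧ S 0 = α ∧ α = sgn b * a ∧ 0 < derivWithin G D 0 := by
  by_cases hb : ∃ α, IsEnd b I α
  · obtain ⟨α, hα⟩ := hb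
    have huniq : ∀ β, IsEnd b I β → β = α := by
      intro β hβ
      have := le_antisymm (hα.2 β hβ.1) (hβ.2 α hα.1)
      exact (mul_left_cancel₀ (sgn_ne_zero b) this).symm
    obtain ⟨D', hD', hoc, G, S, hG, hS, hSσ, hS0, hfG, hpos⟩ :=
      hα.exists_potential hI hφ hc hT0 hT hσ hσT hf hf0
    have hDD : D' = D := by
      ext s
      rw [hD', hD]
      simp only [mem_insert_iff, mem_image, mem_ofPred_eq, show ∃ α, IsEnd b I α from ⟨α, hα⟩,
        and_true, or_comm]
    subst hDD
    refine ⟨sgn b * α, G, S, hG, hS, hfG, hSσ, fun β hβ => ?_⟩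
    rw [huniq β hβ, sgn_mul_sgn_mul]
    exact ⟨hoc, hS0, rfl, hpos⟩
  · have hlog (t : ℝ) : sgn b * (Real.log (Real.exp (2 * t)) / 2) = sgn b * t := by
      rw [Real.log_exp, mul_div_cancel_left₀ _ two_ne_zero]
    have hmaps : MapsTo (fun r => sgn b * (Real.log r / 2)) D T := by
      intro s hs
      rcases (hD s).mp hs with ⟨t, ht, rfl⟩ | h
      · simpa only [hlog] using ht
      · exact absurd h.2 hb
    have hlogs : ContDiffOn ℝ ∞ (fun r => sgn b * (Real.log r / 2)) D := by
      refine contDiffOn_const.mul (ContDiffOn.div_const (contDiffOn_id.log fun s hs => ?_) 2)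
      rcases (hD s).mp hs with ⟨t, ht, rfl⟩ | h
      · exact (Real.exp_pos _).ne'
      · exact absurd h.2 hb
    refine ⟨0, fun r => f (sgn b * (Real.log r / 2)), fun r => σ (sgn b * (Real.log r / 2)),
      hfs.comp hlogs hmaps, hσs.comp hlogs hmaps, fun t _ => ?_, fun t _ => ?_,
      fun α hα => absurd ⟨α, hα⟩ hb⟩
    · simp only [hlog, zero_mul, zero_add]
    · simp only [hlog]

/-- Momentum profiles that close up at the ends of the momentum interval determine potentials. -/
theorem exists_potentialData (hI : I.OrdConnected) (hne : (interior I).Nonempty)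
    (hφ : IsMomentumProfile I φ) (hc : ClosesUp I φ) :
    ∃ (J : Set ℝ≥0∞) (f : ℝ → ℝ) (a : Bool → ℝ) (G S : Bool → ℝ → ℝ),
      PotentialData J I φ f a G S := by
  obtain ⟨T, σ, f, hT0, hTo, hT, hσs, hσ, hσT, hf, hf0⟩ := hφ.exists_momentum hI hne
  -- The zero section or the section at infinity is added exactly when `I` contains the
  -- corresponding end.
  set P : Bool → Prop := fun b => ∃ α, IsEnd b I α with hP
  set J := normInterval T P with hJ
  have hlog : logInterval J = T := logInterval_normInterval
  have hzero (b : Bool) : 0 ∈ sideDomain b J ↔ ∃ α, IsEnd b I α :=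
    zero_mem_sideDomain_iff.trans flip_zero_mem_normInterval
  have hside (b : Bool) (s : ℝ) : s ∈ sideDomain b J ↔
      (∃ t, sgn b * t ∈ T ∧ Real.exp (2 * t) = s) ∨ s = 0 ∧ ∃ α, IsEnd b I α := by
    rw [mem_sideDomain_iff, hlog, flip_zero_mem_normInterval]
  have hfs : ContDiffOn ℝ ∞ f T := contDiffOn_infty_of_hasDerivWithinAt hTo.uniqueDiffOn
    (fun t ht => (hf t ht).hasDerivWithinAt) hσs
  choose a G S hG hS hfG hSσ hend using fun b =>
    exists_end_data hI hφ hc hT0 hT hσs hfs hσ hσT hf hf0 b (hside b)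
  -- The domain of the potential at the end is order-connected and contains `0`, so it contains
  -- every positive value below one it contains; in logarithms, `T` is unbounded in that direction.
  have hunb : ∀ b, P b → ∀ s ∈ T, ∀ t, sgn b * t ≤ sgn b * s → t ∈ T := by
    rintro b ⟨α, hα⟩ s hs t hts
    have h1 : Real.exp (2 * (sgn b * s)) ∈ sideDomain b J :=
      (hside b _).mpr (Or.inl ⟨_, by rwa [sgn_mul_sgn_mul], rfl⟩)
    have h2 := (hend b α hα).1.out ((hzero b).mpr ⟨α, hα⟩) h1
      ⟨(Real.exp_pos (2 * (sgn b * t))).le, Real.exp_le_exp.mpr (by linarith)⟩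
    rwa [exp_mem_sideDomain, sgn_mul_sgn_mul, hlog] at h2
  have hderiv : ∀ t ∈ T, deriv f t = σ t := fun t ht => (hf t ht).deriv
  refine ⟨J, f, a, G, S, ?_⟩
  exact
    { isOpen := isOpen_normInterval hT hTo ⟨0, hT0⟩ hunb
      ordConnected := ordConnected_normInterval hT ⟨0, hT0⟩ hunb
      smooth := by rwa [hlog]
      smooth_potential := hG
      smooth_moment := hS
      potential_eq := fun b t ht => hfG b t (by rwa [hlog] at ht)
      moment_eq := fun b t ht => by
        rw [hlog] at ht
        rw [hderiv _ ht, hSσ b t ht]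
      moment_zero := fun b hb => by
        obtain ⟨α, hα⟩ := (hzero b).mp hb
        rw [(hend b α hα).2.1, (hend b α hα).2.2.1]
      deriv_pos := fun b hb => by
        obtain ⟨α, hα⟩ := (hzero b).mp hb
        exact (hend b α hα).2.2.2
      profile := fun t ht => by
        rw [hlog] at ht
        have h1 : σ t ∈ interior I := hσT ▸ mem_image_of_mem σ ht
        have h2 : deriv f =ᶠ[𝓝 t] σ := Filter.eventually_of_mem (hTo.mem_nhds ht) hderiv
        rw [hderiv t ht, h2.deriv_eq, (hσ t ht).deriv]
        exact ⟨interior_subset h1, hφ.pos _ h1, rfl⟩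
      profile_zero := fun b hb => by
        obtain ⟨α, hα⟩ := (hzero b).mp hb
        rw [(hend b α hα).2.1]
        exact ⟨hα.1, (hc.of_isEnd hα).1⟩
      surj := fun s hs => by
        rcases mem_interior_or_isEnd hI hs with h | ⟨b, h⟩
        · rw [← hσT] at h
          obtain ⟨t, ht, rfl⟩ := h
          exact Or.inl ⟨t, by rwa [hlog], hderiv t ht⟩
        · exact Or.inr ⟨b, (hzero b).mpr ⟨s, h⟩, (hend b s h).2.1⟩ }

end MomentumConstruction

end

noncomputable section

namespace MomentumConstruction

/-! ### The differential equation satisfied by any momentum metric. -/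

section Uniqueness

variable {E : Type*} [NormedAddCommGroup E] [NormedSpace ℂ E]
  {M : Type*} [TopologicalSpace M] [ChartedSpace E M] [IsManifold 𝓘(ℂ, E) ω M]
  {L : M → Type*} [∀ x, AddCommGroup (L x)] [∀ x, Module ℂ (L x)]
  [TopologicalSpace (TotalSpace ℂ L)] [∀ x, TopologicalSpace (L x)]
  [FiberBundle ℂ L] [VectorBundle ℂ ℂ L] [ContMDiffVectorBundle ω ℂ L 𝓘(ℂ, E)]
  {h : HermitianMetric E L}
  {J : Set ℝ≥0∞} {I : Set ℝ} {φ f : ℝ → ℝ} {τ : Completion E L → ℝ}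
  {Ω : Form (E × ℂ) (Completion E L) 2}

theorem subbundle_mem_nhds (hJo : IsOpen J) {p : Completion E L} (hp : p ∈ h.subbundle J) :
    h.subbundle J ∈ 𝓝 p := by
  have hs := chart_symm_chart p
  have h1 := eventually_mem_subbundle (h := h) (b := side p) hJo (chart_mem_region p)
    (hs.symm ▸ hp)
  have hps := mem_chart_source (E × ℂ) p
  filter_upwards [((chartAt (E × ℂ) p).continuousAt hps).eventually h1,
    (chartAt (E × ℂ) p).open_source.mem_nhds hps] with z hz hz'
  have h2 := hz.2
  rwa [← chartAt_eq, (chartAt (E × ℂ) p).left_inv hz'] at h2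

theorem logNorm_eq_sgn_mul {b : Bool} {x₀ : M} {q : E × ℂ} (hq : q.1 ∈ region E L x₀)
    (h0 : q.2 ≠ 0) : h.logNorm ((stdChart E L b x₀).symm q) =
      sgn b * modelLog (frameNorm h b x₀) q := by
  rw [modelLog_eq h hq h0, sgn_mul_sgn_mul]

theorem hasFDerivAt_comp_logNorm {u : ℝ → ℝ} {p : Completion E L}
    (h0 : p ∈ puncturedBundle E L) (hu : DifferentiableAt ℝ u (h.logNorm p)) :
    HasFDerivAt (fun y => u (h.logNorm ((chartAt (E × ℂ) p).symm y)))
      (deriv u (h.logNorm p) • (sgn (side p) •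
        fderiv ℝ (modelLog (frameNorm h (side p) p.base)) (chartAt (E × ℂ) p p)))
      (chartAt (E × ℂ) p p) := by
  have hq := chart_mem_region p
  have hq2 := (mem_punctured_iff_chart p).mp h0
  have hs := chart_symm_chart p
  have hlog := logNorm_eq_sgn_mul (h := h) (b := side p) hq hq2
  rw [hs] at hlog
  have hl := (contDiffAt_modelLog (contDiffAt_frameNorm h (side p) hq)
    (frameNorm_pos h (side p) hq) hq2).differentiableAt (by simp)
  rw [hlog] at hu ⊢
  refine (hu.hasDerivAt.comp_hasFDerivAt
    (f := fun y => sgn (side p) * modelLog (frameNorm h (side p) p.base) y) _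
    (hl.hasFDerivAt.const_mul (sgn (side p)))).congr_of_eventuallyEq ?_
  filter_upwards [continuous_fst.continuousAt ((isOpen_region p.base).mem_nhds hq),
    continuous_snd.continuousAt (isOpen_ne.mem_nhds hq2)] with z hz hz0
  rw [chartAt_eq, logNorm_eq_sgn_mul hz hz0]
  rfl

theorem logNorm_mem_of_punctured {p : Completion E L} (h0 : p ∈ puncturedBundle E L) :
    p ∈ h.subbundle J ↔ h.logNorm p ∈ logInterval J := by
  have := logNorm_mem_logInterval h (b := side p) (chart_mem_region p)
    ((mem_punctured_iff_chart p).mp h0) (J := J)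
  rwa [chart_symm_chart] at this

theorem isOpen_puncturedBundle : IsOpen (puncturedBundle E L) := by
  refine isOpen_iff_mem_nhds.mpr fun p hp => ?_
  have hq2 := (mem_punctured_iff_chart p).mp hp
  have hps := mem_chart_source (E × ℂ) p
  have hq := chart_mem_region p
  filter_upwards [((chartAt (E × ℂ) p).continuousAt hps).eventually
      (continuous_snd.continuousAt (isOpen_ne.mem_nhds hq2)),
    ((chartAt (E × ℂ) p).continuousAt hps).eventually
      (continuous_fst.continuousAt ((isOpen_region p.base).mem_nhds hq)),
    (chartAt (E × ℂ) p).open_source.mem_nhds hps] with z hz hz1 hz2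
  rw [← (chartAt (E × ℂ) p).left_inv hz2]
  rw [chartAt_eq] at hz hz1 ⊢
  exact (stdChart_symm_mem_punctured hz1).mpr hz

/-- A bundle-adapted Kähler form with potential `f` and moment map `τ`. -/
structure IsAdapted (h : HermitianMetric E L) (I : Set ℝ) (φ : ℝ → ℝ) (J : Set ℝ≥0∞)
    (Ω : Form (E × ℂ) (Completion E L) 2) (f : ℝ → ℝ) (τ : Completion E L → ℝ) : Prop where
  isOpen : IsOpen J
  ordConnected : J.OrdConnected
  positive : IsPositiveOn Ω (h.subbundle J)
  smooth : ContDiffOn ℝ ∞ f (logInterval J)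
  momentMap : IsMomentMap Ω circleField (h.subbundle J) τ
  moment_eq : ∀ p ∈ h.subbundle J ∩ puncturedBundle E L, τ p = deriv f (h.logNorm p)
  image : τ '' h.subbundle J = I
  metric : ∀ p ∈ h.subbundle J, kahlerMetric Ω p (circleField p) (circleField p) = φ (τ p)

namespace IsAdapted

theorem contMDiffAt (hA : IsAdapted h I φ J Ω f τ) {p : Completion E L}
    (hp : p ∈ h.subbundle J) : ContMDiffAt 𝓘(ℝ, E × ℂ) 𝓘(ℝ, ℝ) ∞ τ p :=
  hA.momentMap.smooth.contMDiffAt (subbundle_mem_nhds hA.isOpen hp)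

theorem contDiffAt (hA : IsAdapted h I φ J Ω f τ) {t : ℝ} (ht : t ∈ logInterval J) :
    ContDiffAt ℝ ∞ f t :=
  hA.smooth.contDiffAt ((isOpen_logInterval hA.isOpen).mem_nhds ht)

theorem differentiableAt (hA : IsAdapted h I φ J Ω f τ) {t : ℝ} (ht : t ∈ logInterval J) :
    DifferentiableAt ℝ (deriv f) t :=
  differentiableAt_deriv ((hA.contDiffAt ht).of_le two_le_infty)

theorem circleField_ne_zero {p : Completion E L} (h0 : p ∈ puncturedBundle E L) :
    circleField p ≠ 0 := by
  intro hX
  have := congrArg Prod.snd ((circleField_eq p).symm.trans hX)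
  simp [sgn_ne_zero, (mem_punctured_iff_chart p).mp h0] at this

theorem profile_pos (hA : IsAdapted h I φ J Ω f τ) {p : Completion E L}
    (hp : p ∈ h.subbundle J) (h0 : p ∈ puncturedBundle E L) : 0 < φ (τ p) := by
  rw [← hA.metric p hp]
  exact hA.positive p hp _ (circleField_ne_zero h0)

theorem profile_zero (hA : IsAdapted h I φ J Ω f τ) {p : Completion E L}
    (hp : p ∈ h.subbundle J) (h0 : p ∉ puncturedBundle E L) : φ (τ p) = 0 := by
  rw [← hA.metric p hp, circleField_eq_zero h0]
  exact ContinuousAlternatingMap.map_coord_zero _ 0 rfl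

/-- Evaluating `i_X ω = -dτ` on `J X` gives `g(X, X) = -dτ(J X)`, and `J X` decreases `t` at unit
speed. Only the moment map is used, not the formula for the form. -/
theorem deriv_deriv_eq (hA : IsAdapted h I φ J Ω f τ) {p : Completion E L}
    (hp : p ∈ h.subbundle J) (h0 : p ∈ puncturedBundle E L) :
    deriv (deriv f) (h.logNorm p) = φ (τ p) := by
  have h1 := hA.momentMap.contraction p hp (Complex.I • circleField p)
  have h2 := hA.metric p hp
  have hT := (logNorm_mem_of_punctured h0).mp hp
  have h3 : (fun y => chartAt ℝ (τ p) (τ ((chartAt (E × ℂ) p).symm y))) =ᶠ[𝓝 (chartAt (E × ℂ) p p)]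
      fun y => deriv f (h.logNorm ((chartAt (E × ℂ) p).symm y)) := by
    have hps := mem_chart_target (E × ℂ) p
    have hc := (chartAt (E × ℂ) p).continuousAt_symm hps
    rw [ContinuousAt, (chartAt (E × ℂ) p).left_inv (mem_chart_source _ p)] at hc
    filter_upwards [hc (subbundle_mem_nhds hA.isOpen hp),
      hc (isOpen_puncturedBundle.mem_nhds h0)] with y hy hy'
    exact hA.moment_eq _ ⟨hy, hy'⟩
  rw [differential_eq ((hA.contMDiffAt hp).mdifferentiableAt (by simp)), h3.fderiv_eq,
    (hasFDerivAt_comp_logNorm h0 (hA.differentiableAt hT)).fderiv] at h1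
  simp only [_root_.smul_apply, smul_eq_mul, (fderiv_modelLog_circleField h h0).2] at h1
  rw [← h2]
  refine Eq.trans ?_ h1.symm
  linear_combination (-(deriv (deriv f) (h.logNorm p))) * sgn_mul_self (side p)

variable [Nonempty M]

theorem momentum (hA : IsAdapted h I φ J Ω f τ) {t : ℝ} (ht : t ∈ logInterval J) :
    deriv f t ∈ I ∧ 0 < φ (deriv f t) ∧ HasDerivAt (deriv f) (φ (deriv f t)) t := by
  obtain ⟨p, ⟨hp, h0⟩, rfl⟩ := exists_logNorm_eq h t J ht
  have h1 := hA.moment_eq p ⟨hp, h0⟩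
  refine ⟨?_, h1 ▸ hA.profile_pos hp h0, ?_⟩
  · rw [← h1, ← hA.image]
    exact mem_image_of_mem τ hp
  · rw [← h1, ← hA.deriv_deriv_eq hp h0]
    exact (hA.differentiableAt ht).hasDerivAt

theorem ordConnected_logInterval (hA : IsAdapted h I φ J Ω f τ) :
    (logInterval J).OrdConnected :=
  ⟨fun _ hx _ hy _ hz => hA.ordConnected.out hx hy
    ⟨ofReal_exp_le_iff.mpr hz.1, ofReal_exp_le_iff.mpr hz.2⟩⟩

theorem strictMonoOn (hA : IsAdapted h I φ J Ω f τ) : StrictMonoOn (deriv f) (logInterval J) :=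
  strictMonoOn_of_hasDerivWithinAt hA.ordConnected_logInterval
    (fun _ ht => (hA.momentum ht).2.2.hasDerivWithinAt) fun _ ht => (hA.momentum ht).2.1

/-- Since `φ(τ) = g(X, X)` is positive off the sections and zero on them, `φ` detects which momentum
values come from the punctured bundle. The image thus depends on `I` and `φ` alone and is the same
for any two momentum metrics. -/
theorem image_logInterval (hA : IsAdapted h I φ J Ω f τ) :
    deriv f '' logInterval J = I ∩ {s | 0 < φ s} := by
  refine Subset.antisymm ?_ ?_
  · rintro _ ⟨t, ht, rfl⟩
    exact ⟨(hA.momentum ht).1, (hA.momentum ht).2.1⟩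
  · rintro s ⟨hs, hs0⟩
    rw [← hA.image] at hs
    obtain ⟨p, hp, rfl⟩ := hs
    have h0 : p ∈ puncturedBundle E L := by
      by_contra h0
      exact (hA.profile_zero hp h0).not_gt hs0
    exact ⟨h.logNorm p, (logNorm_mem_of_punctured h0).mp hp, (hA.moment_eq p ⟨hp, h0⟩).symm⟩

end IsAdapted

end Uniqueness

/-- Solutions of `σ' = φ(σ)` with the same image differ by a translation. -/
theorem exists_translation {T₁ T₂ : Set ℝ} {σ₁ σ₂ φ : ℝ → ℝ}
    (hT₁ : T₁.OrdConnected) (hT₂ : T₂.OrdConnected) (hT₂o : IsOpen T₂) (hne : T₁.Nonempty)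
    (h₁ : ∀ t ∈ T₁, HasDerivAt σ₁ (φ (σ₁ t)) t) (h₂ : ∀ t ∈ T₂, HasDerivAt σ₂ (φ (σ₂ t)) t)
    (hpos : ∀ t ∈ T₂, 0 < φ (σ₂ t)) (hσ₂ : ContDiffOn ℝ ∞ σ₂ T₂) (him : σ₁ '' T₁ = σ₂ '' T₂)
    (hu : UniqueDiffOn ℝ (σ₂ '' T₂)) :
    ∃ c : ℝ, (∀ t, t ∈ T₁ ↔ t + c ∈ T₂) ∧ ∀ t ∈ T₁, σ₂ (t + c) = σ₁ t := by
  have hm := strictMonoOn_of_hasDerivWithinAt hT₂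
    (fun t ht => (h₂ t ht).hasDerivWithinAt) hpos
  -- No smoothness of `φ` is assumed here; `φ ∘ σ₂` is smooth because it is the derivative of `σ₂`.
  have hB : ContDiffOn ℝ ∞ (fun t => (φ (σ₂ t))⁻¹) T₂ := by
    refine ContDiffOn.inv ?_ fun t ht => (hpos t ht).ne'
    exact ((contDiffOn_infty_iff_derivWithin hT₂o.uniqueDiffOn).mp hσ₂).2.congr fun t ht =>
      ((h₂ t ht).hasDerivWithinAt.derivWithin (hT₂o.uniqueDiffOn t ht)).symm
  obtain ⟨g, hg, -, hg'⟩ := exists_inverse hT₂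
    (fun t ht => by simpa using (h₂ t ht).hasDerivWithinAt)
    (fun t ht => inv_pos.mpr (hpos t ht)) hB hu
  have hmem : ∀ t ∈ T₁, σ₁ t ∈ σ₂ '' T₂ := fun t ht => him ▸ mem_image_of_mem σ₁ ht
  have hgm : ∀ y ∈ σ₂ '' T₂, g y ∈ T₂ ∧ σ₂ (g y) = y := by
    rintro _ ⟨t, ht, rfl⟩
    rw [hg t ht]
    exact ⟨ht, rfl⟩
  -- `g` inverts `σ₂`, so `σ₂⁻¹ ∘ σ₁` has derivative `φ⁻¹ φ = 1`.
  have hd : ∀ t ∈ T₁, HasDerivWithinAt (fun t => g (σ₁ t) - t) 0 T₁ t := by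
    intro t ht
    obtain ⟨h3, h4⟩ := hgm _ (hmem t ht)
    have h5 := (hg' _ (hmem t ht)).comp t (h₁ t ht).hasDerivWithinAt hmem
    refine (h5.sub (hasDerivWithinAt_id t T₁)).congr_deriv ?_
    have := hpos _ h3
    rw [h4] at this ⊢
    rw [inv_mul_cancel₀ this.ne', sub_self]
  obtain ⟨t₁, ht₁⟩ := hne
  have hc : ∀ t ∈ T₁, g (σ₁ t) = t + (g (σ₁ t₁) - t₁) := fun t ht => by
    have := eq_of_hasDerivWithinAt_zero hT₁ hd ht ht₁
    linarith
  have hσ : ∀ t ∈ T₁, t + (g (σ₁ t₁) - t₁) ∈ T₂ ∧ σ₂ (t + (g (σ₁ t₁) - t₁)) = σ₁ t :=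
    fun t ht => by
      rw [← hc t ht]
      exact hgm _ (hmem t ht)
  refine ⟨g (σ₁ t₁) - t₁, fun t => ⟨fun ht => (hσ t ht).1, fun ht => ?_⟩, fun t ht => (hσ t ht).2⟩
  obtain ⟨t', ht', h6⟩ : σ₂ (t + (g (σ₁ t₁) - t₁)) ∈ σ₁ '' T₁ := him ▸ mem_image_of_mem σ₂ ht
  have h7 := hm.injOn (hσ t' ht').1 ht ((hσ t' ht').2.trans h6)
  rwa [add_right_cancel h7] at ht'

end MomentumConstruction

end

noncomputable section

namespace MomentumConstruction

/-! ### The two sections correspond to the ends of the momentum interval. -/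

section Ends

variable {E : Type*} [NormedAddCommGroup E] [NormedSpace ℂ E]
  {M : Type*} [TopologicalSpace M] [ChartedSpace E M] [IsManifold 𝓘(ℂ, E) ω M]
  {L : M → Type*} [∀ x, AddCommGroup (L x)] [∀ x, Module ℂ (L x)]
  [TopologicalSpace (TotalSpace ℂ L)] [∀ x, TopologicalSpace (L x)]
  [FiberBundle ℂ L] [VectorBundle ℂ ℂ L] [ContMDiffVectorBundle ω ℂ L 𝓘(ℂ, E)]
  {h : HermitianMetric E L}
  {J : Set ℝ≥0∞} {I : Set ℝ} {φ f : ℝ → ℝ} {τ : Completion E L → ℝ}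
  {Ω : Form (E × ℂ) (Completion E L) 2}

theorem extNormSq_of_notMem_punctured {p : Completion E L} (h0 : p ∉ puncturedBundle E L) :
    h.extNormSq p = flip (side p) 0 := by
  obtain ⟨x, v⟩ := p
  rw [puncturedBundle_iff] at h0
  induction v using OnePoint.rec with
  | infty => simp [HermitianMetric.extNormSq, side, flip]
  | coe v =>
    obtain rfl : v = 0 := by simpa using h0
    simp [HermitianMetric.extNormSq, side, flip, h.normSq_zero]

theorem pole_notMem_punctured (b : Bool) (x : M) : pole E L b x ∉ puncturedBundle E L := by
  rw [puncturedBundle_iff]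
  cases b
  · exact fun h => h.2 rfl
  · exact fun h => h.1 rfl

theorem side_pole (b : Bool) (x : M) : side (pole E L b x) = b := by
  cases b <;> rfl

theorem exists_modelLog_eq {K : E → ℝ} (z : E) (u : ℝ) :
    modelLog K (z, (Real.exp (u - (1 / 2) * Real.log (K z)) : ℝ)) = u := by
  simp [modelLog, Complex.norm_exp]

namespace IsAdapted

/-- The moment map at the ends is a limit of its values on the punctured bundle. -/
theorem tendsto_momentum (hA : IsAdapted h I φ J Ω f τ) {p : Completion E L}
    (hp : p ∈ h.subbundle J) (h0 : p ∉ puncturedBundle E L) :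
    (∀ᶠ u in Filter.atBot, sgn (side p) * u ∈ logInterval J) ∧
      Filter.Tendsto (fun u => deriv f (sgn (side p) * u)) Filter.atBot (𝓝 (τ p)) := by
  set K := frameNorm h (side p) p.base with hK
  set z := (chartAt (E × ℂ) p p).1 with hz
  have hq : z ∈ region E L p.base := chart_mem_region p
  -- A radial path in one fibre, parametrized by the logarithm `u` of the norm on the side of `p`;
  -- it tends to `p` as `u → -∞`.
  let γ : ℝ → E × ℂ := fun u => (z, (Real.exp (u - (1 / 2) * Real.log (K z)) : ℝ))
  have hγ2 (u : ℝ) : (γ u).2 ≠ 0 := by simp [γ]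
  have hγ : Filter.Tendsto γ Filter.atBot (𝓝 (chartAt (E × ℂ) p p)) := by
    have hq2 : (chartAt (E × ℂ) p p).2 = 0 := by
      simpa using (mem_punctured_iff_chart p).not.mp h0
    rw [← Prod.mk.eta (p := chartAt (E × ℂ) p p), hq2, ← Complex.ofReal_zero]
    refine tendsto_const_nhds.prodMk_nhds
      ((Complex.continuous_ofReal.tendsto 0).comp (Real.tendsto_exp_atBot.comp ?_))
    exact Filter.tendsto_atBot_add_const_right _ _ Filter.tendsto_id
  have hc := (chartAt (E × ℂ) p).continuousAt_symm (mem_chart_target (E × ℂ) p)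
  rw [ContinuousAt, (chartAt (E × ℂ) p).left_inv (mem_chart_source _ p)] at hc
  have hlim := hc.comp hγ
  have hlog (u : ℝ) : h.logNorm ((chartAt (E × ℂ) p).symm (γ u)) = sgn (side p) * u := by
    rw [chartAt_eq, logNorm_eq_sgn_mul (q := γ u) hq (hγ2 u), exists_modelLog_eq]
  have hpun (u : ℝ) : (chartAt (E × ℂ) p).symm (γ u) ∈ puncturedBundle E L := by
    rw [chartAt_eq]
    exact (stdChart_symm_mem_punctured (q := γ u) hq).mpr (hγ2 u)
  have hmem := hlim.eventually (subbundle_mem_nhds hA.isOpen hp)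
  constructor
  · filter_upwards [hmem] with u hu
    rw [← hlog u]
    exact (logNorm_mem_of_punctured (hpun u)).mp hu
  · refine ((hA.contMDiffAt hp).continuousAt.tendsto.comp hlim).congr' ?_
    filter_upwards [hmem] with u hu
    rw [← hlog u]
    exact hA.moment_eq _ ⟨hu, hpun u⟩

variable [Nonempty M]

/-- The momentum on a section is the limit of `f'` at that end, and `f'` is strictly increasing, so
the limit lies strictly beyond every value of `f'`. -/
theorem lt_momentum (hA : IsAdapted h I φ J Ω f τ) {p : Completion E L}
    (hp : p ∈ h.subbundle J) (h0 : p ∉ puncturedBundle E L) {t : ℝ} (ht : t ∈ logInterval J) :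
    sgn (side p) * τ p < sgn (side p) * deriv f t := by
  obtain ⟨hev, hlim⟩ := hA.tendsto_momentum hp h0
  have hm {u v : ℝ} (hu : sgn (side p) * u ∈ logInterval J)
      (hv : sgn (side p) * v ∈ logInterval J) (huv : u < v) :
      sgn (side p) * deriv f (sgn (side p) * u) < sgn (side p) * deriv f (sgn (side p) * v) := by
    have := hA.strictMonoOn
    cases hb : side p
    · simp only [hb, sgn, cond_false, one_mul] at *
      exact this hu hv huv
    · simp only [hb, sgn, cond_true, neg_mul, one_mul, neg_lt_neg_iff] at *
      exact this hv hu (neg_lt_neg huv)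
  rw [← sgn_mul_sgn_mul (side p) t] at ht ⊢
  obtain ⟨v, hv, hvt⟩ := (hev.and (Filter.eventually_lt_atBot (sgn (side p) * t))).exists
  refine lt_of_le_of_lt ?_ (hm hv ht hvt)
  refine le_of_tendsto (hlim.const_mul (sgn (side p))) ?_
  filter_upwards [hev, Filter.eventually_lt_atBot v] with u hu huv
  exact (hm hu hv huv).le

/-- Against points off the sections this is `lt_momentum`. Points of the same section share the
limiting value, and the other section lies on the far side of every value of `f'`. -/
theorem isEnd (hA : IsAdapted h I φ J Ω f τ) (hne : (logInterval J).Nonempty)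
    {p : Completion E L} (hp : p ∈ h.subbundle J) (h0 : p ∉ puncturedBundle E L) :
    IsEnd (side p) I (τ p) := by
  refine ⟨hA.image ▸ mem_image_of_mem τ hp, fun s hs => ?_⟩
  rw [← hA.image] at hs
  obtain ⟨p', hp', rfl⟩ := hs
  by_cases h0' : p' ∈ puncturedBundle E L
  · rw [hA.moment_eq p' ⟨hp', h0'⟩]
    exact (hA.lt_momentum hp h0 ((logNorm_mem_of_punctured h0').mp hp')).le
  · by_cases hb : side p' = side p
    · have h1 := (hA.tendsto_momentum hp' h0').2
      rw [hb] at h1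
      rw [tendsto_nhds_unique h1 (hA.tendsto_momentum hp h0).2]
    · obtain ⟨t, ht⟩ := hne
      have h1 := hA.lt_momentum hp h0 ht
      have h2 := hA.lt_momentum hp' h0' ht
      have h3 : sgn (side p') = -sgn (side p) := by
        cases h : side p <;> cases h' : side p' <;> simp_all [sgn]
      rw [h3] at h2
      linarith

/-- The right-hand side does not involve the metric, so any two momentum metrics contain the same
sections. An end of `I` that belongs to `I` has `φ = 0` there, so its value cannot be taken off the
sections; `lt_momentum` excludes the wrong section. -/
theorem flip_zero_mem_iff (hA : IsAdapted h I φ J Ω f τ) (hc : ClosesUp I φ)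
    (hne : (logInterval J).Nonempty) (b : Bool) :
    flip b 0 ∈ J ↔ ∃ α, IsEnd b I α := by
  constructor
  · intro hb
    obtain ⟨x⟩ := ‹Nonempty M›
    have h0 := pole_notMem_punctured (E := E) (L := L) b x
    have hp : pole E L b x ∈ h.subbundle J := by
      rw [HermitianMetric.subbundle, mem_preimage, extNormSq_of_notMem_punctured h0, side_pole]
      exact hb
    have := hA.isEnd hne hp h0
    rw [side_pole] at this
    exact ⟨_, this⟩
  · rintro ⟨α, hα⟩
    have h1 := hα.1
    rw [← hA.image] at h1
    obtain ⟨p, hp, rfl⟩ := h1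
    have h0 : p ∉ puncturedBundle E L := fun h0 =>
      (hA.profile_pos hp h0).ne' (hc.of_isEnd hα).1
    have hb : side p = b := by
      obtain ⟨t, ht⟩ := hne
      have h1 := hA.lt_momentum hp h0 ht
      have h2 := hα.2 _ (hA.momentum ht).1
      by_contra hb
      have h3 : sgn b = -sgn (side p) := by
        cases h : side p <;> cases b <;> simp_all [sgn]
      rw [h3] at h2
      linarith
    rwa [HermitianMetric.subbundle, mem_preimage, extNormSq_of_notMem_punctured h0, hb] at hp

end IsAdapted

end Ends

/-! ### Homotheties in charts and their effect on the norm. -/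

section Scale

variable {E : Type*} [NormedAddCommGroup E] [NormedSpace ℂ E]
  {M : Type*} [TopologicalSpace M] [ChartedSpace E M] [IsManifold 𝓘(ℂ, E) ω M]
  {L : M → Type*} [∀ x, AddCommGroup (L x)] [∀ x, Module ℂ (L x)]
  [TopologicalSpace (TotalSpace ℂ L)] [∀ x, TopologicalSpace (L x)]
  [FiberBundle ℂ L] [VectorBundle ℂ ℂ L] [ContMDiffVectorBundle ω ℂ L 𝓘(ℂ, E)]
  {h : HermitianMetric E L} {c : ℂ}

theorem side_scale (c : ℂ) (p : Completion E L) : side (scale c p) = side p := by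
  obtain ⟨x, v⟩ := p
  induction v using OnePoint.rec <;> rfl

theorem chartAt_scale (c : ℂ) (p : Completion E L) :
    chartAt (E × ℂ) (scale c p) = chartAt (E × ℂ) p := by
  rw [chartAt_eq, chartAt_eq, side_scale]
  rfl

theorem scale_scale (c d : ℂ) (p : Completion E L) : scale c (scale d p) = scale (c * d) p := by
  obtain ⟨x, v⟩ := p
  induction v using OnePoint.rec with
  | infty => rfl
  | coe v =>
    simp only [scale, OnePoint.map_some, mul_smul]
    rfl

theorem scale_one (p : Completion E L) : scale 1 p = p := by
  obtain ⟨x, v⟩ := p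
  induction v using OnePoint.rec with
  | infty => rfl
  | coe v => simp only [scale, OnePoint.map_some, one_smul]

/-- Multiplication by `d` in the last factor. -/
def scaleCLM (E : Type*) [NormedAddCommGroup E] [NormedSpace ℂ E] (d : ℂ) :
    (E × ℂ) →L[ℂ] (E × ℂ) :=
  (ContinuousLinearMap.fst ℂ E ℂ).prod (d • ContinuousLinearMap.snd ℂ E ℂ)

@[simp]
theorem scaleCLM_apply (d : ℂ) (q : E × ℂ) : scaleCLM E d q = (q.1, d * q.2) := rfl

theorem scale_chart_symm (hc : c ≠ 0) {b : Bool} {x₀ : M} {q : E × ℂ}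
    (hq : q.1 ∈ region E L x₀) : scale c ((stdChart E L b x₀).symm q) =
      (stdChart E L b x₀).symm (scaleCLM E (flip b c) q) :=
  scale_stdChart_symm hq hc

theorem chart_scale (hc : c ≠ 0) (p : Completion E L) :
    chartAt (E × ℂ) p (scale c p) = scaleCLM E (flip (side p) c) (chartAt (E × ℂ) p p) := by
  have hq := chart_mem_region p
  conv_lhs => rw [← chart_symm_chart p]
  rw [scale_chart_symm hc hq, chart_symm_chart, chartAt_eq]
  refine stdChart_right_inv ?_
  rw [← chartAt_eq]
  exact hq

theorem eventually_scale_eq (hc : c ≠ 0) (p : Completion E L) :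
    scale c =ᶠ[𝓝 p] fun z => (chartAt (E × ℂ) p).symm
      (scaleCLM E (flip (side p) c) (chartAt (E × ℂ) p z)) := by
  filter_upwards [(chartAt (E × ℂ) p).open_source.mem_nhds (mem_chart_source _ p)] with z hz
  have hz1 : (chartAt (E × ℂ) p z).1 ∈ region E L p.base := by
    rw [chartAt_eq] at hz ⊢
    exact stdChart_mem_region hz
  conv_lhs => rw [← (chartAt (E × ℂ) p).left_inv hz]
  rw [chartAt_eq] at hz1 ⊢
  exact scale_chart_symm hc hz1

theorem scaleCLM_chart_mem_target (d : ℂ) (p : Completion E L) :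
    scaleCLM E d (chartAt (E × ℂ) p p) ∈ (chartAt (E × ℂ) p).target := by
  rw [chartAt_eq p, mem_stdChart_target, ← chartAt_eq]
  exact chart_mem_region p

theorem mdifferentiableAt_scale (hc : c ≠ 0) (p : Completion E L) :
    MDifferentiableAt 𝓘(ℝ, E × ℂ) 𝓘(ℝ, E × ℂ) (scale (E := E) (L := L) c) p := by
  refine MDifferentiableAt.congr_of_eventuallyEq ?_ (eventually_scale_eq hc p)
  have h1 := mdifferentiableAt_chart (F := E × ℂ) p (mem_chart_source _ p)
  have h2 : MDifferentiableAt 𝓘(ℝ, E × ℂ) 𝓘(ℝ, E × ℂ) (scaleCLM E (flip (side p) c))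
      (chartAt (E × ℂ) p p) :=
    ((scaleCLM E (flip (side p) c)).restrictScalars ℝ).differentiableAt.mdifferentiableAt
  exact (mdifferentiableAt_chart_symm (F := E × ℂ) p (scaleCLM_chart_mem_target _ p)).comp p
    (h2.comp p h1)

theorem differential_scale (hc : c ≠ 0) (p : Completion E L) :
    differential (E × ℂ) (E × ℂ) (scale (E := E) (L := L) c) p =
      (scaleCLM E (flip (side p) c)).restrictScalars ℝ := by
  rw [differential_eq (mdifferentiableAt_scale hc p), chartAt_scale]
  have : (fun y => chartAt (E × ℂ) p (scale c ((chartAt (E × ℂ) p).symm y)))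
      =ᶠ[𝓝 (chartAt (E × ℂ) p p)] (scaleCLM E (flip (side p) c)).restrictScalars ℝ := by
    filter_upwards [continuous_fst.continuousAt
      ((isOpen_region p.base).mem_nhds (chart_mem_region p))] with z hz
    rw [chartAt_eq, scale_chart_symm hc hz]
    exact stdChart_right_inv hz
  rw [this.fderiv_eq, ContinuousLinearMap.fderiv]

theorem scale_mem_punctured (hc : c ≠ 0) {p : Completion E L} :
    scale c p ∈ puncturedBundle E L ↔ p ∈ puncturedBundle E L := by
  rw [mem_punctured_iff_chart, mem_punctured_iff_chart, chartAt_scale, chart_scale hc]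
  simp [flip]
  cases side p <;> simp [hc]

theorem logNorm_scale (hc : c ≠ 0) {p : Completion E L} (h0 : p ∈ puncturedBundle E L) :
    h.logNorm (scale c p) = h.logNorm p + Real.log ‖c‖ := by
  have hq := chart_mem_region p
  have hq2 := (mem_punctured_iff_chart p).mp h0
  have hs := chart_symm_chart p
  have hc' : flip (side p) c ≠ 0 := by cases side p <;> simp [flip, hc]
  have e1 : h.logNorm p = sgn (side p) * modelLog (frameNorm h (side p) p.base)
      (chartAt (E × ℂ) p p) := by
    have := logNorm_eq_sgn_mul (h := h) (b := side p) hq hq2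
    rwa [hs] at this
  have e2 : scale c p = (stdChart E L (side p) p.base).symm
      (scaleCLM E (flip (side p) c) (chartAt (E × ℂ) p p)) := by
    rw [← scale_chart_symm hc hq, hs]
  rw [e2, e1, logNorm_eq_sgn_mul]
  · simp only [modelLog, scaleCLM_apply, norm_mul]
    rw [Real.log_mul (norm_ne_zero_iff.mpr hc') (norm_ne_zero_iff.mpr hq2)]
    cases side p
    · simp [flip, sgn]; ring
    · simp [flip, sgn]; ring
  · exact hq
  · exact mul_ne_zero hc' hq2

end Scale

end MomentumConstruction

end

noncomputable section

namespace MomentumConstruction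

theorem flatDdc_add_const {F : Type*} [NormedAddCommGroup F] [NormedSpace ℂ F] [NormedSpace ℝ F]
    [IsScalarTower ℝ ℂ F] (u : F → ℝ) (k : ℝ) (y : F) :
    flatDdc (fun z => u z + k) y = flatDdc u y := by
  have : flatDc (fun z => u z + k) = flatDc u := by
    ext1 z
    simp [flatDc]
  simp [flatDdc, this]

/-! ### The homothety between two momentum metrics is an isometry. -/

section Isometry

variable {E : Type*} [NormedAddCommGroup E] [NormedSpace ℂ E]
  {M : Type*} [TopologicalSpace M] [ChartedSpace E M] [IsManifold 𝓘(ℂ, E) ω M]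
  {L : M → Type*} [∀ x, AddCommGroup (L x)] [∀ x, Module ℂ (L x)]
  [TopologicalSpace (TotalSpace ℂ L)] [∀ x, TopologicalSpace (L x)]
  [FiberBundle ℂ L] [VectorBundle ℂ ℂ L] [ContMDiffVectorBundle ω ℂ L 𝓘(ℂ, E)]
  {h : HermitianMetric E L} {ΩM : Form E M 2}
  {J J₁ J₂ : Set ℝ≥0∞} {I : Set ℝ} {φ f f₁ f₂ : ℝ → ℝ} {τ τ₁ τ₂ : Completion E L → ℝ}
  {Ω Ω₁ Ω₂ : Form (E × ℂ) (Completion E L) 2}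

theorem contDiffAt_comp_logNorm {u : ℝ → ℝ} {p : Completion E L}
    (h0 : p ∈ puncturedBundle E L) (hu : ContDiffAt ℝ ∞ u (h.logNorm p)) :
    ContDiffAt ℝ ∞ (fun y => u (h.logNorm ((chartAt (E × ℂ) p).symm y)))
      (chartAt (E × ℂ) p p) := by
  have hq := chart_mem_region p
  have hq2 := (mem_punctured_iff_chart p).mp h0
  have hlog := logNorm_eq_sgn_mul (h := h) (b := side p) hq hq2
  rw [chart_symm_chart] at hlog
  rw [hlog] at hu
  refine (ContDiffAt.fun_comp (f := fun y => sgn (side p) *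
    modelLog (frameNorm h (side p) p.base) y) _ hu (contDiffAt_const.mul
    (contDiffAt_modelLog (contDiffAt_frameNorm h (side p) hq) (frameNorm_pos h (side p) hq)
      hq2))).congr_of_eventuallyEq ?_
  filter_upwards [continuous_fst.continuousAt ((isOpen_region p.base).mem_nhds hq),
    continuous_snd.continuousAt (isOpen_ne.mem_nhds hq2)] with z hz hz0
  rw [chartAt_eq, logNorm_eq_sgn_mul hz hz0]

theorem scale_mem_subbundle_iff {c : ℝ}
    (hT : ∀ t, t ∈ logInterval J₁ ↔ t + c ∈ logInterval J₂)
    (hends : ∀ b : Bool, flip b 0 ∈ J₁ ↔ flip b 0 ∈ J₂) (p : Completion E L) :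
    scale (Real.exp c : ℂ) p ∈ h.subbundle J₂ ↔ p ∈ h.subbundle J₁ := by
  have ha : (Real.exp c : ℂ) ≠ 0 := by simp
  by_cases h0 : p ∈ puncturedBundle E L
  · rw [logNorm_mem_of_punctured ((scale_mem_punctured ha).mpr h0), logNorm_mem_of_punctured h0,
      logNorm_scale ha h0, hT]
    simp [Complex.norm_exp]
  · simp only [HermitianMetric.subbundle, mem_preimage]
    rw [extNormSq_of_notMem_punctured ((scale_mem_punctured ha).not.mpr h0),
      extNormSq_of_notMem_punctured h0, side_scale, hends]

theorem image_scale_subbundle {c : ℝ}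
    (hT : ∀ t, t ∈ logInterval J₁ ↔ t + c ∈ logInterval J₂)
    (hends : ∀ b : Bool, flip b 0 ∈ J₁ ↔ flip b 0 ∈ J₂) :
    scale (Real.exp c : ℂ) '' h.subbundle J₁ = h.subbundle J₂ := by
  have ha : (Real.exp c : ℂ) ≠ 0 := by simp
  ext p
  constructor
  · rintro ⟨p, hp, rfl⟩
    exact (scale_mem_subbundle_iff hT hends p).mpr hp
  · intro hp
    have e : scale (Real.exp c : ℂ) (scale (Real.exp c : ℂ)⁻¹ p) = p := by
      rw [scale_scale, mul_inv_cancel₀ ha, scale_one]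
    refine ⟨scale (Real.exp c : ℂ)⁻¹ p, ?_, e⟩
    rwa [← scale_mem_subbundle_iff hT hends, e]

/-- The homothety is holomorphic, covers the identity of the base and shifts `t` by `c`. So it
carries `f₂(t)` to `f₁(t) + k`, and `d d^c` ignores the constant. -/
theorem pullback_scale_of_punctured (h₁ : IsCalabiAnsatz h ΩM J₁ Ω₁ f₁)
    (h₂ : IsCalabiAnsatz h ΩM J₂ Ω₂ f₂) (hJ₁ : IsOpen J₁) (hJ₂ : IsOpen J₂) {c k : ℝ}
    (hf : ∀ t ∈ logInterval J₁, f₂ (t + c) = f₁ t + k) {p : Completion E L}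
    (hp : p ∈ h.subbundle J₁) (hp' : scale (Real.exp c : ℂ) p ∈ h.subbundle J₂)
    (h0 : p ∈ puncturedBundle E L) :
    pullback (scale (Real.exp c : ℂ)) Ω₂ p = Ω₁ p := by
  have ha : (Real.exp c : ℂ) ≠ 0 := by simp
  set Λ := scaleCLM E (flip (side p) (Real.exp c : ℂ)) with hΛ
  have h0' := (scale_mem_punctured ha).mpr h0
  have hT₁ := (logNorm_mem_of_punctured h0).mp hp
  have hT₂ := (logNorm_mem_of_punctured h0').mp hp'
  have hu₁ := contDiffAt_comp_logNorm h0
    (h₁.smooth.contDiffAt ((isOpen_logInterval hJ₁).mem_nhds hT₁))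
  have hu₂ := contDiffAt_comp_logNorm h0'
    (h₂.smooth.contDiffAt ((isOpen_logInterval hJ₂).mem_nhds hT₂))
  rw [pullback, differential_scale ha, ← hΛ, h₂.eq _ ⟨hp', h0'⟩, h₁.eq _ ⟨hp, h0⟩,
    pullback_base_eq, pullback_base_eq, ddc_eq (hu₂.of_le two_le_infty),
    ddc_eq (hu₁.of_le two_le_infty)]
  rw [chartAt_scale, chart_scale ha, ← hΛ] at hu₂ ⊢
  have h3 := flatDdc_comp (P := fun z => f₂ (h.logNorm ((chartAt (E × ℂ) p).symm z))) (ψ := Λ)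
    (y := chartAt (E × ℂ) p p) (hu₂.of_le two_le_infty) Λ.contDiff.contDiffAt
  have h4 : fderiv ℝ Λ (chartAt (E × ℂ) p p) = Λ.restrictScalars ℝ :=
    (Λ.restrictScalars ℝ).fderiv
  have h5 : (fun z => f₂ (h.logNorm ((chartAt (E × ℂ) p).symm (Λ z))))
      =ᶠ[𝓝 (chartAt (E × ℂ) p p)]
      fun z => f₁ (h.logNorm ((chartAt (E × ℂ) p).symm z)) + k := by
    have hs := chart_symm_chart p
    filter_upwards [continuous_snd.continuousAt
      (isOpen_ne.mem_nhds ((mem_punctured_iff_chart p).mp h0)),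
      eventually_mem_subbundle (h := h) (b := side p) hJ₁ (chart_mem_region p) (hs.symm ▸ hp)]
      with z hz0 hz
    have hz0' := (stdChart_symm_mem_punctured (b := side p) hz.1).mpr hz0
    have hz2 := (logNorm_mem_of_punctured hz0').mp hz.2
    rw [chartAt_eq, ← scale_chart_symm ha hz.1, logNorm_scale ha hz0', ← hf _ hz2]
    simp [Complex.norm_exp]
  rw [h4, flatDdc_congr h5, flatDdc_add_const] at h3
  rw [h3]
  rfl

theorem continuousAt_inChart (hΩ : IsSmoothOn Ω (h.subbundle J)) (hJ : IsOpen J)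
    {p : Completion E L} {y : E × ℂ} (hy : y ∈ (chartAt (E × ℂ) p).target)
    (hyJ : (chartAt (E × ℂ) p).symm y ∈ h.subbundle J) :
    ContinuousAt (inChart (chartAt (E × ℂ) p) Ω) y :=
  ((hΩ p).continuousOn).continuousAt (Filter.inter_mem
    ((chartAt (E × ℂ) p).open_target.mem_nhds hy)
    (((chartAt (E × ℂ) p).continuousAt_symm hy) (subbundle_mem_nhds hJ hyJ)))

/-- The ansatz says nothing on the sections. In a chart both forms are continuous and agree on the
dense set where the fibre coordinate is nonzero, so they agree everywhere. -/
theorem pullback_scale_eq {c : ℝ} (hΩ₁ : IsSmoothOn Ω₁ (h.subbundle J₁))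
    (hΩ₂ : IsSmoothOn Ω₂ (h.subbundle J₂)) (hJ₁ : IsOpen J₁) (hJ₂ : IsOpen J₂)
    (hmem : ∀ p : Completion E L,
      scale (Real.exp c : ℂ) p ∈ h.subbundle J₂ ↔ p ∈ h.subbundle J₁)
    (hpun : ∀ p ∈ h.subbundle J₁ ∩ puncturedBundle E L,
      pullback (scale (Real.exp c : ℂ)) Ω₂ p = Ω₁ p) {p : Completion E L}
    (hp : p ∈ h.subbundle J₁) : pullback (scale (Real.exp c : ℂ)) Ω₂ p = Ω₁ p := by
  have ha : (Real.exp c : ℂ) ≠ 0 := by simp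
  set a : ℂ := (Real.exp c : ℂ) with hadef
  set Λ := (scaleCLM E (flip (side p) a)).restrictScalars ℝ with hΛ
  have hps := mem_chart_target (E × ℂ) p
  have hs := (chartAt (E × ℂ) p).left_inv (mem_chart_source _ p)
  let A : ((E × ℂ) [⋀^Fin 2]→L[ℝ] ℝ) →L[ℝ] ((E × ℂ) [⋀^Fin 2]→L[ℝ] ℝ) :=
    ContinuousAlternatingMap.compContinuousLinearMapCLM Λ
  have hc₁ : ContinuousAt (inChart (chartAt (E × ℂ) p) Ω₁) (chartAt (E × ℂ) p p) :=
    continuousAt_inChart hΩ₁ hJ₁ hps (hs.symm ▸ hp)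
  have hΛp : Λ (chartAt (E × ℂ) p p) = chartAt (E × ℂ) p (scale a p) := (chart_scale ha p).symm
  have hp's : scale a p ∈ (chartAt (E × ℂ) p).source := by
    have := mem_chart_source (E × ℂ) (scale a p)
    rwa [chartAt_scale] at this
  have hc₂ : ContinuousAt (fun z => A (inChart (chartAt (E × ℂ) p) Ω₂ (Λ z)))
      (chartAt (E × ℂ) p p) := by
    refine A.continuous.continuousAt.comp (ContinuousAt.comp ?_ Λ.continuous.continuousAt)
    rw [hΛp]
    refine continuousAt_inChart hΩ₂ hJ₂ ((chartAt (E × ℂ) p).map_source hp's) ?_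
    rw [(chartAt (E × ℂ) p).left_inv hp's]
    exact (hmem p).mpr hp
  have hev : ∀ᶠ z in 𝓝[{z : E × ℂ | z.2 ≠ 0}] (chartAt (E × ℂ) p p),
      inChart (chartAt (E × ℂ) p) Ω₁ z = A (inChart (chartAt (E × ℂ) p) Ω₂ (Λ z)) := by
    have h1 := eventually_mem_subbundle (h := h) (b := side p) hJ₁ (chart_mem_region p)
      ((chart_symm_chart p).symm ▸ hp)
    filter_upwards [self_mem_nhdsWithin, mem_nhdsWithin_of_mem_nhds h1] with z hz0 hz
    have hzt : z ∈ (chartAt (E × ℂ) p).target := by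
      rw [chartAt_eq]; exact mem_stdChart_target.mpr hz.1
    have hz' : (chartAt (E × ℂ) p).symm z ∈ h.subbundle J₁ ∩ puncturedBundle E L := by
      rw [chartAt_eq]
      exact ⟨hz.2, (stdChart_symm_mem_punctured hz.1).mpr hz0⟩
    have hΛz : Λ z ∈ (chartAt (E × ℂ) p).target := by
      rw [chartAt_eq]; exact mem_stdChart_target.mpr hz.1
    have e1 : inChart (chartAt (E × ℂ) p) Ω₁ z =
        pullback (chartAt (E × ℂ) p).symm
          (pullback (scale a) Ω₂ : Form (E × ℂ) (Completion E L) 2) z := by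
      rw [inChart, pullback, pullback, hpun _ hz']
    have e2 : (fun y => scale a ((chartAt (E × ℂ) p).symm y)) =ᶠ[𝓝 z]
        fun y => (chartAt (E × ℂ) p).symm (Λ y) := by
      filter_upwards [continuous_fst.continuousAt ((isOpen_region p.base).mem_nhds hz.1)]
        with y hy
      rw [chartAt_eq]
      exact scale_chart_symm ha hy
    rw [e1, ← pullback_comp (F' := E × ℂ) (Ψ := scale (E := E) (L := L) a) Ω₂
      (mdifferentiableAt_scale ha _)
      (mdifferentiableAt_chart_symm p hzt), pullback_congr Ω₂ e2,
      pullback_comp (F' := E × ℂ) (Ψ := (chartAt (E × ℂ) p).symm) (Φ := Λ) Ω₂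
        (mdifferentiableAt_chart_symm p hΛz) Λ.differentiableAt.mdifferentiableAt]
    rw [pullback, differential_model, ContinuousLinearMap.fderiv]
    rfl
  have hdense : Dense {z : E × ℂ | z.2 ≠ 0} :=
    (dense_compl_singleton (0 : ℂ)).preimage isOpenMap_snd
  have := mem_closure_iff_nhdsWithin_neBot.mp (hdense (chartAt (E × ℂ) p p))
  have key := tendsto_nhds_unique_of_eventuallyEq (hc₁.tendsto.mono_left nhdsWithin_le_nhds)
    (hc₂.tendsto.mono_left nhdsWithin_le_nhds) hev
  have e3 := inChart_self Ω₂ (scale a p)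
  rw [chartAt_scale] at e3
  rw [inChart_self, hΛp, e3] at key
  rw [key, pullback, differential_scale ha]
  rfl

variable [Nonempty M]

/-- `f₁'` and `f₂'` solve the same equation with the same image, so they differ by a translation;
`f₂(t + c) - f₁(t)` then has zero derivative on an interval. -/
theorem IsAdapted.exists_translation (hA₁ : IsAdapted h I φ J₁ Ω₁ f₁ τ₁)
    (hA₂ : IsAdapted h I φ J₂ Ω₂ f₂ τ₂) (hne : (interior I).Nonempty)
    (hφ : IsMomentumProfile I φ) :
    (logInterval J₁).Nonempty ∧ (logInterval J₂).Nonempty ∧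
    ∃ c k : ℝ, (∀ t, t ∈ logInterval J₁ ↔ t + c ∈ logInterval J₂) ∧
      ∀ t ∈ logInterval J₁, f₂ (t + c) = f₁ t + k := by
  have hsub : interior I ⊆ I ∩ {s | 0 < φ s} := fun s hs => ⟨interior_subset hs, hφ.pos s hs⟩
  have hne₁ : (logInterval J₁).Nonempty := by
    rw [← image_nonempty (f := deriv f₁), hA₁.image_logInterval]
    exact hne.mono hsub
  have hne₂ : (logInterval J₂).Nonempty := by
    rw [← image_nonempty (f := deriv f₂), hA₂.image_logInterval]
    exact hne.mono hsub
  have ho := isOpen_logInterval hA₂.isOpen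
  have hσ₂ : ContDiffOn ℝ ∞ (deriv f₂) (logInterval J₂) :=
    ((contDiffOn_infty_iff_derivWithin ho.uniqueDiffOn).mp hA₂.smooth).2.congr fun t ht =>
      (derivWithin_of_isOpen ho ht).symm
  have hoc : (deriv f₂ '' logInterval J₂).OrdConnected :=
    (hA₂.ordConnected_logInterval.isPreconnected.image _ hσ₂.continuousOn).ordConnected
  have hu : UniqueDiffOn ℝ (deriv f₂ '' logInterval J₂) := by
    refine uniqueDiffOn_convex hoc.convex (hne.mono (interior_maximal ?_ isOpen_interior))
    rw [hA₂.image_logInterval]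
    exact hsub
  obtain ⟨c, hc, hσ⟩ := MomentumConstruction.exists_translation hA₁.ordConnected_logInterval
    hA₂.ordConnected_logInterval ho hne₁ (fun t ht => (hA₁.momentum ht).2.2)
    (fun t ht => (hA₂.momentum ht).2.2) (fun t ht => (hA₂.momentum ht).2.1) hσ₂
    (hA₁.image_logInterval.trans hA₂.image_logInterval.symm) hu
  obtain ⟨t₁, ht₁⟩ := hne₁
  refine ⟨⟨t₁, ht₁⟩, hne₂, c, f₂ (t₁ + c) - f₁ t₁, hc, fun t ht => ?_⟩
  have hd : ∀ t ∈ logInterval J₁,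
      HasDerivWithinAt (fun t => f₂ (t + c) - f₁ t) 0 (logInterval J₁) t := by
    intro t ht
    have h1 := ((hA₁.contDiffAt ht).differentiableAt (by simp)).hasDerivAt
    have h2 := ((hA₂.contDiffAt ((hc t).mp ht)).differentiableAt (by simp)).hasDerivAt
    have h3 := (h2.comp_add_const t c).sub h1
    rw [hσ t ht, sub_self] at h3
    exact h3.hasDerivWithinAt
  have := eq_of_hasDerivWithinAt_zero hA₁.ordConnected_logInterval hd ht ht₁
  linarith

theorem IsMomentumMetric.homotheticallyIsometric (hne : (interior I).Nonempty)
    (hφ : IsMomentumProfile I φ) (hc : ClosesUp I φ)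
    (h₁ : IsMomentumMetric h ΩM I φ J₁ Ω₁) (h₂ : IsMomentumMetric h ΩM I φ J₂ Ω₂) :
    HomotheticallyIsometric h J₁ Ω₁ J₂ Ω₂ := by
  obtain ⟨f₁, τ₁, hC₁, hm₁, hτ₁, him₁, hg₁⟩ := h₁.momentum
  obtain ⟨f₂, τ₂, hC₂, hm₂, hτ₂, him₂, hg₂⟩ := h₂.momentum
  have hA₁ : IsAdapted h I φ J₁ Ω₁ f₁ τ₁ :=
    ⟨h₁.isOpen, h₁.ordConnected, h₁.kahler.positive, hC₁.smooth, hm₁, hτ₁, him₁, hg₁⟩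
  have hA₂ : IsAdapted h I φ J₂ Ω₂ f₂ τ₂ :=
    ⟨h₂.isOpen, h₂.ordConnected, h₂.kahler.positive, hC₂.smooth, hm₂, hτ₂, him₂, hg₂⟩
  obtain ⟨hne₁, hne₂, c, k, hT, hf⟩ := hA₁.exists_translation hA₂ hne hφ
  have hends (b : Bool) : flip b 0 ∈ J₁ ↔ flip b 0 ∈ J₂ :=
    (hA₁.flip_zero_mem_iff hc hne₁ b).trans (hA₂.flip_zero_mem_iff hc hne₂ b).symm
  have hmem := scale_mem_subbundle_iff (h := h) hT hends
  have ha : (Real.exp c : ℂ) ≠ 0 := by simp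
  refine ⟨Real.exp c, Real.exp_pos c, image_scale_subbundle hT hends, fun p hp v w => ?_⟩
  rw [kahlerMetric, kahlerMetric, ← pullback_scale_eq h₁.kahler.smooth h₂.kahler.smooth h₁.isOpen
    h₂.isOpen hmem (fun p hp => pullback_scale_of_punctured hC₁ hC₂ h₁.isOpen h₂.isOpen hf hp.1
      ((hmem p).mpr hp.1) hp.2) hp, pullback,
    ContinuousAlternatingMap.compContinuousLinearMap_apply]
  congr 1
  ext1 i
  fin_cases i
  · rfl
  -- The metric contains `J w` in its second slot, and the differential of the homothety is complex
  -- linear.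
  · simp only [differential_scale ha]
    exact ((scaleCLM E (flip (side p) (Real.exp c : ℂ))).map_smul Complex.I w).symm

/-- The momentum construction, for profiles that close up at the ends of the interval. -/
theorem exists_and_unique_momentumMetric (hdata : IsHorizontalData h ΩM I)
    (hφ : IsMomentumProfile I φ) (hc : ClosesUp I φ) :
    (∃ J Ω, IsMomentumMetric h ΩM I φ J Ω) ∧
      ∀ J₁ Ω₁ J₂ Ω₂, IsMomentumMetric h ΩM I φ J₁ Ω₁ → IsMomentumMetric h ΩM I φ J₂ Ω₂ →
        HomotheticallyIsometric h J₁ Ω₁ J₂ Ω₂ := by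
  obtain ⟨J, f, a, G, S, hP⟩ :=
    exists_potentialData hdata.ordConnected hdata.nondegenerate hφ hc
  exact ⟨⟨J, _, hP.isMomentumMetric h hdata⟩, fun _ _ _ _ h₁ h₂ =>
    h₁.homotheticallyIsometric hdata.nondegenerate hφ hc h₂⟩

end Isometry

/-- An open set has no least or greatest element, so the endpoint conditions are void. Part (a) thus
becomes part (b) for the interior of `I`. -/
theorem closesUp_interior (I : Set ℝ) (φ : ℝ → ℝ) : ClosesUp (interior I) φ where
  lower _ ha := absurd ((interior_interior (s := I)).symm ▸ ha.1)
    (isEnd_false.mpr ha).notMem_interior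
  upper _ hb := absurd ((interior_interior (s := I)).symm ▸ hb.1)
    (isEnd_true.mpr hb).notMem_interior

theorem IsMomentumProfile.interior {I : Set ℝ} {φ : ℝ → ℝ} (hφ : IsMomentumProfile I φ) :
    IsMomentumProfile (interior I) φ where
  smooth := hφ.smooth.mono (closure_mono interior_subset)
  pos s hs := hφ.pos s (interior_subset hs)

end MomentumConstruction

end

theorem mainTheorem5
    {E : Type*} [NormedAddCommGroup E] [NormedSpace ℂ E] [FiniteDimensional ℂ E]
    {M : Type*} [TopologicalSpace M] [ChartedSpace E M] [IsManifold 𝓘(ℂ, E) ω M] [Nonempty M]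
    {L : M → Type*} [∀ x, AddCommGroup (L x)] [∀ x, Module ℂ (L x)]
    [TopologicalSpace (TotalSpace ℂ L)] [∀ x, TopologicalSpace (L x)]
    [FiberBundle ℂ L] [VectorBundle ℂ ℂ L] [ContMDiffVectorBundle ω ℂ L 𝓘(ℂ, E)]
    (h : MomentumConstruction.HermitianMetric E L)
    (ΩM : MomentumConstruction.Form E M 2) (I : Set ℝ) (φ : ℝ → ℝ)
    (hdata : MomentumConstruction.IsHorizontalData h ΩM I)
    (hφ : MomentumConstruction.IsMomentumProfile I φ) :
    ((∃ J Ω, MomentumConstruction.IsMomentumMetric h ΩM (interior I) φ J Ω) ∧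
      ∀ J₁ Ω₁ J₂ Ω₂,
        MomentumConstruction.IsMomentumMetric h ΩM (interior I) φ J₁ Ω₁ →
        MomentumConstruction.IsMomentumMetric h ΩM (interior I) φ J₂ Ω₂ →
        MomentumConstruction.HomotheticallyIsometric h J₁ Ω₁ J₂ Ω₂) ∧
    (MomentumConstruction.ClosesUp I φ →
      (∃ J Ω, MomentumConstruction.IsMomentumMetric h ΩM I φ J Ω) ∧
      ∀ J₁ Ω₁ J₂ Ω₂,
        MomentumConstruction.IsMomentumMetric h ΩM I φ J₁ Ω₁ →
        MomentumConstruction.IsMomentumMetric h ΩM I φ J₂ Ω₂ →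
        MomentumConstruction.HomotheticallyIsometric h J₁ Ω₁ J₂ Ω₂) := by
  have hdata' : MomentumConstruction.IsHorizontalData h ΩM (interior I) :=
    ⟨hdata.kahler, hdata.ordConnected.interior, by
      rw [interior_interior]; exact hdata.nondegenerate,
      fun s hs => hdata.compatible s (interior_subset hs)⟩
  exact ⟨MomentumConstruction.exists_and_unique_momentumMetric hdata' hφ.interior
    (MomentumConstruction.closesUp_interior I φ),
    fun hc => MomentumConstruction.exists_and_unique_momentumMetric hdata hφ hc⟩
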